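/- Let $(M,c)$ be a conformal manifold of dimension $n\ge 3$ and signature $(p,q)$: $M$ is a smooth $n$-manifold and $c$ is an equivalence class of smooth metrics of signature $(p,q)$, where $\hat g\sim g$ means $\hat g=\Omega^2 g$ for some smooth positive function $\Omega$. Let $\mathcal Q\subset S^2T^*M$ be the ray bundle of values of metrics in $c$; let $\mathcal E[w]$ be the line bundle whose sections are the functions on $\mathcal Q$ with $f(s^2q)=s^wf(q)$ for $s>0$; put $\mathcal E_a[w]=T^*M\otimes\mathcal E[w]$; and let $\mathbf g_{ab}$ be the conformal metric (the tautological section of $S^2T^*M[2]$), which is used to raise and lower indices. A metric $g\in c$ is called a scale. For $g\in c$ let $\nabla$ be its Levi-Civita connection, acting also on densities (it is the flat connection on $\mathcal E[w]$ for which the densities that are constant on the section $g$ of $\mathcal Q$ are parallel), and let $P_{ab}$ be its Schouten tensor, so $\mathrm{Ric}_{ab}=(n-2)P_{ab}+J g_{ab}$ with $J=g^{ab}P_{ab}$. Put $[\mathcal T]_g=\mathcal E[1]\oplus\mathcal E_a[1]\oplus\mathcal E[-1]$ and, for sections $(\sigma,\mu_b,\rho)$ of $[\mathcal T]_g$, $$\nabla^{\mathcal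 T}_a\begin{pmatrix}\sigma\\ \mu_b\\ \rho\end{pmatrix}=\begin{pmatrix}\nabla_a\sigma-\mu_a\\ \nabla_a\mu_b+\mathbf g_{ab}\rho+P_{ab}\sigma\\ \nabla_a\rho-P_{ab}\mu^b\end{pmatrix}.\qquad(*)$$ For $\hat g=\Omega^2g$ and $\Upsilon=\Omega^{-1}d\Omega$, identify $(\sigma,\mu_b,\rho)\in[\mathcal T]_g$ with $$(\hat\sigma,\hat\mu_b,\hat\rho)=\bigl(\sigma,\ \mu_b+\Upsilon_b\sigma,\ \rho-\Upsilon^b\mu_b-\tfrac12\Upsilon^b\Upsilon_b\,\sigma\bigr)\in[\mathcal T]_{\hat g}.\qquad(**)$$ This is an equivalence relation on $\bigsqcup_{g\in c}[\mathcal T]_g$, and its quotient $\mathcal T$ is the standard tractor bundle. Then: 1. for each $g\in c$, $(*)$ is a smooth linear connection on $[\mathcal T]_g$; 2. for $\hat g=\Omega^2g$, the map $(**)$ intertwines the operator $(*)$ of $g$ with the operator $(*)$ of $\hat g$; 3. each $g\in c$ identifies $[\mathcal T]_g$ with $\mathcal T$ as smooth vector bundles; 4. there is a smooth linear connection $\nabla^{\mathcal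 T}$ on $\mathcal T$ which under the identification $\mathcal T\cong[\mathcal T]_g$ is given by $(*)$ for every $g\in c$, and it is the only connection on $\mathcal T$ that is given by $(*)$ for even one $g\in c$. -/

import Mathlib

open Bundle
open scoped Manifold ContDiff

set_option maxSynthPendingDepth 3
set_option linter.unusedSectionVars false

noncomputable section
namespace BundleTransport

variable {B : Type*} [TopologicalSpace B] {F : Type*} [NormedAddCommGroup F] [NormedSpace ℝ F]
  {V V' : B → Type*} [∀ b, AddCommGroup (V b)] [∀ b, Module ℝ (V b)]
  [∀ b, AddCommGroup (V' b)] [∀ b, Module ℝ (V' b)]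

/-- The bijection of total spaces induced by fibrewise linear isomorphisms. -/
def totalEquiv (F : Type*) (φ : ∀ b, V' b ≃ₗ[ℝ] V b) : TotalSpace F V' ≃ TotalSpace F V where
  toFun z := ⟨z.1, φ z.1 z.2⟩
  invFun z := ⟨z.1, (φ z.1).symm z.2⟩
  left_inv z := by simp
  right_inv z := by simp

variable [TopologicalSpace (TotalSpace F V)] [∀ b, TopologicalSpace (V b)]
  [TopologicalSpace (TotalSpace F V')] [∀ b, TopologicalSpace (V' b)]

/-- `totalEquiv` as a homeomorphism. -/
def totalHomeomorph (φ : ∀ b, V' b ≃ₗ[ℝ] V b) (hF : Topology.IsInducing (totalEquiv F φ)) :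
    TotalSpace F V' ≃ₜ TotalSpace F V :=
  (totalEquiv F φ).toHomeomorphOfIsInducing hF

/-- A local trivialization of `V` carried over to `V'`. -/
def trivialization (φ : ∀ b, V' b ≃ₗ[ℝ] V b) (hF : Topology.IsInducing (totalEquiv F φ))
    (e : Trivialization F (π F V)) : Trivialization F (π F V') :=
  e.compHomeomorph (totalHomeomorph φ hF)

/-- The fibre bundle structure carried over along fibrewise linear isomorphisms. -/
@[reducible] def fiberBundle [FiberBundle F V] (φ : ∀ b, V' b ≃ₗ[ℝ] V b)
    (hφ : ∀ b, Topology.IsInducing (φ b)) (hF : Topology.IsInducing (totalEquiv F φ)) :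
    FiberBundle F V' where
  totalSpaceMk_isInducing' b := by
    rw [← hF.of_comp_iff]
    exact (FiberBundle.totalSpaceMk_isInducing F V b).comp (hφ b)
  trivializationAtlas' := {e' | ∃ e ∈ FiberBundle.trivializationAtlas F V,
    e' = trivialization φ hF e}
  trivializationAt' b := trivialization φ hF (trivializationAt F V b)
  mem_baseSet_trivializationAt' b := FiberBundle.mem_baseSet_trivializationAt F V b
  trivialization_mem_atlas' b := ⟨_, FiberBundle.trivialization_mem_atlas F V b, rfl⟩

theorem trivialization_isLinear (φ : ∀ b, V' b ≃ₗ[ℝ] V b)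
    (hF : Topology.IsInducing (totalEquiv F φ)) (e : Trivialization F (π F V)) [e.IsLinear ℝ] :
    (trivialization φ hF e).IsLinear ℝ where
  linear b hb := by
    have h := (e.linear ℝ (b := b) hb)
    constructor
    · intro x y
      have := h.map_add (φ b x) (φ b y)
      rw [← map_add] at this
      exact this
    · intro a x
      have := h.map_smul a (φ b x)
      rw [← map_smul] at this
      exact this

theorem coordChangeL_eq (φ : ∀ b, V' b ≃ₗ[ℝ] V b)
    (hF : Topology.IsInducing (totalEquiv F φ)) (e e' : Trivialization F (π F V))
    [e.IsLinear ℝ] [e'.IsLinear ℝ] [(trivialization φ hF e).IsLinear ℝ]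
    [(trivialization φ hF e').IsLinear ℝ] {b : B} (hb : b ∈ e.baseSet ∩ e'.baseSet) :
    (trivialization φ hF e).coordChangeL ℝ (trivialization φ hF e') b = e.coordChangeL ℝ e' b := by
  ext y
  have h1 := Trivialization.coordChangeL_apply' (R := ℝ) (trivialization φ hF e)
    (trivialization φ hF e') (b := b) hb y
  have h2 := Trivialization.coordChangeL_apply' (R := ℝ) e e' (b := b) hb y
  have h3 : (trivialization φ hF e).toOpenPartialHomeomorph.symm (b, y) =
      (totalHomeomorph φ hF).symm (e.toOpenPartialHomeomorph.symm (b, y)) := rfl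
  have h4 : ∀ z, trivialization φ hF e' z = e' (totalHomeomorph φ hF z) := fun z => rfl
  rw [h3, h4, Homeomorph.apply_symm_apply] at h1
  exact h1.trans h2.symm

theorem vectorBundle [FiberBundle F V] [VectorBundle ℝ F V] (φ : ∀ b, V' b ≃ₗ[ℝ] V b)
    (hφ : ∀ b, Topology.IsInducing (φ b)) (hF : Topology.IsInducing (totalEquiv F φ)) :
    letI := fiberBundle φ hφ hF
    VectorBundle ℝ F V' := by
  let _ := fiberBundle φ hφ hF
  refine ⟨?_, ?_⟩
  · rintro _ ⟨e, he, rfl⟩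
    have : MemTrivializationAtlas e := ⟨he⟩
    exact trivialization_isLinear φ hF e
  · rintro _ _ ⟨e, he, rfl⟩ ⟨e', he', rfl⟩
    have : MemTrivializationAtlas e := ⟨he⟩
    have : MemTrivializationAtlas e' := ⟨he'⟩
    have := trivialization_isLinear φ hF e
    have := trivialization_isLinear φ hF e'
    refine (continuousOn_coordChange ℝ e e').congr fun b hb => ?_
    rw [coordChangeL_eq φ hF e e' hb]

theorem contMDiffVectorBundle {E H : Type*} [NormedAddCommGroup E] [NormedSpace ℝ E]
    [TopologicalSpace H] [ChartedSpace H B] {I : ModelWithCorners ℝ E H} {n : ℕ∞ω}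
    [FiberBundle F V] [VectorBundle ℝ F V] [ContMDiffVectorBundle n F V I]
    (φ : ∀ b, V' b ≃ₗ[ℝ] V b)
    (hφ : ∀ b, Topology.IsInducing (φ b)) (hF : Topology.IsInducing (totalEquiv F φ)) :
    letI := fiberBundle φ hφ hF
    letI := vectorBundle φ hφ hF
    ContMDiffVectorBundle n F V' I := by
  let _ := fiberBundle φ hφ hF
  let _ := vectorBundle φ hφ hF
  refine ⟨?_⟩
  rintro _ _ ⟨e, he, rfl⟩ ⟨e', he', rfl⟩
  have : MemTrivializationAtlas e := ⟨he⟩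
  have : MemTrivializationAtlas e' := ⟨he'⟩
  have := trivialization_isLinear φ hF e
  have := trivialization_isLinear φ hF e'
  refine (contMDiffOn_coordChangeL (n := n) (IB := I) e e').congr fun b hb => ?_
  rw [coordChangeL_eq φ hF e e' hb]

theorem isTopologicalAddGroup {X Y : Type*} [AddCommGroup X] [Module ℝ X] [AddCommGroup Y]
    [Module ℝ Y] [TopologicalSpace X] [TopologicalSpace Y] [IsTopologicalAddGroup Y]
    (φ : X ≃ₗ[ℝ] Y) (h : Topology.IsInducing φ) : IsTopologicalAddGroup X :=
  h.topologicalAddGroup φ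

theorem continuousSMul {X Y : Type*} [AddCommGroup X] [Module ℝ X] [AddCommGroup Y]
    [Module ℝ Y] [TopologicalSpace X] [TopologicalSpace Y] [ContinuousSMul ℝ Y]
    (φ : X ≃ₗ[ℝ] Y) (h : Topology.IsInducing φ) : ContinuousSMul ℝ X :=
  h.continuousSMul continuous_id (map_smul φ _ _)

end BundleTransport

/-! ## Local pseudo-Riemannian geometry on (open subsets of) a vector space -/

namespace LocalMetric

variable {E : Type*} [NormedAddCommGroup E] [NormedSpace ℝ E]

/-- The 1-form valued bilinear map `(u, v) ↦ D(u, v, ·) + D(v, u, ·) - D(·, u, v)`. -/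
def koszul (D : E →L[ℝ] E →L[ℝ] E →L[ℝ] ℝ) : E →L[ℝ] E →L[ℝ] E →L[ℝ] ℝ :=
  D + D.flip -
    (ContinuousLinearMap.flipₗᵢ ℝ E E ℝ).toContinuousLinearEquiv.toContinuousLinearMap.comp D.flip

theorem koszul_apply (D : E →L[ℝ] E →L[ℝ] E →L[ℝ] ℝ) (u v w : E) :
    koszul D u v w = D u v w + D v u w - D w u v := rfl

/-- The Christoffel symbols of a metric `G` given in coordinates:
`Γ(u, v) = ½ G⁻¹ (∂_u G(v, ·) + ∂_v G(u, ·) - ∂_· G(u, v))`, that is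
`Γⁱⱼₖ = ½ gⁱˡ (∂ₖ gₗⱼ + ∂ⱼ gₗₖ - ∂ₗ gⱼₖ)`. -/
def christoffel (G : E → E →L[ℝ] E →L[ℝ] ℝ) (y : E) : E →L[ℝ] E →L[ℝ] E :=
  (1 / 2 : ℝ) • (ContinuousLinearMap.compL ℝ E (E →L[ℝ] ℝ) E (G y).inverse).comp
    (koszul (fderiv ℝ G y))

theorem christoffel_apply (G : E → E →L[ℝ] E →L[ℝ] ℝ) (y u v : E) :
    christoffel G y u v = (1 / 2 : ℝ) • (G y).inverse (koszul (fderiv ℝ G y) u v) := rfl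

/-- The curvature `R(u, v) w` in coordinates, where
`R(u, v) w = ∇_u ∇_v w - ∇_v ∇_u w` for constant `u`, `v`, `w`. -/
def riemann (G : E → E →L[ℝ] E →L[ℝ] ℝ) (y u v w : E) : E :=
  fderiv ℝ (christoffel G) y u v w - fderiv ℝ (christoffel G) y v u w
    + christoffel G y u (christoffel G y v w) - christoffel G y v (christoffel G y u w)

/-- The endomorphism `u ↦ R(u, v) w`. -/
def riemannEnd (G : E → E →L[ℝ] E →L[ℝ] ℝ) (y v w : E) : E →ₗ[ℝ] E where
  toFun u := riemann G y u v w
  map_add' a b := by simp only [riemann, map_add, add_apply]; abel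
  map_smul' t a := by
    simp only [riemann, map_smul, smul_apply, RingHom.id_apply, smul_add, smul_sub]

/-- The Ricci tensor in coordinates, `Ric(v, w) = tr (u ↦ R(u, v) w)`. -/
def ricci [FiniteDimensional ℝ E] (G : E → E →L[ℝ] E →L[ℝ] ℝ) (y : E) : E →L[ℝ] E →L[ℝ] ℝ :=
  (LinearMap.mk₂ ℝ (fun v w => LinearMap.trace ℝ E (riemannEnd G y v w))
    (fun a b w => by
      rw [← map_add]; congr 1; ext u
      change riemann G y u (a + b) w = riemann G y u a w + riemann G y u b w
      simp only [riemann, map_add, add_apply]; abel)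
    (fun t a w => by
      rw [← map_smul]; congr 1; ext u
      change riemann G y u (t • a) w = t • riemann G y u a w
      simp only [riemann, map_smul, smul_apply, smul_add, smul_sub])
    (fun v a b => by
      rw [← map_add]; congr 1; ext u
      change riemann G y u v (a + b) = riemann G y u v a + riemann G y u v b
      simp only [riemann, map_add]; abel)
    (fun t v a => by
      rw [← map_smul]; congr 1; ext u
      change riemann G y u v (t • a) = t • riemann G y u v a
      simp only [riemann, map_smul, smul_add, smul_sub])).toContinuousBilinearMap

end LocalMetric

/-! ## Pseudo-Riemannian metrics on a manifold -/

/-- A bilinear form has signature `(p, q)` if in suitable linear coordinates its quadratic form is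
a sum of `p` squares minus a sum of `q` squares. -/
def HasSignature {W : Type*} [AddCommGroup W] [Module ℝ W] (b : W → W → ℝ) (p q : ℕ) : Prop :=
  ∃ e : W ≃ₗ[ℝ] (Fin p → ℝ) × (Fin q → ℝ),
    ∀ v, b v v = ∑ i, (e v).1 i ^ 2 - ∑ j, (e v).2 j ^ 2

/-- A smooth pseudo-Riemannian metric of signature `(p, q)` on a manifold `M` modelled on `E`. -/
@[ext]
structure PseudoRiemannianMetric (E : Type*) [NormedAddCommGroup E] [NormedSpace ℝ E]
    (M : Type*) [TopologicalSpace M] [ChartedSpace E M] [IsManifold 𝓘(ℝ, E) ∞ M] (p q : ℕ) where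
  /-- the value of the metric at a point -/
  val : ∀ x : M, TangentSpace 𝓘(ℝ, E) x →L[ℝ] TangentSpace 𝓘(ℝ, E) x →L[ℝ] ℝ
  symm : ∀ x v w, val x v w = val x w v
  nondegenerate : ∀ x v, (∀ w, val x v w = 0) → v = 0
  signature : ∀ x, HasSignature (fun v w => val x v w) p q
  contMDiff : ContMDiff 𝓘(ℝ, E) (𝓘(ℝ, E).prod 𝓘(ℝ, E →L[ℝ] E →L[ℝ] ℝ)) ∞
    (fun x => TotalSpace.mk' (E →L[ℝ] E →L[ℝ] ℝ) x (val x))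

section Geometry

variable {E : Type*} [NormedAddCommGroup E] [NormedSpace ℝ E]
  {M : Type*} [TopologicalSpace M] [ChartedSpace E M] [IsManifold 𝓘(ℝ, E) ∞ M]

/-- The cotangent space at `x`. -/
abbrev Cotangent (E : Type*) [NormedAddCommGroup E] [NormedSpace ℝ E]
    {M : Type*} [TopologicalSpace M] [ChartedSpace E M] (x : M) : Type _ :=
  TangentSpace 𝓘(ℝ, E) x →L[ℝ] Bundle.Trivial M ℝ x

/-- The coordinate frame at the point `y` of the chart around `x₀`: it sends a constant vector
`u : E` to the value at `y` of the vector field with constant components `u` in that chart. -/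
def chartFrame (E : Type*) [NormedAddCommGroup E] [NormedSpace ℝ E] {M : Type*}
    [TopologicalSpace M] [ChartedSpace E M] [IsManifold 𝓘(ℝ, E) ∞ M] (x₀ y : M) :
    E →L[ℝ] TangentSpace 𝓘(ℝ, E) y :=
  (trivializationAt E (TangentSpace 𝓘(ℝ, E)) x₀).symmL ℝ y

/-- The components, in the chart around `x₀`, of a tangent vector at `y`. -/
def chartCoframe (E : Type*) [NormedAddCommGroup E] [NormedSpace ℝ E] {M : Type*}
    [TopologicalSpace M] [ChartedSpace E M] [IsManifold 𝓘(ℝ, E) ∞ M] (x₀ y : M) :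
    TangentSpace 𝓘(ℝ, E) y →L[ℝ] E :=
  (trivializationAt E (TangentSpace 𝓘(ℝ, E)) x₀).continuousLinearMapAt ℝ y

/-- Pull back of a bilinear form by a linear map. -/
def pullForm {X Y : Type*} [AddCommGroup X] [Module ℝ X] [TopologicalSpace X]
    [AddCommGroup Y] [Module ℝ Y] [TopologicalSpace Y]
    (b : Y →L[ℝ] Y →L[ℝ] ℝ) (L : X →L[ℝ] Y) : X →L[ℝ] X →L[ℝ] ℝ :=
  (ContinuousLinearMap.precomp ℝ L) ∘L b ∘L L

namespace PseudoRiemannianMetric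

variable {p q : ℕ} (g : PseudoRiemannianMetric E M p q)

/-- The components `g_{ij}` of the metric in the chart around `x₀`, as a function of the
coordinates. -/
def inChart (x₀ : M) (y : E) : E →L[ℝ] E →L[ℝ] ℝ :=
  pullForm (g.val ((extChartAt 𝓘(ℝ, E) x₀).symm y))
    (chartFrame E x₀ ((extChartAt 𝓘(ℝ, E) x₀).symm y))

/-- The Levi-Civita covariant derivative `∇_v μ` of a 1-form at `x`, computed in the chart
around `x`: `(∇_v μ)ⱼ = ∂_v μⱼ - Γ(v, eⱼ)ⁱ μᵢ`. -/
def leviCivita (μ : ∀ y : M, Cotangent E y) (x : M) (v : TangentSpace 𝓘(ℝ, E) x) :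
    Cotangent E x :=
  (mvfderiv 𝓘(ℝ, E) (fun y => ((μ y) ∘L (chartFrame E x y) : E →L[ℝ] ℝ)) x v
    - ((μ x) ∘L (chartFrame E x x)) ∘L
        LocalMetric.christoffel (g.inChart x) (extChartAt 𝓘(ℝ, E) x x) (chartCoframe E x x v))
    ∘L chartCoframe E x x

variable [FiniteDimensional ℝ E]

/-- The Ricci tensor. -/
def ricci (x : M) : TangentSpace 𝓘(ℝ, E) x →L[ℝ] TangentSpace 𝓘(ℝ, E) x →L[ℝ] ℝ :=
  pullForm (LocalMetric.ricci (g.inChart x) (extChartAt 𝓘(ℝ, E) x x)) (chartCoframe E x x)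

/-- The scalar curvature `g^{ab} Ric_{ab}`. -/
def scalar (x : M) : ℝ :=
  LinearMap.trace ℝ (TangentSpace 𝓘(ℝ, E) x) ((g.val x).inverse ∘L g.ricci x).toLinearMap

/-- The Schouten tensor `P`, determined by `Ric = (n - 2) P + J g` with `J = g^{ab} P_{ab}`, i.e.
`P = (Ric - Sc / (2 (n - 1)) g) / (n - 2)`. -/
def schouten (x : M) : TangentSpace 𝓘(ℝ, E) x →L[ℝ] TangentSpace 𝓘(ℝ, E) x →L[ℝ] ℝ :=
  ((Module.finrank ℝ E : ℝ) - 2)⁻¹ •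
    (g.ricci x - (g.scalar x / (2 * ((Module.finrank ℝ E : ℝ) - 1))) • g.val x)

end PseudoRiemannianMetric

end Geometry

/-! ## Conformal structures and weighted bundles -/

/-- `ĝ = Ω² g` with `Ω` a smooth positive function. -/
structure IsRescaling {E : Type*} [NormedAddCommGroup E] [NormedSpace ℝ E]
    {M : Type*} [TopologicalSpace M] [ChartedSpace E M] [IsManifold 𝓘(ℝ, E) ∞ M] {p q : ℕ}
    (Ω : M → ℝ) (g g' : PseudoRiemannianMetric E M p q) : Prop where
  smooth : ContMDiff 𝓘(ℝ, E) 𝓘(ℝ) ∞ Ω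
  pos : ∀ x, 0 < Ω x
  eq : ∀ x, g'.val x = Ω x ^ 2 • g.val x

/-- A conformal structure of signature `(p, q)`: a conformal equivalence class of metrics. -/
structure ConformalStructure (E : Type*) [NormedAddCommGroup E] [NormedSpace ℝ E]
    (M : Type*) [TopologicalSpace M] [ChartedSpace E M] [IsManifold 𝓘(ℝ, E) ∞ M] (p q : ℕ) where
  /-- the metrics in the class -/
  carrier : Set (PseudoRiemannianMetric E M p q)
  nonempty : carrier.Nonempty
  mem_iff : ∀ g ∈ carrier, ∀ g', g' ∈ carrier ↔ ∃ Ω : M → ℝ, IsRescaling Ω g g'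

section Rescaling

variable {E : Type*} [NormedAddCommGroup E] [NormedSpace ℝ E]
  {M : Type*} [TopologicalSpace M] [ChartedSpace E M] [IsManifold 𝓘(ℝ, E) ∞ M] {p q : ℕ}

/-- `Υ = Ω⁻¹ dΩ`. -/
def upsilon (E : Type*) [NormedAddCommGroup E] [NormedSpace ℝ E] {M : Type*} [TopologicalSpace M]
    [ChartedSpace E M] (Ω : M → ℝ) (x : M) : Cotangent E x :=
  (Ω x)⁻¹ • mvfderiv 𝓘(ℝ, E) Ω x

namespace IsRescaling

variable {g g' g'' : PseudoRiemannianMetric E M p q} {Ω Ω' : M → ℝ}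

theorem refl (g : PseudoRiemannianMetric E M p q) : IsRescaling (fun _ => 1) g g :=
  ⟨contMDiff_const, fun _ => one_pos, fun x => by simp⟩

theorem symm (h : IsRescaling Ω g g') : IsRescaling (fun x => (Ω x)⁻¹) g' g :=
  ⟨fun x => (h.smooth x).inv₀ (h.pos x).ne', fun x => inv_pos.2 (h.pos x), fun x => by
    rw [h.eq x, smul_smul, ← mul_pow, inv_mul_cancel₀ (h.pos x).ne', one_pow, one_smul]⟩

theorem trans (h : IsRescaling Ω g g') (h' : IsRescaling Ω' g' g'') :
    IsRescaling (fun x => Ω' x * Ω x) g g'' :=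
  ⟨h'.smooth.mul h.smooth, fun x => mul_pos (h'.pos x) (h.pos x), fun x => by
    rw [h'.eq x, h.eq x, smul_smul, mul_pow]⟩

theorem mdifferentiableAt (h : IsRescaling Ω g g') (x : M) :
    MDifferentiableAt 𝓘(ℝ, E) 𝓘(ℝ) Ω x :=
  (h.smooth x).mdifferentiableAt (by simp)

theorem upsilon_trans (h : IsRescaling Ω g g') (h' : IsRescaling Ω' g' g'') (x : M) :
    upsilon E (fun x => Ω' x * Ω x) x = upsilon E Ω x + upsilon E Ω' x := by
  have h1 := (h.pos x).ne'
  have h2 := (h'.pos x).ne'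
  ext v
  simp only [upsilon]
  rw [mvfderiv_fun_mul (h'.mdifferentiableAt x) (h.mdifferentiableAt x)]
  simp
  field_simp

theorem upsilon_symm (h : IsRescaling Ω g g') (x : M) :
    upsilon E (fun x => (Ω x)⁻¹) x = - upsilon E Ω x := by
  have h0 := upsilon_trans h h.symm x
  have h1 : (fun x => (Ω x)⁻¹ * Ω x) = fun _ : M => (1 : ℝ) :=
    funext fun x => inv_mul_cancel₀ (h.pos x).ne'
  rw [h1] at h0
  have h2 : upsilon E (fun _ : M => (1 : ℝ)) x = 0 := by
    simp [upsilon, mvfderiv, mfderiv_const]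
  rw [h2] at h0
  exact (neg_eq_of_add_eq_zero_right h0.symm).symm

end IsRescaling

end Rescaling

section Weights

theorem inverse_smul_clm {X Y : Type*} [AddCommGroup X] [Module ℝ X] [TopologicalSpace X]
    [AddCommGroup Y] [Module ℝ Y] [TopologicalSpace Y] [ContinuousConstSMul ℝ Y]
    (A : X →L[ℝ] Y) {t : ℝ} (ht : t ≠ 0) (y : Y) : (t • A).inverse y = t⁻¹ • A.inverse y := by
  have h : t • A = (ContinuousLinearEquiv.smulLeft (R₁ := ℝ) (M₁ := Y) (Units.mk0 t ht) :
      Y →L[ℝ] Y) ∘L A := by ext v; rfl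
  rw [h, ContinuousLinearMap.inverse_equiv_comp]
  change A.inverse (t⁻¹ • y) = _
  rw [map_smul]

variable {E : Type*} [NormedAddCommGroup E] [NormedSpace ℝ E]
  {M : Type*} [TopologicalSpace M] [ChartedSpace E M] [IsManifold 𝓘(ℝ, E) ∞ M] {p q : ℕ}

/-- A choice of scale: a metric in the conformal class. -/
abbrev ConformalStructure.Scale (c : ConformalStructure E M p q) : Type _ :=
  {g : PseudoRiemannianMetric E M p q // g ∈ c.carrier}

/-- The fibre at `x` of the ray bundle `𝒬 ⊂ S²T*M`: the values at `x` of the metrics in the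
class. -/
def ConformalStructure.ray (c : ConformalStructure E M p q) (x : M) :
    Set (TangentSpace 𝓘(ℝ, E) x →L[ℝ] TangentSpace 𝓘(ℝ, E) x →L[ℝ] ℝ) :=
  {b | ∃ g ∈ c.carrier, g.val x = b}

/-- The value of a scale at `x`, as a point of `𝒬ₓ`. -/
def ConformalStructure.Scale.pt {c : ConformalStructure E M p q} (g : c.Scale) (x : M) : c.ray x :=
  ⟨g.1.val x, g.1, g.2, rfl⟩

theorem ConformalStructure.exists_rescaling (c : ConformalStructure E M p q) (g g' : c.Scale) :
    ∃ Ω : M → ℝ, IsRescaling Ω g.1 g'.1 :=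
  (c.mem_iff g.1 g.2 g'.1).1 g'.2

theorem ConformalStructure.exists_ratio (c : ConformalStructure E M p q) {x : M} (a b : c.ray x) :
    ∃ s : ℝ, 0 < s ∧ b.1 = s ^ 2 • a.1 := by
  obtain ⟨_, g, hg, rfl⟩ := a
  obtain ⟨_, g', hg', rfl⟩ := b
  obtain ⟨Ω, h⟩ := (c.mem_iff g hg g').1 hg'
  exact ⟨Ω x, h.pos x, h.eq x⟩

/-- The fibre at `x` of the weighted bundle `V[w] = V ⊗ ℰ[w]`: functions on `𝒬ₓ` with values in
`Vₓ` that are homogeneous of degree `w`, `f (s² q) = s ^ w f q`. -/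
def weightedSubmodule (c : ConformalStructure E M p q) (w : ℝ) (V : M → Type*)
    [∀ x, AddCommGroup (V x)] [∀ x, Module ℝ (V x)] (x : M) : Submodule ℝ (c.ray x → V x) where
  carrier := {f | ∀ (a b : c.ray x) (s : ℝ), 0 < s → b.1 = s ^ 2 • a.1 → f b = s ^ w • f a}
  add_mem' hf hf' a b s hs h := by
    rw [Pi.add_apply, Pi.add_apply, hf a b s hs h, hf' a b s hs h, smul_add]
  zero_mem' a b s hs h := by simp
  smul_mem' t f hf a b s hs h := by
    rw [Pi.smul_apply, Pi.smul_apply, hf a b s hs h, smul_comm]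

/-- The weighted bundle `V[w]`; in particular `ℰ[w] = Weighted c w (Bundle.Trivial M ℝ)`. -/
def Weighted (c : ConformalStructure E M p q) (w : ℝ) (V : M → Type*)
    [∀ x, AddCommGroup (V x)] [∀ x, Module ℝ (V x)] (x : M) : Type _ :=
  weightedSubmodule c w V x

namespace Weighted

variable {c : ConformalStructure E M p q} {w : ℝ} {V : M → Type*}
    [∀ x, AddCommGroup (V x)] [∀ x, Module ℝ (V x)] {x : M}

instance : AddCommGroup (Weighted c w V x) := inferInstanceAs (AddCommGroup (weightedSubmodule c w V x))
instance : Module ℝ (Weighted c w V x) := inferInstanceAs (Module ℝ (weightedSubmodule c w V x))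

/-- Evaluation of a weighted element at a point of `𝒬ₓ`. -/
def eval (a : c.ray x) : Weighted c w V x →ₗ[ℝ] V x where
  toFun f := f.1 a
  map_add' _ _ := rfl
  map_smul' _ _ := rfl

/-- Build a weighted element from a homogeneous function. -/
def mk (f : c.ray x → V x)
    (hf : ∀ (a b : c.ray x) (s : ℝ), 0 < s → b.1 = s ^ 2 • a.1 → f b = s ^ w • f a) :
    Weighted c w V x := ⟨f, hf⟩

@[simp] theorem eval_mk (f : c.ray x → V x) (hf) (a : c.ray x) :
    eval a (mk (w := w) f hf) = f a := rfl

theorem eval_smul (f : Weighted c w V x) {a b : c.ray x} {s : ℝ} (hs : 0 < s)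
    (h : b.1 = s ^ 2 • a.1) : eval b f = s ^ w • eval a f := f.2 a b s hs h

@[ext] theorem ext {f f' : Weighted c w V x} (h : ∀ a, eval a f = eval a f') : f = f' :=
  Subtype.ext (funext h)

/-- Apply a linear map to the values of a weighted element. -/
def map {V' : M → Type*} [∀ x, AddCommGroup (V' x)] [∀ x, Module ℝ (V' x)] (L : V x →ₗ[ℝ] V' x) :
    Weighted c w V x →ₗ[ℝ] Weighted c w V' x where
  toFun f := mk (fun a => L (eval a f)) fun a b s hs h => by rw [eval_smul f hs h, map_smul]
  map_add' f f' := by ext; simp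
  map_smul' t f := by ext; simp

@[simp] theorem eval_map {V' : M → Type*} [∀ x, AddCommGroup (V' x)] [∀ x, Module ℝ (V' x)]
    (L : V x →ₗ[ℝ] V' x) (f : Weighted c w V x) (a : c.ray x) :
    eval a (map L f) = L (eval a f) := rfl

/-! ### Contraction with the conformal metric -/

/-- `ρ ↦ v^a 𝐠_{ab} ρ`, from `ℰ[-1]` to `ℰ_b[1]`, where `𝐠` is the conformal metric, i.e. the
tautological section of `S²T*M[2]` with value `a` at `a ∈ 𝒬ₓ`. -/
def lower (v : TangentSpace 𝓘(ℝ, E) x) :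
    Weighted c (-1) (Bundle.Trivial M ℝ) x →ₗ[ℝ] Weighted c 1 (Cotangent E) x where
  toFun ρ := mk (fun a => (eval a ρ : ℝ) • (a.1 v : Cotangent E x)) fun a b s hs h => by
    rw [eval_smul ρ hs h, h, Real.rpow_neg_one, Real.rpow_one]
    have := hs.ne'
    ext u
    simp
    field_simp
  map_add' ρ ρ' := by ext; simp [add_mul]
  map_smul' t ρ := by ext; simp [mul_assoc]

/-- `μ_b ↦ 𝐠^{ab} μ_b`, from `ℰ_b[1]` to `ℰ^a[-1]`. -/
def raise : Weighted c 1 (Cotangent E) x →ₗ[ℝ] Weighted c (-1) (TangentSpace 𝓘(ℝ, E)) x where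
  toFun μ := mk (fun a => a.1.inverse (eval a μ)) fun a b s hs h => by
    rw [eval_smul μ hs h, h, map_smul, inverse_smul_clm _ (pow_pos hs 2).ne', Real.rpow_neg_one,
      Real.rpow_one, smul_smul]
    congr 1
    have := hs.ne'
    field_simp
  map_add' μ μ' := by ext; simp
  map_smul' t μ := by ext; simp

@[simp] theorem eval_lower (v : TangentSpace 𝓘(ℝ, E) x)
    (ρ : Weighted c (-1) (Bundle.Trivial M ℝ) x) (a : c.ray x) :
    eval a (lower v ρ) = (eval a ρ : ℝ) • (a.1 v : Cotangent E x) := rfl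

@[simp] theorem eval_raise (μ : Weighted c 1 (Cotangent E) x) (a : c.ray x) :
    eval a (raise μ) = a.1.inverse (eval a μ) := rfl

end Weighted


/-! ### The vector bundle structure of weighted bundles -/

section Bundle

variable [Fact (3 ≤ Module.finrank ℝ E)]

theorem ConformalStructure.ray_ne_zero (c : ConformalStructure E M p q) {x : M} (a : c.ray x) :
    a.1 ≠ 0 := by
  obtain ⟨_, g, hg, rfl⟩ := a
  intro h
  have h3 : 3 ≤ Module.finrank ℝ E := Fact.out
  have : Nontrivial E := Module.nontrivial_of_finrank_pos (R := ℝ) (by omega)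
  obtain ⟨v, hv⟩ := exists_ne (0 : E)
  exact hv (g.nondegenerate x (v : TangentSpace 𝓘(ℝ, E) x) fun w => by
    have h : g.val x = 0 := h
    rw [h]; rfl)

theorem ConformalStructure.ratio_unique (c : ConformalStructure E M p q) {x : M} {a : c.ray x}
    {s t : ℝ} (hs : 0 < s) (ht : 0 < t) (h : s ^ 2 • a.1 = t ^ 2 • a.1) : s = t := by
  have := smul_left_injective ℝ (c.ray_ne_zero a) h
  exact (pow_left_inj₀ hs.le ht.le two_ne_zero).1 this

namespace Weighted

variable {c : ConformalStructure E M p q} (w : ℝ) (V : M → Type*)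
    [∀ x, AddCommGroup (V x)] [∀ x, Module ℝ (V x)]

/-- A scale identifies `V[w]` with `V`, by evaluation. -/
def scaleEquiv (g : c.Scale) (x : M) : Weighted c w V x ≃ₗ[ℝ] V x where
  __ := eval (g.pt x)
  invFun t := mk (fun a => (c.exists_ratio (g.pt x) a).choose ^ w • t) fun a b s hs h => by
    obtain ⟨ha, ha'⟩ := (c.exists_ratio (g.pt x) a).choose_spec
    obtain ⟨hb, hb'⟩ := (c.exists_ratio (g.pt x) b).choose_spec
    set α := (c.exists_ratio (g.pt x) a).choose
    set β := (c.exists_ratio (g.pt x) b).choose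
    have : β = s * α := c.ratio_unique (a := g.pt x) hb (mul_pos hs ha) (by
      rw [← hb', h, ha', smul_smul, mul_pow])
    rw [this, smul_smul, Real.mul_rpow hs.le ha.le]
  left_inv f := by
    ext a
    exact (eval_smul f (c.exists_ratio (g.pt x) a).choose_spec.1
      (c.exists_ratio (g.pt x) a).choose_spec.2).symm
  right_inv t := by
    obtain ⟨ha, ha'⟩ := (c.exists_ratio (g.pt x)
      (g.pt x)).choose_spec
    have : (c.exists_ratio (g.pt x)
      (g.pt x)).choose = 1 :=
      c.ratio_unique (a := g.pt x) ha one_pos (by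
        rw [← ha', one_pow, one_smul])
    change (c.exists_ratio (g.pt x)
      (g.pt x)).choose ^ w • t = t
    rw [this, Real.one_rpow, one_smul]

@[simp] theorem scaleEquiv_apply (g : c.Scale) (x : M) (f : Weighted c w V x) :
    scaleEquiv w V g x f = eval (g.pt x) f := rfl

@[simp] theorem eval_scaleEquiv_symm (g : c.Scale) (x : M) (t : V x) :
    eval (g.pt x) ((scaleEquiv w V g x).symm t) = t :=
  (scaleEquiv w V g x).apply_symm_apply t

/-- The scale that is used to carry the bundle structure of `V` over to `V[w]`. Any two scales give
the same smooth structure, since their ratio is a smooth positive function. -/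
def _root_.ConformalStructure.refScale (c : ConformalStructure E M p q) : c.Scale :=
  ⟨c.nonempty.choose, c.nonempty.choose_spec⟩

variable (F : Type*) [NormedAddCommGroup F] [NormedSpace ℝ F]
  [TopologicalSpace (TotalSpace F V)] [∀ x, TopologicalSpace (V x)]

instance (x : M) : TopologicalSpace (Weighted c w V x) :=
  .induced (scaleEquiv w V c.refScale x) inferInstance

instance : TopologicalSpace (TotalSpace F (Weighted c w V)) :=
  .induced (BundleTransport.totalEquiv F (scaleEquiv w V c.refScale)) inferInstance

instance (x : M) [IsTopologicalAddGroup (V x)] : IsTopologicalAddGroup (Weighted c w V x) :=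
  BundleTransport.isTopologicalAddGroup (scaleEquiv w V c.refScale x) ⟨rfl⟩

instance (x : M) [ContinuousSMul ℝ (V x)] : ContinuousSMul ℝ (Weighted c w V x) :=
  BundleTransport.continuousSMul (scaleEquiv w V c.refScale x) ⟨rfl⟩

instance [FiberBundle F V] : FiberBundle F (Weighted c w V) :=
  BundleTransport.fiberBundle (scaleEquiv w V c.refScale) (fun _ => ⟨rfl⟩) ⟨rfl⟩

instance [FiberBundle F V] [VectorBundle ℝ F V] : VectorBundle ℝ F (Weighted c w V) :=
  BundleTransport.vectorBundle (scaleEquiv w V c.refScale) (fun _ => ⟨rfl⟩) ⟨rfl⟩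

instance [FiberBundle F V] [VectorBundle ℝ F V] [ContMDiffVectorBundle ∞ F V 𝓘(ℝ, E)] :
    ContMDiffVectorBundle ∞ F (Weighted c w V) 𝓘(ℝ, E) :=
  BundleTransport.contMDiffVectorBundle (scaleEquiv w V c.refScale) (fun _ => ⟨rfl⟩) ⟨rfl⟩

end Weighted

end Bundle

end Weights

/-! ## Tractors -/

section Tractors

variable {E : Type*} [NormedAddCommGroup E] [NormedSpace ℝ E]
  {M : Type*} [TopologicalSpace M] [ChartedSpace E M] [IsManifold 𝓘(ℝ, E) ∞ M] {p q : ℕ}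

/-- The bundle `ℰ[1] ⊕ ℰ_a[1] ⊕ ℰ[-1]`. -/
abbrev SplitTractor (c : ConformalStructure E M p q) : M → Type _ :=
  Weighted c 1 (Bundle.Trivial M ℝ) ×ᵇ
    (Weighted c 1 (Cotangent E) ×ᵇ Weighted c (-1) (Bundle.Trivial M ℝ))

/-- The model fibre of `ℰ[1] ⊕ ℰ_a[1] ⊕ ℰ[-1]`. -/
abbrev TractorModel (E : Type*) [NormedAddCommGroup E] [NormedSpace ℝ E] : Type _ :=
  ℝ × (E →L[ℝ] ℝ) × ℝ

variable {c : ConformalStructure E M p q}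

/-- The linear map `σ ↦ σ Υ_b`, from `ℰ[1]` to `ℰ_b[1]`. -/
def mulCovector {x : M} (Υ : Cotangent E x) :
    Weighted c 1 (Bundle.Trivial M ℝ) x →ₗ[ℝ] Weighted c 1 (Cotangent E) x :=
  Weighted.map (LinearMap.toSpanSingleton ℝ (Cotangent E x) Υ)

/-- The linear map `μ_b ↦ Υ^b μ_b = 𝐠^{ab} Υ_a μ_b`, from `ℰ_b[1]` to `ℰ[-1]`. -/
def contractCovector {x : M} (Υ : Cotangent E x) :
    Weighted c 1 (Cotangent E) x →ₗ[ℝ] Weighted c (-1) (Bundle.Trivial M ℝ) x :=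
  Weighted.map (V' := Bundle.Trivial M ℝ) Υ.toLinearMap ∘ₗ Weighted.raise

/-- The linear map `μ_b ↦ v^b μ_b`, from `ℰ_b[1]` to `ℰ[1]`. -/
def contractVector {x : M} (v : TangentSpace 𝓘(ℝ, E) x) :
    Weighted c 1 (Cotangent E) x →ₗ[ℝ] Weighted c 1 (Bundle.Trivial M ℝ) x :=
  Weighted.map (V' := Bundle.Trivial M ℝ) (LinearMap.applyₗ v ∘ₗ ContinuousLinearMap.coeLM ℝ)

/-- The transformation
`(σ, μ_b, ρ) ↦ (σ, μ_b + Υ_b σ, ρ - Υ^b μ_b - ½ Υ^b Υ_b σ)`. -/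
def tractorShift (c : ConformalStructure E M p q) {x : M} (Υ : Cotangent E x) :
    SplitTractor c x →ₗ[ℝ] SplitTractor c x where
  toFun V := (V.1, V.2.1 + mulCovector Υ V.1,
    V.2.2 - contractCovector Υ V.2.1 - (1 / 2 : ℝ) • contractCovector Υ (mulCovector Υ V.1))
  map_add' V V' := by
    refine Prod.ext rfl (Prod.ext ?_ ?_)
    · simp only [Prod.fst_add, Prod.snd_add, map_add]; abel
    · simp only [Prod.fst_add, Prod.snd_add, map_add]; module
  map_smul' t V := by
    refine Prod.ext rfl (Prod.ext ?_ ?_)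
    · simp only [Prod.smul_fst, Prod.smul_snd, map_smul, RingHom.id_apply]; module
    · simp only [Prod.smul_fst, Prod.smul_snd, map_smul, RingHom.id_apply]; module

theorem tractorShift_apply {x : M} (Υ : Cotangent E x) (V : SplitTractor c x) :
    tractorShift c Υ V = (V.1, V.2.1 + mulCovector Υ V.1,
      V.2.2 - contractCovector Υ V.2.1
        - (1 / 2 : ℝ) • contractCovector Υ (mulCovector Υ V.1)) := rfl

theorem mulCovector_add {x : M} (Υ Υ' : Cotangent E x) (σ : Weighted c 1 (Bundle.Trivial M ℝ) x) :
    mulCovector (Υ + Υ') σ = mulCovector Υ σ + mulCovector Υ' σ := by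
  ext a; simp [mulCovector]

theorem contractCovector_add {x : M} (Υ Υ' : Cotangent E x) (μ : Weighted c 1 (Cotangent E) x) :
    contractCovector (Υ + Υ') μ = contractCovector Υ μ + contractCovector Υ' μ := by
  ext a; simp [contractCovector]

theorem tractorShift_zero {x : M} (V : SplitTractor c x) : tractorShift c 0 V = V := by
  have h1 : ∀ σ, mulCovector (c := c) (0 : Cotangent E x) σ = 0 := fun σ => by
    ext a; simp [mulCovector]
  have h2 : ∀ μ, contractCovector (c := c) (0 : Cotangent E x) μ = 0 := fun μ => by
    ext a; simp [contractCovector]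
  simp [tractorShift_apply, h1, h2]

theorem inverse_symm {x : M} (a : c.ray x) (α β : Cotangent E x) :
    α (a.1.inverse β) = β (a.1.inverse α) := by
  by_cases ha : a.1.IsInvertible
  · obtain ⟨A, hA⟩ := ha
    have hs : ∀ v w, a.1 v w = a.1 w v := by
      obtain ⟨_, g, hg, rfl⟩ := a
      exact g.symm x
    rw [← hA, ContinuousLinearMap.inverse_equiv]
    have h : ∀ γ : Cotangent E x, a.1 (A.symm γ) = γ := fun γ => by
      rw [← hA]; exact A.apply_symm_apply γ
    calc α (A.symm β) = a.1 (A.symm α) (A.symm β) := by rw [h]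
      _ = a.1 (A.symm β) (A.symm α) := hs _ _
      _ = β (A.symm α) := by rw [h]
  · rw [ContinuousLinearMap.inverse_of_not_isInvertible ha]
    simp

theorem tractorShift_add {x : M} (Υ Υ' : Cotangent E x) (V : SplitTractor c x) :
    tractorShift c (Υ + Υ') V = tractorShift c Υ' (tractorShift c Υ V) := by
  have h : contractCovector Υ (mulCovector Υ' V.1) = contractCovector Υ' (mulCovector Υ V.1) := by
    ext a
    simp [contractCovector, mulCovector]
    left
    exact inverse_symm a _ _
  refine Prod.ext rfl (Prod.ext ?_ ?_)
  · simp only [tractorShift_apply, mulCovector_add]; abel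
  · simp only [tractorShift_apply, mulCovector_add, contractCovector_add, map_add, h]
    module

/-- The relation between points of the bundles `[𝒯]_g` and `[𝒯]_ĝ` over `x`, for `g`, `ĝ` in the
conformal class: `ĝ = Ω² g` and `V̂` is the transform of `V` with `Υ = Ω⁻¹ dΩ`. -/
def tractorRel (c : ConformalStructure E M p q) (x : M) (a b : c.Scale × SplitTractor c x) : Prop :=
  ∃ Ω : M → ℝ, IsRescaling Ω a.1.1 b.1.1 ∧ b.2 = tractorShift c (upsilon E Ω x) a.2

theorem upsilon_one (x : M) : upsilon E (fun _ : M => (1 : ℝ)) x = 0 := by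
  simp [upsilon, mvfderiv, mfderiv_const]

/-- `tractorRel` is an equivalence relation. -/
def tractorSetoid (c : ConformalStructure E M p q) (x : M) :
    Setoid (c.Scale × SplitTractor c x) where
  r := tractorRel c x
  iseqv := by
    refine ⟨fun a => ⟨_, IsRescaling.refl _, ?_⟩, ?_, ?_⟩
    · rw [upsilon_one, tractorShift_zero]
    · rintro a b ⟨Ω, h, hab⟩
      refine ⟨_, h.symm, ?_⟩
      rw [hab, ← tractorShift_add, h.upsilon_symm, add_neg_cancel, tractorShift_zero]
    · rintro a b d ⟨Ω, h, hab⟩ ⟨Ω', h', hbd⟩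
      refine ⟨_, h.trans h', ?_⟩
      rw [hbd, hab, ← tractorShift_add, h.upsilon_trans h']

/-- The standard tractor bundle `𝒯`: the disjoint union of the `[𝒯]_g`, `g` in the conformal
class, modulo `tractorRel`. -/
def Tractor (c : ConformalStructure E M p q) (x : M) : Type _ :=
  Quotient (tractorSetoid c x)

namespace Tractor

/-- The class in `𝒯` of an element of `[𝒯]_g`. -/
def ofScaleFun (g : c.Scale) (x : M) (V : SplitTractor c x) : Tractor c x :=
  Quotient.mk (tractorSetoid c x) (g, V)

theorem ofScaleFun_eq {g g' : c.Scale} {Ω : M → ℝ} (h : IsRescaling Ω g.1 g'.1) (x : M)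
    (V : SplitTractor c x) :
    ofScaleFun g x V = ofScaleFun g' x (tractorShift c (upsilon E Ω x) V) :=
  Quotient.sound ⟨Ω, h, rfl⟩

variable [Fact (3 ≤ Module.finrank ℝ E)]

theorem ofScaleFun_bijective (g : c.Scale) (x : M) :
    Function.Bijective (ofScaleFun g x) := by
  refine ⟨fun V V' h => ?_, fun t => ?_⟩
  · obtain ⟨Ω, h, hV⟩ := Quotient.exact h
    have h1 : Ω = fun _ => 1 := funext fun y =>
      c.ratio_unique (a := g.pt y) (h.pos y) one_pos (by
        have := h.eq y
        change g.1.val y = _ at this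
        change Ω y ^ 2 • g.1.val y = (1 : ℝ) ^ 2 • g.1.val y
        rw [← this, one_pow, one_smul])
    rw [h1, upsilon_one, tractorShift_zero] at hV
    exact hV.symm
  · obtain ⟨⟨g', V⟩, rfl⟩ := Quotient.exists_rep t
    obtain ⟨Ω, h⟩ := c.exists_rescaling g' g
    exact ⟨_, (ofScaleFun_eq h x V).symm⟩

/-- `[𝒯]_g` and `𝒯` have the same fibres. -/
def ofScaleEquiv (g : c.Scale) (x : M) : SplitTractor c x ≃ Tractor c x :=
  Equiv.ofBijective _ (ofScaleFun_bijective g x)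

instance (x : M) : AddCommGroup (Tractor c x) := (ofScaleEquiv c.refScale x).symm.addCommGroup
instance (x : M) : Module ℝ (Tractor c x) := (ofScaleEquiv c.refScale x).symm.module ℝ

theorem ofScaleFun_isLinearMap (g : c.Scale) (x : M) :
    IsLinearMap ℝ (ofScaleFun g x) := by
  obtain ⟨Ω, h⟩ := c.exists_rescaling g c.refScale
  have key : ∀ V, ofScaleFun g x V =
      ((ofScaleEquiv c.refScale x).symm.linearEquiv ℝ).symm (tractorShift c (upsilon E Ω x) V) :=
    fun V => ofScaleFun_eq h x V
  exact ⟨fun V V' => by rw [key, key, key, map_add, map_add],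
    fun t V => by rw [key, key, map_smul, map_smul]⟩

/-- A scale `g` identifies `[𝒯]_g = ℰ[1] ⊕ ℰ_a[1] ⊕ ℰ[-1]` with `𝒯`; the linear structure on the
fibres of `𝒯` is the one for which these identifications are linear. -/
def ofScale (g : c.Scale) (x : M) : SplitTractor c x ≃ₗ[ℝ] Tractor c x where
  __ := ofScaleEquiv g x
  map_add' := (ofScaleFun_isLinearMap g x).map_add
  map_smul' := (ofScaleFun_isLinearMap g x).map_smul

instance (x : M) : TopologicalSpace (Tractor c x) :=
  .induced (ofScale c.refScale x).symm inferInstance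

instance : TopologicalSpace (TotalSpace (TractorModel E) (Tractor c)) :=
  .induced (BundleTransport.totalEquiv (TractorModel E) fun x => (ofScale c.refScale x).symm)
    inferInstance

instance (x : M) : IsTopologicalAddGroup (Tractor c x) :=
  BundleTransport.isTopologicalAddGroup (ofScale c.refScale x).symm ⟨rfl⟩

instance (x : M) : ContinuousSMul ℝ (Tractor c x) :=
  BundleTransport.continuousSMul (ofScale c.refScale x).symm ⟨rfl⟩

instance : FiberBundle (TractorModel E) (Tractor c) :=
  BundleTransport.fiberBundle (fun x => (ofScale c.refScale x).symm) (fun _ => ⟨rfl⟩) ⟨rfl⟩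

instance : VectorBundle ℝ (TractorModel E) (Tractor c) :=
  BundleTransport.vectorBundle (fun x => (ofScale c.refScale x).symm) (fun _ => ⟨rfl⟩) ⟨rfl⟩

instance : ContMDiffVectorBundle ∞ (TractorModel E) (Tractor c) 𝓘(ℝ, E) :=
  BundleTransport.contMDiffVectorBundle (fun x => (ofScale c.refScale x).symm) (fun _ => ⟨rfl⟩)
    ⟨rfl⟩

end Tractor

/-! ## The connection -/

variable [Fact (3 ≤ Module.finrank ℝ E)]

/-- The Levi-Civita connection of a scale `g` on `ℰ[w]`: it is `∇^g τ = σ^w d(σ^{-w} τ)` for the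
density `σ ∈ ℰ₊[1]` with `𝐠 = σ² g`. -/
def densityDeriv (g : c.Scale) {w : ℝ} (τ : ∀ y, Weighted c w (Bundle.Trivial M ℝ) y) (x : M)
    (v : TangentSpace 𝓘(ℝ, E) x) : Weighted c w (Bundle.Trivial M ℝ) x :=
  (Weighted.scaleEquiv w (Bundle.Trivial M ℝ) g x).symm
    (mvfderiv 𝓘(ℝ, E) (fun y => Weighted.scaleEquiv w (Bundle.Trivial M ℝ) g y (τ y) : M → ℝ) x v)

/-- The Levi-Civita connection of a scale `g` on `ℰ_b[w]`, coupled from those on `T*M` and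
`ℰ[w]`. -/
def covectorDeriv (g : c.Scale) {w : ℝ} (μ : ∀ y, Weighted c w (Cotangent E) y) (x : M)
    (v : TangentSpace 𝓘(ℝ, E) x) : Weighted c w (Cotangent E) x :=
  (Weighted.scaleEquiv w (Cotangent E) g x).symm
    (g.1.leviCivita (fun y => Weighted.scaleEquiv w (Cotangent E) g y (μ y)) x v)

/-- The tractor connection in a scale `g`, in the direction `v = v^a`, of `V = (σ, μ_b, ρ)`:
`(∇_a σ - μ_a, ∇_a μ_b + 𝐠_{ab} ρ + P_{ab} σ, ∇_a ρ - P_{ab} μ^b)`. -/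
def tractorDeriv [FiniteDimensional ℝ E] (g : c.Scale) (V : ∀ y, SplitTractor c y) (x : M)
    (v : TangentSpace 𝓘(ℝ, E) x) : SplitTractor c x :=
  (densityDeriv g (fun y => (V y).1) x v
      - contractVector v (V x).2.1,
    covectorDeriv g (fun y => (V y).2.1) x v + Weighted.lower v (V x).2.2
      + mulCovector (g.1.schouten x v) (V x).1,
    densityDeriv g (fun y => (V y).2.2) x v - contractCovector (g.1.schouten x v) (V x).2.1)

end Tractors

end

/-! Everything is reduced to a computation in one chart. A scale and a chart turn a tractor field
into a function `t = (s, m, r)` on an open set of `E`, with values in `TractorModel E`, and turn the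
formula for the connection into `LocalMetric.tractorDeriv`, built from the Christoffel symbols, the
metric and the Schouten tensor of the coordinate metric `G`.

The heart is conformal invariance. If `G' = Ω² G` and `Υ = dlog Ω`, then `Γ'(u, v) = Γ(u, v) + Υ(u)
v + Υ(v) u - G(u, v) Υ♯`, because the right side is symmetric and compatible with `G'`, and the
Levi-Civita connection is the only one with these properties (`IsMetricOn.christoffel_eq`).
Inserting this into the curvature gives `riemann_target`, in which all second derivatives of `Ω`
enter through `T = ∇Υ - Υ ⊗ Υ + ½ |Υ|² G`. Two traces then yield `P' = P - T` (`schouten_target`);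
dividing by `n - 2` is where the dimension matters. In the new scale the components are `Ω s`, `Ω (m
+ s Υ)` and `Ω⁻¹ (r - m(Υ♯) - ½ s |Υ|²)`, the powers of `Ω` coming from the weights. Differentiating
them produces `∇Υ`, which the change of `P` cancels, and the terms quadratic in `Υ` cancel against
those of `Γ'` and `P'` (`fderiv_fst`, `fderiv_snd`, `fderiv_trd`).

The global Levi-Civita derivative and Schouten tensor are defined at each point in the preferred
chart of that point. To differentiate or to prove smoothness one chart has to serve a whole
neighbourhood, so independence of the chart is needed. The same uniqueness of the Levi-Civita
connection gives the transformation law of `Γ` under a chart transition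
(`IsIsometryOn.apply_christoffel`), and hence the naturality of curvature, Ricci and Schouten
tensors (`leviCivita_apply`, `PseudoRiemannianMetric.schouten_apply`).

Finally, `𝒯` carries the bundle structure of `[𝒯]_g` for the reference scale. The transition to
another scale is the shift by `Υ`, a smooth bundle map, so every scale gives a smooth
identification. The connection on `𝒯` is transported from the reference scale; conformal invariance
says that it has the same form in all scales. It is unique because each scale makes every section of
`𝒯` the image of a section of `[𝒯]_g`. -/

open Filter Topology

namespace LocalMetric

/-! ### Product rules for evaluated operator-valued maps. -/

section Calculus

theorem two_le_infty : (2 : ℕ∞ω) ≤ ∞ := WithTop.coe_le_coe.2 (le_top : (2 : ℕ∞) ≤ ⊤)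

variable {X Y Z W : Type*} [NormedAddCommGroup X] [NormedSpace ℝ X]
  [NormedAddCommGroup Y] [NormedSpace ℝ Y] [NormedAddCommGroup Z] [NormedSpace ℝ Z]
  [NormedAddCommGroup W] [NormedSpace ℝ W]

theorem fderiv_apply_apply {A : X → Y →L[ℝ] Z} {a : X → Y} {z : X} (hA : DifferentiableAt ℝ A z)
    (ha : DifferentiableAt ℝ a z) (u : X) :
    fderiv ℝ (fun y => A y (a y)) z u = fderiv ℝ A z u (a z) + A z (fderiv ℝ a z u) := by
  rw [fderiv_clm_apply hA ha]
  simp [add_comm]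

theorem fderiv_bilinear_apply {B : X → Y →L[ℝ] Z →L[ℝ] W} {a : X → Y} {b : X → Z} {z : X}
    (hB : DifferentiableAt ℝ B z) (ha : DifferentiableAt ℝ a z) (hb : DifferentiableAt ℝ b z)
    (u : X) :
    fderiv ℝ (fun y => B y (a y) (b y)) z u = fderiv ℝ B z u (a z) (b z)
      + B z (fderiv ℝ a z u) (b z) + B z (a z) (fderiv ℝ b z u) := by
  rw [fderiv_apply_apply (hB.clm_apply ha) hb, fderiv_apply_apply hB ha]
  simp

end Calculus

/-! ### Coordinate metrics and their Levi-Civita connection. -/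

variable {E : Type*} [NormedAddCommGroup E] [NormedSpace ℝ E]

/-- `G` is a smooth pseudo-Riemannian metric on the open set `U`. -/
structure IsMetricOn (G : E → E →L[ℝ] E →L[ℝ] ℝ) (U : Set E) : Prop where
  isOpen : IsOpen U
  contDiffOn : ContDiffOn ℝ ∞ G U
  symm : ∀ z ∈ U, ∀ u v, G z u v = G z v u
  isInvertible : ∀ z ∈ U, (G z).IsInvertible

theorem eq_of_forall_apply_eq {b : E →L[ℝ] E →L[ℝ] ℝ} (hb : b.IsInvertible) {u v : E}
    (h : ∀ w, b u w = b v w) : u = v := by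
  obtain ⟨e, rfl⟩ := hb
  exact e.injective (ContinuousLinearMap.ext h)

namespace IsMetricOn

variable {G : E → E →L[ℝ] E →L[ℝ] ℝ} {U : Set E} {z : E} (hG : IsMetricOn G U)

include hG

theorem mono {U' : Set E} (hU' : IsOpen U') (h : U' ⊆ U) : IsMetricOn G U' :=
  ⟨hU', hG.contDiffOn.mono h, fun z hz => hG.symm z (h hz), fun z hz => hG.isInvertible z (h hz)⟩

theorem mem_nhds (hz : z ∈ U) : U ∈ 𝓝 z := hG.isOpen.mem_nhds hz

theorem contDiffAt (hz : z ∈ U) : ContDiffAt ℝ ∞ G z :=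
  hG.contDiffOn.contDiffAt (hG.mem_nhds hz)

theorem differentiableAt (hz : z ∈ U) : DifferentiableAt ℝ G z :=
  (hG.contDiffAt hz).differentiableAt (by simp)

theorem apply_inverse (hz : z ∈ U) (α : E →L[ℝ] ℝ) : G z ((G z).inverse α) = α := by
  obtain ⟨e, he⟩ := hG.isInvertible z hz
  rw [← he, ContinuousLinearMap.inverse_equiv]
  exact e.apply_symm_apply α

theorem inverse_apply (hz : z ∈ U) (v : E) : (G z).inverse (G z v) = v := by
  obtain ⟨e, he⟩ := hG.isInvertible z hz
  rw [← he, ContinuousLinearMap.inverse_equiv]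
  exact e.symm_apply_apply v

theorem apply_inverse_comm (hz : z ∈ U) (α β : E →L[ℝ] ℝ) :
    α ((G z).inverse β) = β ((G z).inverse α) := by
  calc α ((G z).inverse β) = G z ((G z).inverse α) ((G z).inverse β) := by
        rw [hG.apply_inverse hz]
    _ = G z ((G z).inverse β) ((G z).inverse α) := hG.symm z hz _ _
    _ = β ((G z).inverse α) := by rw [hG.apply_inverse hz]

theorem apply_inverse_right (hz : z ∈ U) (α : E →L[ℝ] ℝ) (v : E) :
    G z v ((G z).inverse α) = α v := by
  rw [hG.symm z hz, hG.apply_inverse hz]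

theorem fderiv_symm (hz : z ∈ U) (u v w : E) : fderiv ℝ G z u v w = fderiv ℝ G z u w v := by
  have hd := hG.differentiableAt hz
  have h : (fun y => G y v w) =ᶠ[𝓝 z] fun y => G y w v := by
    filter_upwards [hG.mem_nhds hz] with y hy using hG.symm y hy v w
  have h1 := DFunLike.congr_fun (h.fderiv_eq (𝕜 := ℝ)) u
  rw [fderiv_bilinear_apply hd (differentiableAt_const _) (differentiableAt_const _),
    fderiv_bilinear_apply hd (differentiableAt_const _) (differentiableAt_const _)] at h1
  simpa using h1

theorem apply_christoffel (hz : z ∈ U) (u v w : E) :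
    G z (christoffel G z u v) w = 1 / 2 * koszul (fderiv ℝ G z) u v w := by
  rw [christoffel_apply, map_smul, hG.apply_inverse hz]
  rfl

theorem christoffel_symm (hz : z ∈ U) (u v : E) : christoffel G z u v = christoffel G z v u := by
  refine eq_of_forall_apply_eq (hG.isInvertible z hz) fun w => ?_
  rw [hG.apply_christoffel hz, hG.apply_christoffel hz, koszul_apply, koszul_apply,
    hG.fderiv_symm hz w u v]
  ring

/-- The Levi-Civita connection is compatible with the metric. -/
theorem fderiv_eq (hz : z ∈ U) (u v w : E) :
    fderiv ℝ G z u v w = G z (christoffel G z u v) w + G z v (christoffel G z u w) := by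
  rw [hG.symm z hz v, hG.apply_christoffel hz, hG.apply_christoffel hz, koszul_apply,
    koszul_apply, hG.fderiv_symm hz u w v, hG.fderiv_symm hz v u w, hG.fderiv_symm hz w u v]
  ring

/-- The Levi-Civita connection is the only torsion-free metric connection. -/
theorem christoffel_eq (hz : z ∈ U) {K : E → E → E} (hK : ∀ u v, K u v = K v u)
    (hK' : ∀ u v w, fderiv ℝ G z u v w = G z (K u v) w + G z v (K u w)) (u v : E) :
    christoffel G z u v = K u v := by
  refine eq_of_forall_apply_eq (hG.isInvertible z hz) fun w => ?_
  -- Metric compatibility turns the three terms of the Koszul expression into six; by the symmetry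
  -- of `K` and of the metric, four cancel and the other two are equal.
  rw [hG.apply_christoffel hz, koszul_apply, hK', hK', hK', hK v u, hK w u, hK w v]
  have h1 := hG.symm z hz v (K u w)
  have h2 := hG.symm z hz u (K v w)
  linarith

theorem contDiffOn_inverse [FiniteDimensional ℝ E] :
    ContDiffOn ℝ ∞ (fun y => (G y).inverse) U := by
  -- Smoothness of inversion at an invertible operator needs a complete space.
  have : CompleteSpace E := FiniteDimensional.complete ℝ E
  intro y hy
  obtain ⟨e, he⟩ := hG.isInvertible y hy
  have h := contDiffAt_map_inverse (𝕜 := ℝ) (n := ∞) e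
  rw [he] at h
  exact (h.comp y (hG.contDiffAt hy)).contDiffWithinAt

theorem contDiffOn_fderiv : ContDiffOn ℝ ∞ (fderiv ℝ G) U :=
  hG.contDiffOn.fderiv_of_isOpen hG.isOpen (by simp)

/-- On a finite-dimensional space an operator-valued map is smooth as soon as its values on fixed
vectors are, so only the scalar and vector components have to be examined. -/
theorem contDiffOn_christoffel [FiniteDimensional ℝ E] : ContDiffOn ℝ ∞ (christoffel G) U := by
  have h : ContDiffOn ℝ ∞ (fun y => koszul (fderiv ℝ G y)) U := by
    have hf := hG.contDiffOn_fderiv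
    refine contDiffOn_clm_apply.2 fun u => contDiffOn_clm_apply.2 fun v =>
      contDiffOn_clm_apply.2 fun w => ?_
    simp only [koszul_apply]
    have h3 : ∀ a b c : E, ContDiffOn ℝ ∞ (fun y => fderiv ℝ G y a b c) U := fun a b c =>
      ((hf.clm_apply contDiffOn_const).clm_apply contDiffOn_const).clm_apply contDiffOn_const
    exact ((h3 _ _ _).add (h3 _ _ _)).sub (h3 _ _ _)
  refine contDiffOn_clm_apply.2 fun u => contDiffOn_clm_apply.2 fun v => ?_
  simp only [christoffel_apply]
  exact (hG.contDiffOn_inverse.clm_apply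
    ((h.clm_apply contDiffOn_const).clm_apply contDiffOn_const)).const_smul _

theorem differentiableAt_christoffel [FiniteDimensional ℝ E] (hz : z ∈ U) :
    DifferentiableAt ℝ (christoffel G) z :=
  (hG.contDiffOn_christoffel.contDiffAt (hG.mem_nhds hz)).differentiableAt (by simp)

end IsMetricOn

/-! ### Change of coordinates -/

/-- `φ` is a local diffeomorphism near the points of `U` and maps the metric `G` on `U` to the
metric `G'` on `U'`. -/
structure IsIsometryOn (φ : E → E) (G G' : E → E →L[ℝ] E →L[ℝ] ℝ) (U U' : Set E) : Prop where
  source : IsMetricOn G U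
  target : IsMetricOn G' U'
  mapsTo : Set.MapsTo φ U U'
  contDiffOn : ContDiffOn ℝ ∞ φ U
  isInvertible : ∀ z ∈ U, (fderiv ℝ φ z).IsInvertible
  pull : ∀ z ∈ U, ∀ v w, G z v w = G' (φ z) (fderiv ℝ φ z v) (fderiv ℝ φ z w)

namespace IsIsometryOn

variable {φ : E → E} {G G' : E → E →L[ℝ] E →L[ℝ] ℝ} {U U' : Set E} {z : E}
  (h : IsIsometryOn φ G G' U U')

include h

theorem contDiffAt (hz : z ∈ U) : ContDiffAt ℝ ∞ φ z :=
  h.contDiffOn.contDiffAt (h.source.mem_nhds hz)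

theorem differentiableAt (hz : z ∈ U) : DifferentiableAt ℝ φ z :=
  (h.contDiffAt hz).differentiableAt (by simp)

theorem contDiffOn_fderiv : ContDiffOn ℝ ∞ (fderiv ℝ φ) U :=
  h.contDiffOn.fderiv_of_isOpen h.source.isOpen (by simp)

theorem differentiableAt_fderiv (hz : z ∈ U) : DifferentiableAt ℝ (fderiv ℝ φ) z :=
  (h.contDiffOn_fderiv.contDiffAt (h.source.mem_nhds hz)).differentiableAt (by simp)

theorem fderiv_fderiv_symm (hz : z ∈ U) (u v : E) :
    fderiv ℝ (fderiv ℝ φ) z u v = fderiv ℝ (fderiv ℝ φ) z v u :=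
  ((h.contDiffAt hz).isSymmSndFDerivAt (by simpa using two_le_infty)).eq u v

theorem apply_inverse (hz : z ∈ U) (v : E) :
    fderiv ℝ φ z ((fderiv ℝ φ z).inverse v) = v := by
  obtain ⟨e, he⟩ := h.isInvertible z hz
  rw [← he, ContinuousLinearMap.inverse_equiv]
  exact e.apply_symm_apply v

theorem fderiv_comp_apply {Y : Type*} [NormedAddCommGroup Y] [NormedSpace ℝ Y] {f : E → Y}
    (hz : z ∈ U) (hf : DifferentiableAt ℝ f (φ z)) (u : E) :
    fderiv ℝ (fun y => f (φ y)) z u = fderiv ℝ f (φ z) (fderiv ℝ φ z u) := by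
  rw [fderiv_fun_comp z hf (h.differentiableAt hz)]
  rfl

/-- This is the pullback identity differentiated along `u`. The two terms with the second derivative
of `φ` are the source of the inhomogeneous term in the transformation of the Christoffel symbols. -/
theorem fderiv_metric (hz : z ∈ U) (u v w : E) :
    fderiv ℝ G z u v w =
      fderiv ℝ G' (φ z) (fderiv ℝ φ z u) (fderiv ℝ φ z v) (fderiv ℝ φ z w)
      + G' (φ z) (fderiv ℝ (fderiv ℝ φ) z u v) (fderiv ℝ φ z w)
      + G' (φ z) (fderiv ℝ φ z v) (fderiv ℝ (fderiv ℝ φ) z u w) := by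
  have he : (fun y => G y v w) =ᶠ[𝓝 z]
      fun y => G' (φ y) (fderiv ℝ φ y v) (fderiv ℝ φ y w) := by
    filter_upwards [h.source.mem_nhds hz] with y hy using h.pull y hy v w
  have h1 := DFunLike.congr_fun (he.fderiv_eq (𝕜 := ℝ)) u
  have hG' := h.target.differentiableAt (h.mapsTo hz)
  have hA := h.differentiableAt_fderiv hz
  rw [fderiv_bilinear_apply (h.source.differentiableAt hz) (differentiableAt_const _)
    (differentiableAt_const _),
    fderiv_bilinear_apply (B := fun y => G' (φ y)) (hG'.comp z (h.differentiableAt hz))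
      (hA.clm_apply (differentiableAt_const _)) (hA.clm_apply (differentiableAt_const _)),
    h.fderiv_comp_apply hz hG', fderiv_apply_apply hA (differentiableAt_const _),
    fderiv_apply_apply hA (differentiableAt_const _)] at h1
  simpa using h1

/-- The connection of `G'` pulled back by `φ` is symmetric, since second derivatives of `φ` commute,
and compatible with `G`; uniqueness of the Levi-Civita connection identifies it with that of `G`. -/
theorem apply_christoffel (hz : z ∈ U) (u v : E) :
    fderiv ℝ φ z (christoffel G z u v) = fderiv ℝ (fderiv ℝ φ) z u v
      + christoffel G' (φ z) (fderiv ℝ φ z u) (fderiv ℝ φ z v) := by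
  rw [h.source.christoffel_eq hz (K := fun u v => (fderiv ℝ φ z).inverse
    (fderiv ℝ (fderiv ℝ φ) z u v
      + christoffel G' (φ z) (fderiv ℝ φ z u) (fderiv ℝ φ z v))), h.apply_inverse hz]
  · intro u v
    rw [h.fderiv_fderiv_symm hz, h.target.christoffel_symm (h.mapsTo hz)]
  · intro u v w
    rw [h.fderiv_metric hz, h.pull z hz, h.pull z hz, h.apply_inverse hz, h.apply_inverse hz,
      h.target.fderiv_eq (h.mapsTo hz)]
    simp only [map_add, add_apply]
    ring

variable [FiniteDimensional ℝ E]

/-- Obtained by differentiating `apply_christoffel` along `u`, which is legitimate because that law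
holds on a whole neighbourhood of `z`. -/
theorem apply_fderiv_christoffel (hz : z ∈ U) (u v w : E) :
    fderiv ℝ (fderiv ℝ φ) z u (christoffel G z v w)
        + fderiv ℝ φ z (fderiv ℝ (christoffel G) z u v w) =
      fderiv ℝ (fderiv ℝ (fderiv ℝ φ)) z u v w
      + (fderiv ℝ (christoffel G') (φ z) (fderiv ℝ φ z u) (fderiv ℝ φ z v) (fderiv ℝ φ z w)
        + christoffel G' (φ z) (fderiv ℝ (fderiv ℝ φ) z u v) (fderiv ℝ φ z w)
        + christoffel G' (φ z) (fderiv ℝ φ z v) (fderiv ℝ (fderiv ℝ φ) z u w)) := by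
  have he : (fun y => fderiv ℝ φ y (christoffel G y v w)) =ᶠ[𝓝 z]
      fun y => fderiv ℝ (fderiv ℝ φ) y v w
        + christoffel G' (φ y) (fderiv ℝ φ y v) (fderiv ℝ φ y w) := by
    filter_upwards [h.source.mem_nhds hz] with y hy using h.apply_christoffel hy v w
  have h1 := DFunLike.congr_fun (he.fderiv_eq (𝕜 := ℝ)) u
  have hΓ := h.source.differentiableAt_christoffel hz
  have hΓ' := h.target.differentiableAt_christoffel (h.mapsTo hz)
  have hA := h.differentiableAt_fderiv hz
  have hA' : DifferentiableAt ℝ (fderiv ℝ (fderiv ℝ φ)) z :=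
    ((h.contDiffOn_fderiv.fderiv_of_isOpen (m := ∞) h.source.isOpen (by simp)).contDiffAt
      (h.source.mem_nhds hz)).differentiableAt (by simp)
  have hc : ∀ v : E, DifferentiableAt ℝ (fun _ : E => v) z := fun v => differentiableAt_const v
  have hB : DifferentiableAt ℝ (fun y => christoffel G' (φ y)) z :=
    hΓ'.comp z (h.differentiableAt hz)
  rw [fderiv_apply_apply hA ((hΓ.clm_apply (hc v)).clm_apply (hc w)),
    fderiv_bilinear_apply hΓ (hc v) (hc w),
    fderiv_fun_add ((hA'.clm_apply (hc v)).clm_apply (hc w))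
      ((hB.clm_apply (hA.clm_apply (hc v))).clm_apply (hA.clm_apply (hc w))), add_apply,
    fderiv_bilinear_apply hA' (hc v) (hc w),
    fderiv_bilinear_apply hB (hA.clm_apply (hc v)) (hA.clm_apply (hc w)),
    h.fderiv_comp_apply hz hΓ', fderiv_apply_apply hA (hc v), fderiv_apply_apply hA (hc w)] at h1
  simpa using h1

/-- The curvature is natural. -/
theorem apply_riemann (hz : z ∈ U) (u v w : E) :
    fderiv ℝ φ z (riemann G z u v w) =
      riemann G' (φ z) (fderiv ℝ φ z u) (fderiv ℝ φ z v) (fderiv ℝ φ z w) := by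
  -- The third derivative of `φ` is the only new object in the differentiated law; its symmetry in
  -- the first two directions removes it from the curvature, which is antisymmetric there.
  have h3 : fderiv ℝ (fderiv ℝ (fderiv ℝ φ)) z u v w
      = fderiv ℝ (fderiv ℝ (fderiv ℝ φ)) z v u w := by
    have hs := (h.contDiffOn_fderiv.contDiffAt (h.source.mem_nhds hz))
    have := (hs.isSymmSndFDerivAt (by simpa using two_le_infty)).eq u v
    rw [this]
  have h1 := h.apply_fderiv_christoffel hz u v w
  have h2 := h.apply_fderiv_christoffel hz v u w
  have h4 := h.apply_christoffel hz u (christoffel G z v w)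
  have h5 := h.apply_christoffel hz v (christoffel G z u w)
  rw [h.apply_christoffel hz v w] at h4
  rw [h.apply_christoffel hz u w] at h5
  rw [h.fderiv_fderiv_symm hz v u, ← h3] at h2
  simp only [riemann, map_add, map_sub] at h1 h2 h4 h5 ⊢
  rw [h4, h5, ← sub_eq_zero]
  rw [← sub_eq_zero] at h1 h2
  -- The zero on the right is written as `0 - 0` and the two zeros are replaced by the
  -- differentiated laws for `(u, v)` and `(v, u)`; what is left is an identity in the additive
  -- group.
  rw [← sub_zero (0 : E)]
  nth_rewrite 1 [← h1]
  rw [← h2]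
  abel

/-- The Ricci tensor is natural. -/
theorem ricci_apply (hz : z ∈ U) (v w : E) :
    ricci G z v w = ricci G' (φ z) (fderiv ℝ φ z v) (fderiv ℝ φ z w) := by
  obtain ⟨e, he⟩ := h.isInvertible z hz
  change LinearMap.trace ℝ E (riemannEnd G z v w)
    = LinearMap.trace ℝ E (riemannEnd G' (φ z) (fderiv ℝ φ z v) (fderiv ℝ φ z w))
  -- By naturality of the curvature, the derivative of `φ` conjugates one endomorphism into the
  -- other, and the trace does not see a conjugation.
  rw [← LinearMap.trace_conj' (riemannEnd G z v w) e.toLinearEquiv]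
  congr 1
  ext u
  have h1 := h.apply_riemann hz (e.symm u) v w
  rw [← he] at h1 ⊢
  rw [LinearEquiv.conj_apply]
  refine h1.trans ?_
  change riemann G' (φ z) (e (e.symm u)) _ _ = riemann G' (φ z) u _ _
  rw [e.apply_symm_apply]

end IsIsometryOn

end LocalMetric

/-! ### Scalar curvature and Schouten tensor in coordinates: naturality and smoothness. -/

namespace LocalMetric

variable {E : Type*} [NormedAddCommGroup E] [NormedSpace ℝ E] [FiniteDimensional ℝ E]

/-- The scalar curvature in coordinates. -/
noncomputable def scalar (G : E → E →L[ℝ] E →L[ℝ] ℝ) (z : E) : ℝ :=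
  LinearMap.trace ℝ E ((G z).inverse ∘L ricci G z).toLinearMap

/-- The Schouten tensor in coordinates. -/
noncomputable def schouten (G : E → E →L[ℝ] E →L[ℝ] ℝ) (z : E) : E →L[ℝ] E →L[ℝ] ℝ :=
  ((Module.finrank ℝ E : ℝ) - 2)⁻¹ •
    (ricci G z - (scalar G z / (2 * ((Module.finrank ℝ E : ℝ) - 1))) • G z)

theorem ricci_apply_eq_trace (G : E → E →L[ℝ] E →L[ℝ] ℝ) (z v w : E) :
    ricci G z v w = LinearMap.trace ℝ E (riemannEnd G z v w) := rfl

theorem schouten_apply (G : E → E →L[ℝ] E →L[ℝ] ℝ) (z v w : E) :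
    schouten G z v w = ((Module.finrank ℝ E : ℝ) - 2)⁻¹ *
      (ricci G z v w - scalar G z / (2 * ((Module.finrank ℝ E : ℝ) - 1)) * G z v w) := rfl

theorem IsIsometryOn.scalar_eq {φ : E → E} {G G' : E → E →L[ℝ] E →L[ℝ] ℝ} {U U' : Set E} {z : E}
    (h : IsIsometryOn φ G G' U U') (hz : z ∈ U) : scalar G z = scalar G' (φ z) := by
  obtain ⟨e, he⟩ := h.isInvertible z hz
  rw [scalar, scalar, ← LinearMap.trace_conj' _ e.toLinearEquiv]
  congr 1
  ext u
  have h1 : fderiv ℝ φ z ((G z).inverse (ricci G z (e.symm u)))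
      = (G' (φ z)).inverse (ricci G' (φ z) u) := by
    refine eq_of_forall_apply_eq (h.target.isInvertible _ (h.mapsTo hz)) fun w => ?_
    rw [h.target.apply_inverse (h.mapsTo hz), ← h.apply_inverse hz w, ← h.pull z hz,
      h.source.apply_inverse hz, h.ricci_apply hz, ← he]
    change ricci G' (φ z) (e (e.symm u)) _ = _
    rw [e.apply_symm_apply]
  rw [← he] at h1
  exact h1

theorem IsIsometryOn.schouten_apply {φ : E → E} {G G' : E → E →L[ℝ] E →L[ℝ] ℝ} {U U' : Set E}
    {z : E} (h : IsIsometryOn φ G G' U U') (hz : z ∈ U) (v w : E) :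
    schouten G z v w = schouten G' (φ z) (fderiv ℝ φ z v) (fderiv ℝ φ z w) := by
  rw [LocalMetric.schouten_apply, LocalMetric.schouten_apply, h.scalar_eq hz, h.ricci_apply hz,
    h.pull z hz]

namespace IsMetricOn

variable {G : E → E →L[ℝ] E →L[ℝ] ℝ} {U : Set E} (hG : IsMetricOn G U)

include hG

theorem contDiffOn_riemann (u v w : E) : ContDiffOn ℝ ∞ (fun z => riemann G z u v w) U := by
  have h1 := hG.contDiffOn_christoffel
  have h2 : ContDiffOn ℝ ∞ (fderiv ℝ (christoffel G)) U :=
    h1.fderiv_of_isOpen hG.isOpen (by simp)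
  have h3 : ∀ a b c : E, ContDiffOn ℝ ∞ (fun z => fderiv ℝ (christoffel G) z a b c) U :=
    fun a b c => ((h2.clm_apply contDiffOn_const).clm_apply contDiffOn_const).clm_apply
      contDiffOn_const
  have h4 : ∀ a b c : E, ContDiffOn ℝ ∞ (fun z => christoffel G z a (christoffel G z b c)) U :=
    fun a b c => (h1.clm_apply contDiffOn_const).clm_apply
      ((h1.clm_apply contDiffOn_const).clm_apply contDiffOn_const)
  exact (((h3 u v w).sub (h3 v u w)).add (h4 u v w)).sub (h4 v u w)

/-- In a fixed basis the trace is a finite sum of fixed functionals applied to the values of `L` on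
the basis vectors. -/
theorem contDiffOn_trace {L : E → E →ₗ[ℝ] E} {U : Set E}
    (hL : ∀ u, ContDiffOn ℝ ∞ (fun z => L z u) U) :
    ContDiffOn ℝ ∞ (fun z => LinearMap.trace ℝ E (L z)) U := by
  let b := Module.finBasis ℝ E
  have h : ∀ z, LinearMap.trace ℝ E (L z) =
      ∑ i, (b.coord i).toContinuousLinearMap (L z (b i)) := fun z => by
    rw [LinearMap.trace_eq_matrix_trace ℝ b, Matrix.trace]
    exact Finset.sum_congr rfl fun i _ => by simp [LinearMap.toMatrix_apply]
  simp only [h]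
  exact ContDiffOn.sum fun i _ => (ContinuousLinearMap.contDiff _).comp_contDiffOn (hL (b i))

theorem contDiffOn_ricci : ContDiffOn ℝ ∞ (ricci G) U :=
  contDiffOn_clm_apply.2 fun v => contDiffOn_clm_apply.2 fun w =>
    hG.contDiffOn_trace fun u => hG.contDiffOn_riemann u v w

theorem contDiffOn_scalar : ContDiffOn ℝ ∞ (scalar G) U :=
  hG.contDiffOn_trace fun _ =>
    hG.contDiffOn_inverse.clm_apply (hG.contDiffOn_ricci.clm_apply contDiffOn_const)

theorem contDiffOn_schouten : ContDiffOn ℝ ∞ (schouten G) U :=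
  (hG.contDiffOn_ricci.sub ((hG.contDiffOn_scalar.div_const _).smul hG.contDiffOn)).const_smul _

end IsMetricOn

/-! ### Conformal change -/

/-- The logarithmic derivative `Υ = Ω⁻¹ dΩ`. -/
noncomputable def dlog (Ω : E → ℝ) (z : E) : E →L[ℝ] ℝ := (Ω z)⁻¹ • fderiv ℝ Ω z

/-- The vector `Υ♯ = G⁻¹ Υ`. -/
noncomputable def gradLog (G : E → E →L[ℝ] E →L[ℝ] ℝ) (Ω : E → ℝ) (z : E) : E :=
  (G z).inverse (dlog Ω z)

/-- The covariant Hessian `∇Υ` of `log Ω`. -/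
noncomputable def hessLog (G : E → E →L[ℝ] E →L[ℝ] ℝ) (Ω : E → ℝ) (z : E) :
    E →L[ℝ] E →L[ℝ] ℝ :=
  fderiv ℝ (dlog Ω) z - (ContinuousLinearMap.compL ℝ E E ℝ (dlog Ω z)).comp (christoffel G z)

/-- The tensor `∇_a Υ_b - Υ_a Υ_b + ½ Υ^c Υ_c G_{ab}`. -/
noncomputable def schoutenShift (G : E → E →L[ℝ] E →L[ℝ] ℝ) (Ω : E → ℝ) (z : E) :
    E →L[ℝ] E →L[ℝ] ℝ :=
  hessLog G Ω z - (dlog Ω z).smulRight (dlog Ω z)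
    + (1 / 2 * dlog Ω z (gradLog G Ω z)) • G z

theorem hessLog_apply (G : E → E →L[ℝ] E →L[ℝ] ℝ) (Ω : E → ℝ) (z u v : E) :
    hessLog G Ω z u v = fderiv ℝ (dlog Ω) z u v - dlog Ω z (christoffel G z u v) := rfl

theorem schoutenShift_apply (G : E → E →L[ℝ] E →L[ℝ] ℝ) (Ω : E → ℝ) (z u v : E) :
    schoutenShift G Ω z u v = hessLog G Ω z u v - dlog Ω z u * dlog Ω z v
      + 1 / 2 * dlog Ω z (gradLog G Ω z) * G z u v := rfl

/-- `G' = Ω² G` on `U` for a smooth positive function `Ω`. -/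
structure IsConformalOn (Ω : E → ℝ) (G G' : E → E →L[ℝ] E →L[ℝ] ℝ) (U : Set E) : Prop where
  source : IsMetricOn G U
  target : IsMetricOn G' U
  contDiffOn : ContDiffOn ℝ ∞ Ω U
  pos : ∀ z ∈ U, 0 < Ω z
  eq : ∀ z ∈ U, G' z = Ω z ^ 2 • G z

namespace IsConformalOn

variable {Ω : E → ℝ} {G G' : E → E →L[ℝ] E →L[ℝ] ℝ} {U : Set E} {z : E}
  (h : IsConformalOn Ω G G' U)

include h

theorem differentiableAt (hz : z ∈ U) : DifferentiableAt ℝ Ω z :=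
  (h.contDiffOn.contDiffAt (h.source.mem_nhds hz)).differentiableAt (by simp)

theorem contDiffOn_dlog : ContDiffOn ℝ ∞ (dlog Ω) U :=
  (h.contDiffOn.inv fun z hz => (h.pos z hz).ne').smul
    (h.contDiffOn.fderiv_of_isOpen h.source.isOpen (by simp))

theorem differentiableAt_dlog (hz : z ∈ U) : DifferentiableAt ℝ (dlog Ω) z :=
  (h.contDiffOn_dlog.contDiffAt (h.source.mem_nhds hz)).differentiableAt (by simp)

theorem contDiffOn_gradLog : ContDiffOn ℝ ∞ (gradLog G Ω) U :=
  h.source.contDiffOn_inverse.clm_apply h.contDiffOn_dlog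

theorem differentiableAt_gradLog (hz : z ∈ U) : DifferentiableAt ℝ (gradLog G Ω) z :=
  (h.contDiffOn_gradLog.contDiffAt (h.source.mem_nhds hz)).differentiableAt (by simp)

theorem fderiv_eq (hz : z ∈ U) (u : E) : fderiv ℝ Ω z u = Ω z * dlog Ω z u := by
  have := (h.pos z hz).ne'
  simp [dlog]
  field_simp

theorem apply_gradLog (hz : z ∈ U) : G z (gradLog G Ω z) = dlog Ω z :=
  h.source.apply_inverse hz _

theorem apply_gradLog_right (hz : z ∈ U) (v : E) : G z v (gradLog G Ω z) = dlog Ω z v := by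
  rw [h.source.symm z hz, h.apply_gradLog hz]

/-- `Υ` is closed: from `dΩ = Ω Υ` one gets `d²Ω = Ω (Υ ⊗ Υ + dΥ)`, where `d²Ω` and `Υ ⊗ Υ` are
symmetric and `Ω` is not zero. -/
theorem fderiv_dlog_symm (hz : z ∈ U) (u v : E) :
    fderiv ℝ (dlog Ω) z u v = fderiv ℝ (dlog Ω) z v u := by
  have h1 : ∀ v, (fun y => fderiv ℝ Ω y v) =ᶠ[𝓝 z] fun y => Ω y * dlog Ω y v := fun v => by
    filter_upwards [h.source.mem_nhds hz] with y hy using h.fderiv_eq hy v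
  have h2 : ∀ u v, fderiv ℝ (fderiv ℝ Ω) z u v =
      Ω z * (dlog Ω z u * dlog Ω z v) + Ω z * fderiv ℝ (dlog Ω) z u v := fun u v => by
    have h3 := congrArg (fun L => L u) ((h1 v).fderiv_eq (𝕜 := ℝ))
    have hs : DifferentiableAt ℝ (fderiv ℝ Ω) z :=
      ((h.contDiffOn.fderiv_of_isOpen (m := ∞) h.source.isOpen (by simp)).contDiffAt
        (h.source.mem_nhds hz)).differentiableAt (by simp)
    have hd := h.differentiableAt_dlog hz
    rw [fderiv_apply_apply hs (differentiableAt_const v),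
      fderiv_fun_mul (h.differentiableAt hz) (hd.clm_apply (differentiableAt_const v)),
      add_apply, smul_apply, smul_apply, fderiv_apply_apply hd (differentiableAt_const v),
      h.fderiv_eq hz u] at h3
    simp at h3
    linarith
  have h4 : fderiv ℝ (fderiv ℝ Ω) z u v = fderiv ℝ (fderiv ℝ Ω) z v u :=
    ((h.contDiffOn.contDiffAt (h.source.mem_nhds hz)).isSymmSndFDerivAt
      (by simpa using two_le_infty)).eq u v
  rw [h2, h2] at h4
  refine mul_left_cancel₀ (h.pos z hz).ne' ?_
  linarith

/-- Raising an index commutes with the covariant derivative: the relation between `Υ♯` and `Υ` is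
differentiated and the derivative of `G` is replaced by Christoffel symbols. -/
theorem fderiv_gradLog (hz : z ∈ U) (u : E) :
    fderiv ℝ (gradLog G Ω) z u =
      (G z).inverse (hessLog G Ω z u) - christoffel G z u (gradLog G Ω z) := by
  refine eq_of_forall_apply_eq (h.source.isInvertible z hz) fun w => ?_
  have h1 : (fun y => G y (gradLog G Ω y) w) =ᶠ[𝓝 z] fun y => dlog Ω y w := by
    filter_upwards [h.source.mem_nhds hz] with y hy
    rw [h.apply_gradLog hy]
  have h2 := congrArg (fun L => L u) (h1.fderiv_eq (𝕜 := ℝ))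
  rw [fderiv_bilinear_apply (h.source.differentiableAt hz) (h.differentiableAt_gradLog hz)
    (differentiableAt_const w), fderiv_apply_apply (h.differentiableAt_dlog hz)
    (differentiableAt_const w), h.source.fderiv_eq hz, h.apply_gradLog hz] at h2
  rw [map_sub, sub_apply, h.source.apply_inverse hz, hessLog_apply]
  simp at h2
  linarith

theorem fderiv_target (hz : z ∈ U) (u v w : E) : fderiv ℝ G' z u v w =
    Ω z ^ 2 * (2 * dlog Ω z u * G z v w + fderiv ℝ G z u v w) := by
  have h1 : (fun y => G' y v w) =ᶠ[𝓝 z] fun y => Ω y ^ 2 * G y v w := by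
    filter_upwards [h.source.mem_nhds hz] with y hy
    rw [h.eq y hy]
    rfl
  have hc : ∀ v : E, DifferentiableAt ℝ (fun _ : E => v) z := fun v => differentiableAt_const v
  have h2 := congrArg (fun L => L u) (h1.fderiv_eq (𝕜 := ℝ))
  rw [fderiv_bilinear_apply (h.target.differentiableAt hz) (hc v) (hc w),
    fderiv_fun_mul ((h.differentiableAt hz).fun_pow 2)
      (((h.source.differentiableAt hz).clm_apply (hc v)).clm_apply (hc w)), add_apply, smul_apply,
    smul_apply, fderiv_bilinear_apply (h.source.differentiableAt hz) (hc v) (hc w),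
    fderiv_fun_pow 2 (h.differentiableAt hz), smul_apply, h.fderiv_eq hz] at h2
  simp at h2
  rw [h2]
  ring

/-- The right-hand side is symmetric and compatible with the rescaled metric: the terms in `Υ`
account for the summand `2 Υ ⊗ G` in the derivative of `Ω² G`. -/
theorem christoffel_target (hz : z ∈ U) (u v : E) :
    christoffel G' z u v = christoffel G z u v + dlog Ω z u • v + dlog Ω z v • u
      - G z u v • gradLog G Ω z := by
  refine h.target.christoffel_eq hz
    (K := fun u v => christoffel G z u v + dlog Ω z u • v + dlog Ω z v • u
      - G z u v • gradLog G Ω z) ?_ ?_ u v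
  · intro u v
    rw [h.source.christoffel_symm hz, h.source.symm z hz]
    abel
  · intro u v w
    rw [h.fderiv_target hz, h.source.fderiv_eq hz, h.eq z hz]
    simp only [smul_apply, smul_eq_mul, map_add, map_sub, map_smul, add_apply, sub_apply,
      h.apply_gradLog hz, h.apply_gradLog_right hz]
    rw [h.source.symm z hz v u]
    ring

theorem fderiv_christoffel_target (hz : z ∈ U) (u v w : E) :
    fderiv ℝ (christoffel G') z u v w = fderiv ℝ (christoffel G) z u v w
      + fderiv ℝ (dlog Ω) z u v • w + fderiv ℝ (dlog Ω) z u w • v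
      - fderiv ℝ G z u v w • gradLog G Ω z - G z v w • fderiv ℝ (gradLog G Ω) z u := by
  have h1 : (fun y => christoffel G' y v w) =ᶠ[𝓝 z] fun y => christoffel G y v w
      + dlog Ω y v • w + dlog Ω y w • v - G y v w • gradLog G Ω y := by
    filter_upwards [h.source.mem_nhds hz] with y hy using h.christoffel_target hy v w
  have hc : ∀ v : E, DifferentiableAt ℝ (fun _ : E => v) z := fun v => differentiableAt_const v
  have hΓ := h.source.differentiableAt_christoffel hz
  have hG := h.source.differentiableAt hz
  have hd := h.differentiableAt_dlog hz
  have hN := h.differentiableAt_gradLog hz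
  have a1 := (hΓ.clm_apply (hc v)).clm_apply (hc w)
  have a2 := (hd.clm_apply (hc v)).fun_smul (hc w)
  have a3 := (hd.clm_apply (hc w)).fun_smul (hc v)
  have a4 := (hG.clm_apply (hc v)).clm_apply (hc w)
  have h2 := congrArg (fun L => L u) (h1.fderiv_eq (𝕜 := ℝ))
  rw [fderiv_bilinear_apply (h.target.differentiableAt_christoffel hz) (hc v) (hc w),
    fderiv_fun_sub ((a1.fun_add a2).fun_add a3) (a4.fun_smul hN), fderiv_fun_add (a1.fun_add a2) a3,
    fderiv_fun_add a1 a2, fderiv_fun_smul (hd.clm_apply (hc v)) (hc w),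
    fderiv_fun_smul (hd.clm_apply (hc w)) (hc v), fderiv_fun_smul a4 hN] at h2
  simp only [add_apply, sub_apply, smul_apply, ContinuousLinearMap.smulRight_apply,
    fderiv_bilinear_apply hΓ (hc v) (hc w), fderiv_bilinear_apply hG (hc v) (hc w),
    fderiv_apply_apply hd (hc v), fderiv_apply_apply hd (hc w)] at h2
  simp at h2
  rw [h2]
  abel

/-- Inserting the new Christoffel symbols gives derivatives of `Υ` and of `Υ♯`, which combine with
Christoffel terms into `∇Υ`, and terms quadratic in `Υ`, which `schoutenShift` collects. Closedness
of `Υ` and the vanishing torsion remove the rest. -/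
theorem riemann_target (hz : z ∈ U) (u v w : E) :
    riemann G' z u v w = riemann G z u v w + schoutenShift G Ω z u w • v
      - schoutenShift G Ω z v w • u - G z v w • (G z).inverse (schoutenShift G Ω z u)
      + G z u w • (G z).inverse (schoutenShift G Ω z v) := by
  have hT : ∀ u, (G z).inverse (schoutenShift G Ω z u) = (G z).inverse (hessLog G Ω z u)
      - dlog Ω z u • gradLog G Ω z + (1 / 2 * dlog Ω z (gradLog G Ω z)) • u := fun u => by
    have : schoutenShift G Ω z u = hessLog G Ω z u - dlog Ω z u • dlog Ω z
      + (1 / 2 * dlog Ω z (gradLog G Ω z)) • G z u := rfl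
    rw [this, map_add, map_sub, map_smul, map_smul, h.source.inverse_apply hz]
    rfl
  simp only [riemann, h.fderiv_christoffel_target hz, h.christoffel_target hz,
    h.fderiv_gradLog hz, hT, schoutenShift_apply, hessLog_apply, h.source.fderiv_eq hz,
    map_add, map_sub, map_smul, smul_eq_mul, h.apply_gradLog_right hz]
  rw [h.fderiv_dlog_symm hz u v, h.source.christoffel_symm hz u v, h.source.symm z hz v u]
  module

/-- Trace of `riemann_target` over `u`. With `T` the shift tensor, the four correction terms
contribute `T`, `-n T`, `-(tr T) G` and `T`. -/
theorem ricci_target (hz : z ∈ U) (v w : E) :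
    ricci G' z v w = ricci G z v w
      - ((Module.finrank ℝ E : ℝ) - 2) * schoutenShift G Ω z v w
      - LinearMap.trace ℝ E ((G z).inverse ∘L schoutenShift G Ω z).toLinearMap * G z v w := by
  set T := schoutenShift G Ω z with hT
  have h1 : riemannEnd G' z v w = riemannEnd G z v w
      + (T.flip w).toLinearMap.smulRight v - T v w • LinearMap.id
      - G z v w • ((G z).inverse ∘L T).toLinearMap
      + ((G z).flip w).toLinearMap.smulRight ((G z).inverse (T v)) :=
    LinearMap.ext fun u => h.riemann_target hz u v w
  have h2 : G z ((G z).inverse (T v)) w = T v w := by rw [h.source.apply_inverse hz]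
  rw [ricci_apply_eq_trace, ricci_apply_eq_trace, h1]
  simp only [map_add, map_sub, map_smul, LinearMap.trace_smulRight, LinearMap.trace_id,
    ContinuousLinearMap.coe_coe, ContinuousLinearMap.flip_apply, h2, smul_eq_mul]
  ring

theorem inverse_target (hz : z ∈ U) (α : E →L[ℝ] ℝ) :
    (G' z).inverse α = (Ω z ^ 2)⁻¹ • (G z).inverse α := by
  rw [h.eq z hz, inverse_smul_clm _ (pow_pos (h.pos z hz) 2).ne']

theorem hessLog_apply_inverse (hz : z ∈ U) (v : E) (α : E →L[ℝ] ℝ) :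
    α ((G z).inverse (hessLog G Ω z v)) = hessLog G Ω z v ((G z).inverse α) :=
  h.source.apply_inverse_comm hz _ _

/-- Tracing `ricci_target` once more gives `-(n - 2) tr T - n tr T`, and the inverse of the rescaled
metric supplies the factor `Ω⁻²`. -/
theorem scalar_target (hz : z ∈ U) :
    scalar G' z = (Ω z ^ 2)⁻¹ * (scalar G z - 2 * ((Module.finrank ℝ E : ℝ) - 1) *
      LinearMap.trace ℝ E ((G z).inverse ∘L schoutenShift G Ω z).toLinearMap) := by
  set T := schoutenShift G Ω z with hT
  set t := LinearMap.trace ℝ E ((G z).inverse ∘L T).toLinearMap with ht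
  have h1 : ((G' z).inverse ∘L ricci G' z).toLinearMap = (Ω z ^ 2)⁻¹ •
      (((G z).inverse ∘L ricci G z).toLinearMap
        - ((Module.finrank ℝ E : ℝ) - 2) • ((G z).inverse ∘L T).toLinearMap
        - t • LinearMap.id) := by
    ext v
    have h2 : ricci G' z v = ricci G z v - ((Module.finrank ℝ E : ℝ) - 2) • T v - t • G z v :=
      ContinuousLinearMap.ext fun w => h.ricci_target hz v w
    change (G' z).inverse (ricci G' z v) = _
    rw [h.inverse_target hz, h2, map_sub, map_sub, map_smul, map_smul, h.source.inverse_apply hz]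
    rfl
  rw [scalar, scalar, h1]
  simp only [map_sub, map_smul, LinearMap.trace_id, smul_eq_mul, ← ht]
  ring

/-- The conformal transformation law of the Schouten tensor. -/
theorem schouten_target (hn : 3 ≤ Module.finrank ℝ E) (hz : z ∈ U) (v w : E) :
    schouten G' z v w = schouten G z v w - schoutenShift G Ω z v w := by
  have hn' : (3 : ℝ) ≤ Module.finrank ℝ E := by exact_mod_cast hn
  have h1 : (Module.finrank ℝ E : ℝ) - 2 ≠ 0 := by linarith
  have h2 : (Module.finrank ℝ E : ℝ) - 1 ≠ 0 := by linarith
  have h3 := (h.pos z hz).ne'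
  -- The multiple of `G` in the Ricci law is cancelled by the scalar curvature term, where `Ω⁻²`
  -- meets the `Ω²` of the new metric; only `(n - 2) T` remains, to be divided by `n - 2`.
  rw [schouten_apply, schouten_apply, h.scalar_target hz, h.ricci_target hz, h.eq z hz, smul_apply,
    smul_apply, smul_eq_mul]
  field_simp
  ring

/-! ### The three slots of the tractor derivative under a rescaling. -/

section Tractor

variable {s r : E → ℝ} {m : E → E →L[ℝ] ℝ}

theorem fderiv_fst (hz : z ∈ U) (hs : DifferentiableAt ℝ s z) (v : E) :
    fderiv ℝ (fun y => Ω y * s y) z v - (Ω z • (m z + s z • dlog Ω z)) v =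
      Ω z * (fderiv ℝ s z v - m z v) := by
  rw [fderiv_fun_mul (h.differentiableAt hz) hs]
  simp only [add_apply, smul_apply, smul_eq_mul, h.fderiv_eq hz]
  ring

/-- The derivative of `s Υ` produces `s ∇Υ`, which the new Schouten tensor cancels. Of the multiples
of `G`, the term `m(Υ♯) + s |Υ|²` from the new Christoffel symbols balances `-m(Υ♯) - ½ s |Υ|²` from
the third component and `-½ s |Υ|²` from the Schouten tensor. -/
theorem fderiv_snd (hn : 3 ≤ Module.finrank ℝ E) (hz : z ∈ U) (hs : DifferentiableAt ℝ s z)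
    (hm : DifferentiableAt ℝ m z) (v w : E) :
    fderiv ℝ (fun y => Ω y • (m y + s y • dlog Ω y)) z v w
      - (Ω z • (m z + s z • dlog Ω z)) (christoffel G' z v w)
      + (Ω z)⁻¹ * (r z - m z (gradLog G Ω z) - 1 / 2 * (s z * dlog Ω z (gradLog G Ω z)))
        * G' z v w
      + Ω z * s z * schouten G' z v w =
    Ω z * ((fderiv ℝ m z v w - m z (christoffel G z v w) + r z * G z v w + s z * schouten G z v w)
      + (fderiv ℝ s z v - m z v) * dlog Ω z w) := by
  have hd := h.differentiableAt_dlog hz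
  have h3 := (h.pos z hz).ne'
  rw [fderiv_fun_smul (h.differentiableAt hz) (hm.fun_add (hs.fun_smul hd)),
    fderiv_fun_add hm (hs.fun_smul hd), fderiv_fun_smul hs hd, h.schouten_target hn hz,
    h.christoffel_target hz, h.eq z hz, schoutenShift_apply, hessLog_apply]
  simp only [add_apply, smul_apply, smul_eq_mul, ContinuousLinearMap.smulRight_apply, map_add,
    map_sub, map_smul, h.fderiv_eq hz]
  field_simp
  ring

/-- Differentiating `Υ♯` gives the raised form of `∇_v Υ`. By symmetry of the inverse metric, its
pairing with `m` equals `∇_v Υ` on the vector `G⁻¹ m`, the form in which the change of the Schouten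
tensor supplies the term that cancels it. -/
theorem fderiv_trd (hn : 3 ≤ Module.finrank ℝ E) (hz : z ∈ U) (hs : DifferentiableAt ℝ s z)
    (hm : DifferentiableAt ℝ m z) (hr : DifferentiableAt ℝ r z) (v : E) :
    fderiv ℝ (fun y => (Ω y)⁻¹ *
        (r y - m y (gradLog G Ω y) - 1 / 2 * (s y * dlog Ω y (gradLog G Ω y)))) z v
      - schouten G' z v ((G' z).inverse (Ω z • (m z + s z • dlog Ω z))) =
    (Ω z)⁻¹ * ((fderiv ℝ r z v - schouten G z v ((G z).inverse (m z)))
      - (fderiv ℝ m z v (gradLog G Ω z) - m z (christoffel G z v (gradLog G Ω z))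
        + r z * G z v (gradLog G Ω z) + s z * schouten G z v (gradLog G Ω z))
      - 1 / 2 * ((fderiv ℝ s z v - m z v) * dlog Ω z (gradLog G Ω z))) := by
  have hd := h.differentiableAt_dlog hz
  have hN := h.differentiableAt_gradLog hz
  have h3 := (h.pos z hz).ne'
  have b1 := hm.clm_apply hN
  have b2 := hd.clm_apply hN
  have hN' : (G z).inverse (dlog Ω z) = gradLog G Ω z := rfl
  have e1 : schouten G' z v ((G' z).inverse (Ω z • (m z + s z • dlog Ω z))) = (Ω z)⁻¹ *
      (schouten G z v ((G z).inverse (m z)) + s z * schouten G z v (gradLog G Ω z)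
        - (schoutenShift G Ω z v ((G z).inverse (m z))
          + s z * schoutenShift G Ω z v (gradLog G Ω z))) := by
    rw [h.inverse_target hz, h.schouten_target hn hz]
    simp only [map_add, map_smul, smul_eq_mul, hN']
    field_simp
  have e2 : dlog Ω z ((G z).inverse (m z)) = m z (gradLog G Ω z) :=
    h.source.apply_inverse_comm hz _ _
  have e3 : G z v ((G z).inverse (m z)) = m z v := h.source.apply_inverse_right hz _ _
  have e4 : fderiv ℝ (fun y => (Ω y)⁻¹) z v = - ((Ω z)⁻¹ * dlog Ω z v) := by
    have : fderiv ℝ (fun y => (Ω y)⁻¹) z = _ :=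
      ((hasDerivAt_inv h3).comp_hasFDerivAt z (h.differentiableAt hz).hasFDerivAt).fderiv
    rw [this]
    simp only [smul_apply, smul_eq_mul, h.fderiv_eq hz]
    field_simp
  rw [fderiv_fun_mul ((h.differentiableAt hz).fun_inv h3)
      ((hr.fun_sub b1).fun_sub ((hs.fun_mul b2).const_mul (1 / 2))), fderiv_fun_sub (hr.fun_sub b1)
      ((hs.fun_mul b2).const_mul (1 / 2)), fderiv_fun_sub hr b1, fderiv_const_mul (hs.fun_mul b2),
    fderiv_fun_mul hs b2, e1]
  simp only [add_apply, smul_apply, smul_eq_mul, sub_apply, fderiv_apply_apply hm hN,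
    fderiv_apply_apply hd hN, h.fderiv_gradLog hz, map_sub, h.hessLog_apply_inverse hz, hN', e4,
    schoutenShift_apply, e2, e3, h.apply_gradLog_right hz]
  -- Only the Hessian on `Υ♯` is expanded, to meet the bare derivative of `Υ`; the Hessian on `G⁻¹
  -- m` cancels unexpanded.
  rw [hessLog_apply G Ω z v (gradLog G Ω z)]
  field_simp
  ring

end Tractor

end IsConformalOn

end LocalMetric

namespace LocalMetric

/-- Nondegeneracy is injectivity of the map into the dual, and the dual has the same finite
dimension. -/
theorem isInvertible_of_nondegenerate {E : Type*} [NormedAddCommGroup E] [NormedSpace ℝ E]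
    [FiniteDimensional ℝ E] {b : E →L[ℝ] E →L[ℝ] ℝ} (h : ∀ v, (∀ w, b v w = 0) → v = 0) :
    b.IsInvertible := by
  have hinj : Function.Injective b.toLinearMap := by
    rw [injective_iff_map_eq_zero]
    exact fun v hv => h v fun w => congrArg (fun L : E →L[ℝ] ℝ => L w) hv
  have hd : Module.finrank ℝ E = Module.finrank ℝ (E →L[ℝ] ℝ) := by
    rw [← (LinearMap.toContinuousLinearMap (𝕜 := ℝ) (E := E) (F' := ℝ)).finrank_eq]
    exact (Subspace.dual_finrank_eq (K := ℝ) (V := E)).symm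
  exact ⟨(LinearEquiv.ofBijective b.toLinearMap ⟨hinj,
    (LinearMap.injective_iff_surjective_of_finrank_eq_finrank hd).1 hinj⟩).toContinuousLinearEquiv,
    rfl⟩

end LocalMetric

/-! ### Chart transitions and coordinate frames. -/

noncomputable section Charts

variable {E : Type*} [NormedAddCommGroup E] [NormedSpace ℝ E]
  {M : Type*} [TopologicalSpace M] [ChartedSpace E M] [IsManifold 𝓘(ℝ, E) ∞ M]

/-- The domain of the chart transition from the chart around `a` to the chart around `b`. -/
def chartOverlap (E : Type*) [NormedAddCommGroup E] [NormedSpace ℝ E] {M : Type*}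
    [TopologicalSpace M] [ChartedSpace E M] (a b : M) : Set E :=
  ((extChartAt 𝓘(ℝ, E) a).symm ≫ extChartAt 𝓘(ℝ, E) b).source

/-- The chart transition from the chart around `a` to the chart around `b`. -/
def chartTransition (E : Type*) [NormedAddCommGroup E] [NormedSpace ℝ E] {M : Type*}
    [TopologicalSpace M] [ChartedSpace E M] (a b : M) : E → E :=
  extChartAt 𝓘(ℝ, E) b ∘ (extChartAt 𝓘(ℝ, E) a).symm

theorem mem_extChartAt_source_iff {a x : M} :
    x ∈ (extChartAt 𝓘(ℝ, E) a).source ↔ x ∈ (chartAt E a).source := by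
  rw [extChartAt_source]

theorem chartFrame_chartCoframe {a x : M} (hx : x ∈ (extChartAt 𝓘(ℝ, E) a).source)
    (v : TangentSpace 𝓘(ℝ, E) x) : chartFrame E a x (chartCoframe E a x v) = v :=
  (trivializationAt E (TangentSpace 𝓘(ℝ, E)) a).symmL_continuousLinearMapAt
    (by simpa using hx) v

theorem chartCoframe_chartFrame {a x : M} (hx : x ∈ (extChartAt 𝓘(ℝ, E) a).source) (v : E) :
    chartCoframe E a x (chartFrame E a x v) = v :=
  (trivializationAt E (TangentSpace 𝓘(ℝ, E)) a).continuousLinearMapAt_symmL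
    (by simpa using hx) v

theorem mem_chartOverlap {a b : M} {z : E} : z ∈ chartOverlap E a b ↔
    z ∈ (extChartAt 𝓘(ℝ, E) a).target ∧
      (extChartAt 𝓘(ℝ, E) a).symm z ∈ (extChartAt 𝓘(ℝ, E) b).source := by
  simp [chartOverlap, PartialEquiv.trans_source]

theorem extChartAt_mem_chartOverlap {a b x : M} (ha : x ∈ (extChartAt 𝓘(ℝ, E) a).source)
    (hb : x ∈ (extChartAt 𝓘(ℝ, E) b).source) : extChartAt 𝓘(ℝ, E) a x ∈ chartOverlap E a b :=
  mem_chartOverlap.2 ⟨(extChartAt 𝓘(ℝ, E) a).map_source ha, by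
    rwa [(extChartAt 𝓘(ℝ, E) a).left_inv ha]⟩

theorem chartTransition_extChartAt {a x : M} (b : M) (ha : x ∈ (extChartAt 𝓘(ℝ, E) a).source) :
    chartTransition E a b (extChartAt 𝓘(ℝ, E) a x) = extChartAt 𝓘(ℝ, E) b x := by
  rw [chartTransition, Function.comp_apply, (extChartAt 𝓘(ℝ, E) a).left_inv ha]

theorem isOpen_chartOverlap (a b : M) : IsOpen (chartOverlap E a b) := by
  have h : chartOverlap E a b = (extChartAt 𝓘(ℝ, E) a).target ∩
      (extChartAt 𝓘(ℝ, E) a).symm ⁻¹' (extChartAt 𝓘(ℝ, E) b).source := by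
    ext z
    exact mem_chartOverlap
  rw [h]
  exact (continuousOn_extChartAt_symm a).isOpen_inter_preimage (isOpen_extChartAt_target a)
    (isOpen_extChartAt_source b)

theorem contDiffOn_chartTransition (a b : M) :
    ContDiffOn ℝ ∞ (chartTransition E a b) (chartOverlap E a b) :=
  contDiffOn_ext_coord_change b a

/-- The tangent space at a point `y` is modelled on `E` through the preferred chart of `y`. The
frame of `a` is the coordinate change from `a` to that chart, the coframe of `b` is the one from
that chart to `b`, and the cocycle rule composes them. -/
theorem fderiv_chartTransition {a b : M} {z : E} (hz : z ∈ chartOverlap E a b) (v : E) :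
    fderiv ℝ (chartTransition E a b) z v = chartCoframe E b ((extChartAt 𝓘(ℝ, E) a).symm z)
      (chartFrame E a ((extChartAt 𝓘(ℝ, E) a).symm z) v) := by
  obtain ⟨hz1, hz2⟩ := mem_chartOverlap.1 hz
  have hza := (extChartAt 𝓘(ℝ, E) a).map_target hz1
  have hzz := (extChartAt 𝓘(ℝ, E) a).right_inv hz1
  set y := (extChartAt 𝓘(ℝ, E) a).symm z with hy
  have h1 : chartFrame E a y = tangentCoordChange 𝓘(ℝ, E) a y y :=
    TangentBundle.symmL_trivializationAt_eq_core (mem_extChartAt_source_iff.1 hza)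
  have h2 : chartCoframe E b y = tangentCoordChange 𝓘(ℝ, E) y b y :=
    TangentBundle.continuousLinearMapAt_trivializationAt_eq_core (mem_extChartAt_source_iff.1 hz2)
  have h3 : tangentCoordChange 𝓘(ℝ, E) y b y (tangentCoordChange 𝓘(ℝ, E) a y y v)
      = tangentCoordChange 𝓘(ℝ, E) a b y v :=
    tangentCoordChange_comp ⟨⟨hza, mem_extChartAt_source y⟩, hz2⟩
  rw [h1, h2]
  refine Eq.trans ?_ h3.symm
  rw [tangentCoordChange_def, hzz, ModelWithCorners.range_eq_univ, fderivWithin_univ]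
  rfl

theorem isInvertible_fderiv_chartTransition {a b : M} {z : E} (hz : z ∈ chartOverlap E a b) :
    (fderiv ℝ (chartTransition E a b) z).IsInvertible := by
  obtain ⟨hz1, hz2⟩ := mem_chartOverlap.1 hz
  have hza := (extChartAt 𝓘(ℝ, E) a).map_target hz1
  refine ⟨ContinuousLinearEquiv.equivOfInverse (fderiv ℝ (chartTransition E a b) z)
    (chartCoframe E a _ ∘L chartFrame E b ((extChartAt 𝓘(ℝ, E) a).symm z)) (fun v => ?_)
    (fun v => ?_), rfl⟩
  · rw [fderiv_chartTransition hz]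
    change chartCoframe E a _ (chartFrame E b _ _) = v
    rw [chartFrame_chartCoframe hz2, chartCoframe_chartFrame hza]
  · rw [fderiv_chartTransition hz]
    change chartCoframe E b _ (chartFrame E a _ (chartCoframe E a _ (chartFrame E b _ v))) = v
    rw [chartFrame_chartCoframe hza, chartCoframe_chartFrame hz2]

theorem chartFrame_fderiv_chartTransition {a b : M} {z : E} (hz : z ∈ chartOverlap E a b)
    (v : E) : chartFrame E b ((extChartAt 𝓘(ℝ, E) a).symm z)
      (fderiv ℝ (chartTransition E a b) z v) =
        chartFrame E a ((extChartAt 𝓘(ℝ, E) a).symm z) v := by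
  rw [fderiv_chartTransition hz, chartFrame_chartCoframe (mem_chartOverlap.1 hz).2]

theorem extChartAt_symm_chartTransition {a b : M} {z : E} (hz : z ∈ chartOverlap E a b) :
    (extChartAt 𝓘(ℝ, E) b).symm (chartTransition E a b z) = (extChartAt 𝓘(ℝ, E) a).symm z :=
  (extChartAt 𝓘(ℝ, E) b).left_inv (mem_chartOverlap.1 hz).2

/-! ### Derivatives of functions on the manifold, read in a chart. -/

section Functions

variable {F : Type*} [NormedAddCommGroup F] [NormedSpace ℝ F]

theorem mdifferentiableAt_extChartAt_symm {a : M} {z : E}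
    (hz : z ∈ (extChartAt 𝓘(ℝ, E) a).target) :
    MDifferentiableAt 𝓘(ℝ, E) 𝓘(ℝ, E) (extChartAt 𝓘(ℝ, E) a).symm z :=
  ((contMDiffOn_extChartAt_symm (n := ∞) a).contMDiffAt
    ((isOpen_extChartAt_target a).mem_nhds hz)).mdifferentiableAt (by simp)

theorem eventuallyEq_comp_extChartAt {a x : M} (hx : x ∈ (extChartAt 𝓘(ℝ, E) a).source)
    (f : M → F) :
    f =ᶠ[𝓝 x] (f ∘ (extChartAt 𝓘(ℝ, E) a).symm) ∘ extChartAt 𝓘(ℝ, E) a := by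
  filter_upwards [(isOpen_extChartAt_source a).mem_nhds hx] with y hy
  rw [Function.comp_apply, Function.comp_apply, (extChartAt 𝓘(ℝ, E) a).left_inv hy]

theorem mdifferentiableAt_extChartAt_of_mem {a x : M}
    (hx : x ∈ (extChartAt 𝓘(ℝ, E) a).source) :
    MDifferentiableAt 𝓘(ℝ, E) 𝓘(ℝ, E) (extChartAt 𝓘(ℝ, E) a) x :=
  mdifferentiableAt_extChartAt (mem_extChartAt_source_iff.1 hx)

theorem mdifferentiableAt_iff_comp_extChartAt_symm {a x : M}
    (hx : x ∈ (extChartAt 𝓘(ℝ, E) a).source) {f : M → F} :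
    MDifferentiableAt 𝓘(ℝ, E) 𝓘(ℝ, F) f x ↔
      DifferentiableAt ℝ (f ∘ (extChartAt 𝓘(ℝ, E) a).symm) (extChartAt 𝓘(ℝ, E) a x) := by
  constructor
  · intro hf
    refine mdifferentiableAt_iff_differentiableAt.1 (MDifferentiableAt.comp _ ?_
      (mdifferentiableAt_extChartAt_symm ((extChartAt 𝓘(ℝ, E) a).map_source hx)))
    rwa [(extChartAt 𝓘(ℝ, E) a).left_inv hx]
  · intro hf
    exact ((mdifferentiableAt_iff_differentiableAt.2 hf).comp x
      (mdifferentiableAt_extChartAt_of_mem hx)).congr_of_eventuallyEq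
        (eventuallyEq_comp_extChartAt hx f)

/-- This frees the derivative at `x` from the preferred chart of `x`: any chart whose domain
contains `x` may be used. The chain rule applies since, near `x`, the function is its coordinate
expression composed with the chart, and the derivative of the chart is the coframe. -/
theorem mvfderiv_eq_fderiv_comp_extChartAt_symm {a x : M}
    (hx : x ∈ (extChartAt 𝓘(ℝ, E) a).source) {f : M → F}
    (hf : MDifferentiableAt 𝓘(ℝ, E) 𝓘(ℝ, F) f x) (v : TangentSpace 𝓘(ℝ, E) x) :
    mvfderiv 𝓘(ℝ, E) f x v = fderiv ℝ (f ∘ (extChartAt 𝓘(ℝ, E) a).symm)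
      (extChartAt 𝓘(ℝ, E) a x) (chartCoframe E a x v) := by
  have h1 : mfderiv 𝓘(ℝ, E) 𝓘(ℝ, F) f x = mfderiv 𝓘(ℝ, E) 𝓘(ℝ, F)
      ((f ∘ (extChartAt 𝓘(ℝ, E) a).symm) ∘ extChartAt 𝓘(ℝ, E) a) x :=
    (eventuallyEq_comp_extChartAt hx f).mfderiv_eq
  have h2 : chartCoframe E a x = mfderiv 𝓘(ℝ, E) 𝓘(ℝ, E) (extChartAt 𝓘(ℝ, E) a) x :=
    TangentBundle.continuousLinearMapAt_trivializationAt (mem_extChartAt_source_iff.1 hx)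
  rw [mfderiv_comp x (mdifferentiableAt_iff_differentiableAt.2
    ((mdifferentiableAt_iff_comp_extChartAt_symm hx).1 hf))
    (mdifferentiableAt_extChartAt_of_mem hx), mfderiv_eq_fderiv] at h1
  rw [h2]
  change (mfderiv 𝓘(ℝ, E) 𝓘(ℝ, F) f x) v = _
  rw [h1]
  rfl

end Functions

/-- The components of a 1-form in the chart around `a`. -/
def formInChart (a : M) (μ : ∀ y : M, Cotangent E y) (z : E) : E →L[ℝ] ℝ :=
  (μ ((extChartAt 𝓘(ℝ, E) a).symm z)) ∘L (chartFrame E a ((extChartAt 𝓘(ℝ, E) a).symm z))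

theorem formInChart_eq_comp_fderiv {a b : M} {z : E} (hz : z ∈ chartOverlap E a b)
    (μ : ∀ y : M, Cotangent E y) :
    formInChart a μ z =
      formInChart b μ (chartTransition E a b z) ∘L fderiv ℝ (chartTransition E a b) z := by
  ext v
  change _ = μ _ (chartFrame E b _ _)
  rw [extChartAt_symm_chartTransition hz]
  exact congrArg (μ _) (chartFrame_fderiv_chartTransition hz v).symm

/-! ### Levi-Civita derivative and Schouten tensor in an arbitrary chart. -/

namespace PseudoRiemannianMetric

variable {p q : ℕ} (g : PseudoRiemannianMetric E M p q)

theorem inChart_apply (a : M) (z u v : E) : g.inChart a z u v =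
    g.val ((extChartAt 𝓘(ℝ, E) a).symm z) (chartFrame E a _ u) (chartFrame E a _ v) := rfl

theorem isInvertible_val [FiniteDimensional ℝ E] (x : M) : (g.val x).IsInvertible :=
  LocalMetric.isInvertible_of_nondegenerate (E := E) (b := g.val x) (g.nondegenerate x)

theorem contMDiffOn_chartFrame (a : M) (u : E) :
    ContMDiffOn 𝓘(ℝ, E) (𝓘(ℝ, E).prod 𝓘(ℝ, E)) ∞
      (fun y => TotalSpace.mk' E y (chartFrame E a y u)) (extChartAt 𝓘(ℝ, E) a).source := by
  have h := (trivializationAt E (TangentSpace 𝓘(ℝ, E)) a).contMDiffOn_symmL (n := ∞)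
    (IB := 𝓘(ℝ, E))
  have hs : (trivializationAt E (TangentSpace 𝓘(ℝ, E)) a).baseSet
    = (extChartAt 𝓘(ℝ, E) a).source := by simp
  rw [hs] at h
  have hu : ContMDiffOn 𝓘(ℝ, E) (𝓘(ℝ, E).prod 𝓘(ℝ, E)) ∞
      (fun y : M => TotalSpace.mk' E (E := Bundle.Trivial M E) y u)
      (extChartAt 𝓘(ℝ, E) a).source := fun y _ =>
    (contMDiffWithinAt_totalSpace).2 ⟨contMDiffWithinAt_id, contMDiffWithinAt_const⟩
  exact h.clm_bundle_apply hu

theorem isMetricOn_inChart [FiniteDimensional ℝ E] (a : M) :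
    LocalMetric.IsMetricOn (g.inChart a) (extChartAt 𝓘(ℝ, E) a).target where
  isOpen := isOpen_extChartAt_target a
  symm z _ u v := g.symm _ _ _
  isInvertible z hz := by
    have hza := (extChartAt 𝓘(ℝ, E) a).map_target hz
    -- The frame is an isomorphism over the chart domain, so nondegeneracy passes from the tangent
    -- space to `E`.
    refine LocalMetric.isInvertible_of_nondegenerate fun v hv => ?_
    have h1 : chartFrame E a _ v = 0 := g.nondegenerate _ _ fun w => by
      have := hv (chartCoframe E a _ w)
      rwa [inChart_apply, chartFrame_chartCoframe hza] at this
    rw [← chartCoframe_chartFrame hza v, h1, map_zero]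
  contDiffOn := by
    refine contDiffOn_clm_apply.2 fun u => contDiffOn_clm_apply.2 fun v => ?_
    have h1 : ContMDiffOn 𝓘(ℝ, E) (𝓘(ℝ, E).prod 𝓘(ℝ, ℝ)) ∞
        (fun y => TotalSpace.mk' ℝ (E := Bundle.Trivial M ℝ) y
          (g.val y (chartFrame E a y u) (chartFrame E a y v)))
        (extChartAt 𝓘(ℝ, E) a).source :=
      ContMDiffOn.clm_bundle_apply₂ (E₃ := Bundle.Trivial M ℝ) g.contMDiff.contMDiffOn
        (contMDiffOn_chartFrame a u) (contMDiffOn_chartFrame a v)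
    have h2 : ContMDiffOn 𝓘(ℝ, E) 𝓘(ℝ, ℝ) ∞
        (fun y => g.val y (chartFrame E a y u) (chartFrame E a y v))
        (extChartAt 𝓘(ℝ, E) a).source := fun y hy =>
      (contMDiffWithinAt_totalSpace.1 (h1 y hy)).2
    exact (h2.comp (contMDiffOn_extChartAt_symm a)
      fun z hz => (extChartAt 𝓘(ℝ, E) a).map_target hz).contDiffOn

theorem isIsometryOn_chartTransition [FiniteDimensional ℝ E] (a b : M) :
    LocalMetric.IsIsometryOn (chartTransition E a b) (g.inChart a) (g.inChart b)
      (chartOverlap E a b) (extChartAt 𝓘(ℝ, E) b).target where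
  source := (g.isMetricOn_inChart a).mono (isOpen_chartOverlap a b)
    fun _ hz => (mem_chartOverlap.1 hz).1
  target := g.isMetricOn_inChart b
  mapsTo _ hz := (extChartAt 𝓘(ℝ, E) b).map_source (mem_chartOverlap.1 hz).2
  contDiffOn := contDiffOn_chartTransition a b
  isInvertible _ hz := isInvertible_fderiv_chartTransition hz
  pull z hz v w := by
    rw [inChart_apply, inChart_apply, extChartAt_symm_chartTransition hz,
      chartFrame_fderiv_chartTransition hz, chartFrame_fderiv_chartTransition hz]

variable [FiniteDimensional ℝ E]

/-- The Levi-Civita covariant derivative in the chart around `x` at the point `x`. -/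
theorem leviCivita_apply_self (μ : ∀ y : M, Cotangent E y) (x : M)
    (hμ : DifferentiableAt ℝ (formInChart x μ) (extChartAt 𝓘(ℝ, E) x x))
    (v w : TangentSpace 𝓘(ℝ, E) x) :
    g.leviCivita μ x v w =
      fderiv ℝ (formInChart x μ) (extChartAt 𝓘(ℝ, E) x x) (chartCoframe E x x v)
          (chartCoframe E x x w)
        - formInChart x μ (extChartAt 𝓘(ℝ, E) x x)
          (LocalMetric.christoffel (g.inChart x) (extChartAt 𝓘(ℝ, E) x x) (chartCoframe E x x v)
            (chartCoframe E x x w)) := by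
  have hx := mem_extChartAt_source (I := 𝓘(ℝ, E)) x
  have h1 : MDifferentiableAt 𝓘(ℝ, E) 𝓘(ℝ, E →L[ℝ] ℝ)
      (fun y => ((μ y) ∘L (chartFrame E x y) : E →L[ℝ] ℝ)) x :=
    (mdifferentiableAt_iff_comp_extChartAt_symm hx).2 hμ
  have h2 := mvfderiv_eq_fderiv_comp_extChartAt_symm hx h1 v
  have h3 : formInChart x μ (extChartAt 𝓘(ℝ, E) x x) = (μ x) ∘L (chartFrame E x x) := by
    rw [formInChart, (extChartAt 𝓘(ℝ, E) x).left_inv hx]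
  rw [h3]
  change (mvfderiv 𝓘(ℝ, E) (fun y => ((μ y) ∘L (chartFrame E x y) : E →L[ℝ] ℝ)) x v)
    (chartCoframe E x x w) - _ = _
  rw [h2]
  rfl

/-- The Levi-Civita covariant derivative can be computed in any chart. -/
theorem leviCivita_apply (μ : ∀ y : M, Cotangent E y) {a x : M}
    (hx : x ∈ (extChartAt 𝓘(ℝ, E) a).source)
    (hμ : DifferentiableAt ℝ (formInChart a μ) (extChartAt 𝓘(ℝ, E) a x))
    (v w : TangentSpace 𝓘(ℝ, E) x) :
    g.leviCivita μ x v w =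
      fderiv ℝ (formInChart a μ) (extChartAt 𝓘(ℝ, E) a x) (chartCoframe E a x v)
          (chartCoframe E a x w)
        - formInChart a μ (extChartAt 𝓘(ℝ, E) a x)
          (LocalMetric.christoffel (g.inChart a) (extChartAt 𝓘(ℝ, E) a x) (chartCoframe E a x v)
            (chartCoframe E a x w)) := by
  have hxx := mem_extChartAt_source (I := 𝓘(ℝ, E)) x
  have h := g.isIsometryOn_chartTransition x a
  have hz := extChartAt_mem_chartOverlap hxx hx
  have hφ := chartTransition_extChartAt a hxx
  have hco : ∀ u : TangentSpace 𝓘(ℝ, E) x, fderiv ℝ (chartTransition E x a)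
      (extChartAt 𝓘(ℝ, E) x x) (chartCoframe E x x u) = chartCoframe E a x u := fun u => by
    rw [fderiv_chartTransition hz, (extChartAt 𝓘(ℝ, E) x).left_inv hxx,
      chartFrame_chartCoframe hxx]
  rw [← hφ] at hμ ⊢
  set z := extChartAt 𝓘(ℝ, E) x x with hzdef
  have he : formInChart x μ =ᶠ[𝓝 z] fun y => formInChart a μ (chartTransition E x a y) ∘L
      fderiv ℝ (chartTransition E x a) y := by
    filter_upwards [h.source.mem_nhds hz] with y hy using formInChart_eq_comp_fderiv hy μ
  have hc : DifferentiableAt ℝ (fun y => formInChart a μ (chartTransition E x a y)) z :=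
    hμ.comp z (h.differentiableAt hz)
  have hA := h.differentiableAt_fderiv hz
  have hμ' : DifferentiableAt ℝ (formInChart x μ) z :=
    (hc.clm_comp hA).congr_of_eventuallyEq he
  have hd : ∀ u w : E, fderiv ℝ (formInChart x μ) z u w =
      fderiv ℝ (formInChart a μ) (chartTransition E x a z) (fderiv ℝ (chartTransition E x a) z u)
        (fderiv ℝ (chartTransition E x a) z w)
      + formInChart a μ (chartTransition E x a z)
        (fderiv ℝ (fderiv ℝ (chartTransition E x a)) z u w) := fun u w => by
    rw [he.fderiv_eq, fderiv_clm_comp hc hA]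
    simp [h.fderiv_comp_apply hz hμ, add_comm]
  -- The derivative of the components of `μ` and the Christoffel symbols each acquire a second
  -- derivative of the chart transition; with opposite signs these cancel.
  rw [g.leviCivita_apply_self μ x hμ', ← hzdef, hd, formInChart_eq_comp_fderiv hz]
  rw [ContinuousLinearMap.comp_apply, h.apply_christoffel hz, hco, hco, map_add]
  ring

theorem val_apply {a x : M} (hx : x ∈ (extChartAt 𝓘(ℝ, E) a).source)
    (v w : TangentSpace 𝓘(ℝ, E) x) :
    g.val x v w = g.inChart a (extChartAt 𝓘(ℝ, E) a x)
      (chartCoframe E a x v) (chartCoframe E a x w) := by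
  rw [inChart_apply, (extChartAt 𝓘(ℝ, E) a).left_inv hx, chartFrame_chartCoframe hx,
    chartFrame_chartCoframe hx]

theorem val_apply_inverse (x : M) (α : Cotangent E x) : g.val x ((g.val x).inverse α) = α := by
  obtain ⟨e, he⟩ := g.isInvertible_val x
  rw [← he, ContinuousLinearMap.inverse_equiv]
  exact e.apply_symm_apply α

/-- Index raising commutes with passing to components, as is seen by pairing both sides with vectors
through the nondegenerate coordinate metric. -/
theorem chartCoframe_inverse {a x : M} (hx : x ∈ (extChartAt 𝓘(ℝ, E) a).source)
    (α : Cotangent E x) : chartCoframe E a x ((g.val x).inverse α) =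
      (g.inChart a (extChartAt 𝓘(ℝ, E) a x)).inverse (α ∘L chartFrame E a x) := by
  have hG := g.isMetricOn_inChart a
  have hz := (extChartAt 𝓘(ℝ, E) a).map_source hx
  refine LocalMetric.eq_of_forall_apply_eq (hG.isInvertible _ hz) fun w => ?_
  rw [hG.apply_inverse hz]
  have h1 := g.val_apply hx ((g.val x).inverse α) (chartFrame E a x w)
  rw [chartCoframe_chartFrame hx, val_apply_inverse] at h1
  exact h1.symm

theorem ricci_apply_self (x : M) (v w : TangentSpace 𝓘(ℝ, E) x) :
    g.ricci x v w = LocalMetric.ricci (g.inChart x) (extChartAt 𝓘(ℝ, E) x x)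
      (chartCoframe E x x v) (chartCoframe E x x w) := rfl

theorem scalar_eq_self (x : M) :
    g.scalar x = LocalMetric.scalar (g.inChart x) (extChartAt 𝓘(ℝ, E) x x) := by
  have hx := mem_extChartAt_source (I := 𝓘(ℝ, E)) x
  let e : TangentSpace 𝓘(ℝ, E) x ≃ₗ[ℝ] E :=
    LinearEquiv.ofLinearMap (chartCoframe E x x).toLinearMap (chartFrame E x x).toLinearMap
      (LinearMap.ext fun v => chartCoframe_chartFrame hx v)
      (LinearMap.ext fun v => chartFrame_chartCoframe hx v)
  rw [scalar, LocalMetric.scalar, ← LinearMap.trace_conj' _ e]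
  congr 1
  ext u
  change chartCoframe E x x ((g.val x).inverse (g.ricci x (chartFrame E x x u))) = _
  rw [g.chartCoframe_inverse hx]
  change _ = (g.inChart x (extChartAt 𝓘(ℝ, E) x x)).inverse
    (LocalMetric.ricci (g.inChart x) (extChartAt 𝓘(ℝ, E) x x) u)
  congr 1
  ext w
  change g.ricci x (chartFrame E x x u) (chartFrame E x x w) = _
  rw [ricci_apply_self, chartCoframe_chartFrame hx, chartCoframe_chartFrame hx]

theorem schouten_apply_self (x : M) (v w : TangentSpace 𝓘(ℝ, E) x) :
    g.schouten x v w = LocalMetric.schouten (g.inChart x) (extChartAt 𝓘(ℝ, E) x x)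
      (chartCoframe E x x v) (chartCoframe E x x w) := by
  have hx := mem_extChartAt_source (I := 𝓘(ℝ, E)) x
  rw [LocalMetric.schouten_apply, ← scalar_eq_self, ← g.val_apply hx, ← g.ricci_apply_self]
  rfl

/-- The Schouten tensor can be computed in any chart. -/
theorem schouten_apply {a x : M} (hx : x ∈ (extChartAt 𝓘(ℝ, E) a).source)
    (v w : TangentSpace 𝓘(ℝ, E) x) :
    g.schouten x v w = LocalMetric.schouten (g.inChart a) (extChartAt 𝓘(ℝ, E) a x)
      (chartCoframe E a x v) (chartCoframe E a x w) := by
  have hxx := mem_extChartAt_source (I := 𝓘(ℝ, E)) x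
  have hz := extChartAt_mem_chartOverlap hxx hx
  have hco : ∀ u : TangentSpace 𝓘(ℝ, E) x, fderiv ℝ (chartTransition E x a)
      (extChartAt 𝓘(ℝ, E) x x) (chartCoframe E x x u) = chartCoframe E a x u := fun u => by
    rw [fderiv_chartTransition hz, (extChartAt 𝓘(ℝ, E) x).left_inv hxx,
      chartFrame_chartCoframe hxx]
  rw [g.schouten_apply_self, (g.isIsometryOn_chartTransition x a).schouten_apply hz,
    chartTransition_extChartAt a hxx, hco, hco]

end PseudoRiemannianMetric

end Charts

/-! ### The tractor connection in coordinates. -/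

namespace LocalMetric

variable {E : Type*} [NormedAddCommGroup E] [NormedSpace ℝ E]

/-- Change of the coordinates of a tractor when the metric is multiplied by `k²`. -/
noncomputable def scaleWeights (k : ℝ) (t : TractorModel E) : TractorModel E :=
  (k * t.1, k • t.2.1, k⁻¹ * t.2.2)

/-- The conformal transformation of tractors in coordinates. -/
noncomputable def tractorShift (G : E → E →L[ℝ] E →L[ℝ] ℝ) (Ω : E → ℝ) (z : E)
    (t : TractorModel E) : TractorModel E :=
  (t.1, t.2.1 + t.1 • dlog Ω z,
    t.2.2 - t.2.1 (gradLog G Ω z) - 1 / 2 * (t.1 * dlog Ω z (gradLog G Ω z)))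

theorem contDiffOn_scaleWeights {U : Set E} {k : E → ℝ} {t : E → TractorModel E}
    (hk : ContDiffOn ℝ ∞ k U) (hk' : ∀ z ∈ U, k z ≠ 0) (ht : ContDiffOn ℝ ∞ t U) :
    ContDiffOn ℝ ∞ (fun z => scaleWeights (k z) (t z)) U :=
  (hk.mul ht.fst).prodMk ((hk.smul ht.snd.fst).prodMk ((hk.inv hk').mul ht.snd.snd))

theorem differentiableAt_scaleWeights {z : E} {k : E → ℝ} {t : E → TractorModel E}
    (hk : DifferentiableAt ℝ k z) (hk' : k z ≠ 0) (ht : DifferentiableAt ℝ t z) :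
    DifferentiableAt ℝ (fun z => scaleWeights (k z) (t z)) z :=
  (hk.mul ht.fst).prodMk ((hk.smul ht.snd.fst).prodMk ((hk.inv hk').mul ht.snd.snd))

variable [FiniteDimensional ℝ E]

/-- The tractor connection in coordinates. -/
noncomputable def tractorDeriv (G : E → E →L[ℝ] E →L[ℝ] ℝ) (t : E → TractorModel E) (z u : E) :
    TractorModel E :=
  (fderiv ℝ (fun y => (t y).1) z u - (t z).2.1 u,
    fderiv ℝ (fun y => (t y).2.1) z u - (t z).2.1 ∘L christoffel G z u + (t z).2.2 • G z u
      + (t z).1 • schouten G z u,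
    fderiv ℝ (fun y => (t y).2.2) z u - schouten G z u ((G z).inverse (t z).2.1))

theorem tractorDeriv_congr (G : E → E →L[ℝ] E →L[ℝ] ℝ) {t t' : E → TractorModel E} {z : E}
    (h : t =ᶠ[𝓝 z] t') (u : E) : tractorDeriv G t z u = tractorDeriv G t' z u := by
  have h1 : (fun y => (t y).1) =ᶠ[𝓝 z] fun y => (t' y).1 := h.fun_comp Prod.fst
  have h2 : (fun y => (t y).2.1) =ᶠ[𝓝 z] fun y => (t' y).2.1 := h.fun_comp fun t => t.2.1
  have h3 : (fun y => (t y).2.2) =ᶠ[𝓝 z] fun y => (t' y).2.2 := h.fun_comp fun t => t.2.2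
  rw [tractorDeriv, h1.fderiv_eq, h2.fderiv_eq, h3.fderiv_eq, h.eq_of_nhds]
  rfl

theorem tractorDeriv_add (G : E → E →L[ℝ] E →L[ℝ] ℝ) {t t' : E → TractorModel E} {z : E}
    (h : DifferentiableAt ℝ t z) (h' : DifferentiableAt ℝ t' z) (u : E) :
    tractorDeriv G (t + t') z u = tractorDeriv G t z u + tractorDeriv G t' z u := by
  have e1 : fderiv ℝ (fun y => ((t + t') y).1) z = _ := fderiv_add h.fst h'.fst
  have e2 : fderiv ℝ (fun y => ((t + t') y).2.1) z = _ := fderiv_add h.snd.fst h'.snd.fst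
  have e3 : fderiv ℝ (fun y => ((t + t') y).2.2) z = _ := fderiv_add h.snd.snd h'.snd.snd
  rw [tractorDeriv, e1, e2, e3]
  refine Prod.ext ?_ (Prod.ext ?_ ?_)
  · simp [tractorDeriv]; ring
  · ext w; simp [tractorDeriv]; ring
  · simp [tractorDeriv]; ring

theorem tractorDeriv_smul (G : E → E →L[ℝ] E →L[ℝ] ℝ) {f : E → ℝ} {t : E → TractorModel E}
    {z : E} (hf : DifferentiableAt ℝ f z) (h : DifferentiableAt ℝ t z) (u : E) :
    tractorDeriv G (fun y => f y • t y) z u =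
      f z • tractorDeriv G t z u + fderiv ℝ f z u • t z := by
  have e1 : fderiv ℝ (fun y => (f y • t y).1) z = _ := fderiv_smul hf h.fst
  have e2 : fderiv ℝ (fun y => (f y • t y).2.1) z = _ := fderiv_smul hf h.snd.fst
  have e3 : fderiv ℝ (fun y => (f y • t y).2.2) z = _ := fderiv_smul hf h.snd.snd
  rw [tractorDeriv, e1, e2, e3]
  refine Prod.ext ?_ (Prod.ext ?_ ?_)
  · simp [tractorDeriv]; ring
  · ext w; simp [tractorDeriv]; ring
  · simp [tractorDeriv]; ring

/-- Joint smoothness in the base point and the fibre variable is what makes the shift a smooth map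
of total spaces. -/
theorem IsMetricOn.contDiffOn_tractorShift {Ω : E → ℝ} {G : E → E →L[ℝ] E →L[ℝ] ℝ}
    {U : Set E} (hG : IsMetricOn G U) (hΩ : ContDiffOn ℝ ∞ (dlog Ω) U) :
    ContDiffOn ℝ ∞ (fun w : E × TractorModel E => tractorShift G Ω w.1 w.2) (U ×ˢ Set.univ) := by
  have hf : ContDiffOn ℝ ∞ (fun w : E × TractorModel E => w.1) (U ×ˢ Set.univ) :=
    contDiff_fst.contDiffOn
  have ht : ContDiffOn ℝ ∞ (fun w : E × TractorModel E => w.2) (U ×ˢ Set.univ) :=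
    contDiff_snd.contDiffOn
  have hm : Set.MapsTo (fun w : E × TractorModel E => w.1) (U ×ˢ Set.univ) U := fun _ hw => hw.1
  have hd := hΩ.comp hf hm
  have hN := (hG.contDiffOn_inverse.clm_apply hΩ).comp hf hm
  exact ht.fst.prodMk ((ht.snd.fst.add (ht.fst.smul hd)).prodMk
    ((ht.snd.snd.sub (ht.snd.fst.clm_apply hN)).sub
      (contDiffOn_const.mul (ht.fst.mul (hd.clm_apply hN)))))

theorem IsConformalOn.differentiableAt_tractorShift {Ω : E → ℝ}
    {G G' : E → E →L[ℝ] E →L[ℝ] ℝ} {U : Set E} {z : E} (h : IsConformalOn Ω G G' U) (hz : z ∈ U)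
    {t : E → TractorModel E} (ht : DifferentiableAt ℝ t z) :
    DifferentiableAt ℝ (fun y => tractorShift G Ω y (t y)) z := by
  have h1 := ((h.source.contDiffOn_tractorShift h.contDiffOn_dlog).contDiffAt (x := (z, t z))
    (prod_mem_nhds (h.source.mem_nhds hz) univ_mem)).differentiableAt (by simp)
  exact h1.comp z (differentiableAt_id.prodMk ht)

/-- The tractor connection in coordinates is conformally invariant. -/
theorem IsConformalOn.tractorDeriv_tractorShift {Ω : E → ℝ} {G G' : E → E →L[ℝ] E →L[ℝ] ℝ}
    {U : Set E} {z : E} (h : IsConformalOn Ω G G' U) (hn : 3 ≤ Module.finrank ℝ E) (hz : z ∈ U)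
    {t : E → TractorModel E} (ht : DifferentiableAt ℝ t z) (u : E) :
    tractorDeriv G' (fun y => scaleWeights (Ω y) (tractorShift G Ω y (t y))) z u =
      scaleWeights (Ω z) (tractorShift G Ω z (tractorDeriv G t z u)) := by
  refine Prod.ext ?_ (Prod.ext ?_ ?_)
  · exact h.fderiv_fst (m := fun y => (t y).2.1) hz ht.fst u
  · ext w
    refine (h.fderiv_snd hn hz ht.fst ht.snd.fst u w (r := fun y => (t y).2.2)).trans ?_
    rfl
  · refine (h.fderiv_trd hn hz ht.fst ht.snd.fst ht.snd.snd u).trans ?_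
    rfl

theorem IsMetricOn.contDiffOn_tractorDeriv {G : E → E →L[ℝ] E →L[ℝ] ℝ} {U : Set E}
    (hG : IsMetricOn G U) {t : E → TractorModel E} (ht : ContDiffOn ℝ ∞ t U) (u : E) :
    ContDiffOn ℝ ∞ (fun z => tractorDeriv G t z u) U := by
  have hs := ht.fst
  have hm := ht.snd.fst
  have hr := ht.snd.snd
  have hP := hG.contDiffOn_schouten.clm_apply (contDiffOn_const (c := u))
  have hds := (hs.fderiv_of_isOpen (m := ∞) hG.isOpen (by simp)).clm_apply
    (contDiffOn_const (c := u))
  have hdm := (hm.fderiv_of_isOpen (m := ∞) hG.isOpen (by simp)).clm_apply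
    (contDiffOn_const (c := u))
  have hdr := (hr.fderiv_of_isOpen (m := ∞) hG.isOpen (by simp)).clm_apply
    (contDiffOn_const (c := u))
  refine (hds.sub (hm.clm_apply contDiffOn_const)).prodMk (ContDiffOn.prodMk ?_ ?_)
  · exact ((hdm.sub (hm.clm_comp
      (hG.contDiffOn_christoffel.clm_apply contDiffOn_const))).add
      (hr.smul (hG.contDiffOn.clm_apply contDiffOn_const))).add (hs.smul hP)
  · exact hdr.sub (hP.clm_apply (hG.contDiffOn_inverse.clm_apply hm))

end LocalMetric

/-! ### Coordinates of tractors in a scale and a chart. -/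

noncomputable section TractorCoordinates

variable {E : Type*} [NormedAddCommGroup E] [NormedSpace ℝ E]
  {M : Type*} [TopologicalSpace M] [ChartedSpace E M] [IsManifold 𝓘(ℝ, E) ∞ M] {p q : ℕ}
  {c : ConformalStructure E M p q}

theorem Weighted.eval_pt_eq {w : ℝ} {V : M → Type*} [∀ x, AddCommGroup (V x)]
    [∀ x, Module ℝ (V x)] {g g' : c.Scale} {Ω : M → ℝ} (h : IsRescaling Ω g.1 g'.1) {x : M}
    (f : Weighted c w V x) :
    Weighted.eval (g'.pt x) f = Ω x ^ w • Weighted.eval (g.pt x) f :=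
  Weighted.eval_smul f (h.pos x) (h.eq x)

theorem Weighted.ext_of_eval_pt [Fact (3 ≤ Module.finrank ℝ E)] {w : ℝ} {V : M → Type*}
    [∀ x, AddCommGroup (V x)] [∀ x, Module ℝ (V x)] (g : c.Scale) {x : M}
    {f f' : Weighted c w V x} (h : Weighted.eval (g.pt x) f = Weighted.eval (g.pt x) f') :
    f = f' :=
  (Weighted.scaleEquiv w V g x).injective h

/-- The coordinates of a tractor at `y` in a scale and in the chart around `a`. -/
def tractorCoord (g : c.Scale) (a y : M) (V : SplitTractor c y) : TractorModel E :=
  (Weighted.eval (g.pt y) V.1, (Weighted.eval (g.pt y) V.2.1 : Cotangent E y) ∘L chartFrame E a y,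
    Weighted.eval (g.pt y) V.2.2)

variable [Fact (3 ≤ Module.finrank ℝ E)]

/-- The structure of the weighted bundles was carried over by evaluation at the reference scale, so
their trivializations evaluate there. Smoothness in the bundle is therefore smoothness of these
coordinates; other scales differ by `scaleWeights`. -/
theorem trivializationAt_splitTractor (a y : M) (V : SplitTractor c y) :
    (trivializationAt (TractorModel E) (SplitTractor c) a ⟨y, V⟩).2 =
      tractorCoord c.refScale a y V := by
  refine Prod.ext rfl (Prod.ext ?_ rfl)
  change (trivializationAt (E →L[ℝ] ℝ) (Cotangent E) a
    ⟨y, (Weighted.eval (c.refScale.pt y) V.2.1 : Cotangent E y)⟩).2 = _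
  rw [hom_trivializationAt_apply]
  ext v
  simp [ContinuousLinearMap.inCoordinates, tractorCoord]
  rfl

theorem baseSet_splitTractor (a : M) :
    (trivializationAt (TractorModel E) (SplitTractor c) a).baseSet =
      (extChartAt 𝓘(ℝ, E) a).source := by
  change Set.univ ∩ ((trivializationAt (E →L[ℝ] ℝ) (Cotangent E) a).baseSet ∩ Set.univ) = _
  rw [hom_trivializationAt_baseSet]
  simp

/-- A homogeneous function on a ray is determined by one value, and the frame is invertible over the
chart domain. Identities of tractors may thus be checked in coordinates. -/
theorem tractorCoord_injective (g : c.Scale) {a y : M}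
    (hy : y ∈ (extChartAt 𝓘(ℝ, E) a).source) :
    Function.Injective (tractorCoord (c := c) g a y) := by
  intro V V' h
  have h1 := congrArg Prod.fst h
  have h2 := congrArg (fun t => t.2.1) h
  have h3 := congrArg (fun t => t.2.2) h
  refine Prod.ext (Weighted.ext_of_eval_pt g h1)
    (Prod.ext (Weighted.ext_of_eval_pt g ?_) (Weighted.ext_of_eval_pt g h3))
  ext v
  have h4 := congrArg (fun L : E →L[ℝ] ℝ => L (chartCoframe E a y v)) h2
  simp only [tractorCoord, ContinuousLinearMap.comp_apply] at h4
  rwa [chartFrame_chartCoframe hy] at h4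

theorem tractorCoord_rescale {g g' : c.Scale} {Ω : M → ℝ} (h : IsRescaling Ω g.1 g'.1)
    (a y : M) (V : SplitTractor c y) :
    tractorCoord g' a y V = LocalMetric.scaleWeights (Ω y) (tractorCoord g a y V) := by
  simp only [tractorCoord, LocalMetric.scaleWeights, Weighted.eval_pt_eq h, Real.rpow_one,
    Real.rpow_neg_one]
  rfl

/-- The coordinates of a tractor field in a scale and in the chart around `a`. -/
def tractorInChart (g : c.Scale) (a : M) (V : ∀ y, SplitTractor c y) (z : E) : TractorModel E :=
  tractorCoord g a ((extChartAt 𝓘(ℝ, E) a).symm z) (V ((extChartAt 𝓘(ℝ, E) a).symm z))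

/-- A function on the manifold in the chart around `a`. -/
def functionInChart (E : Type*) [NormedAddCommGroup E] [NormedSpace ℝ E] {M : Type*}
    [TopologicalSpace M] [ChartedSpace E M] (a : M) (f : M → ℝ) (z : E) : ℝ :=
  f ((extChartAt 𝓘(ℝ, E) a).symm z)

theorem contDiffOn_functionInChart (a : M) {f : M → ℝ} (hf : ContMDiff 𝓘(ℝ, E) 𝓘(ℝ) ∞ f) :
    ContDiffOn ℝ ∞ (functionInChart E a f) (extChartAt 𝓘(ℝ, E) a).target :=
  (hf.comp_contMDiffOn (contMDiffOn_extChartAt_symm a)).contDiffOn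

theorem tractorInChart_rescale {g g' : c.Scale} {Ω : M → ℝ} (h : IsRescaling Ω g.1 g'.1)
    (a : M) (V : ∀ y, SplitTractor c y) :
    tractorInChart g' a V = fun z =>
      LocalMetric.scaleWeights (functionInChart E a Ω z) (tractorInChart g a V z) :=
  funext fun _ => tractorCoord_rescale h a _ _

theorem contDiffOn_tractorInChart (g : c.Scale) (a : M) {V : ∀ y, SplitTractor c y}
    (hV : ContMDiff 𝓘(ℝ, E) (𝓘(ℝ, E).prod 𝓘(ℝ, TractorModel E)) ∞
      (fun y => TotalSpace.mk' (TractorModel E) y (V y))) :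
    ContDiffOn ℝ ∞ (tractorInChart g a V) (extChartAt 𝓘(ℝ, E) a).target := by
  have h1 := (trivializationAt (TractorModel E) (SplitTractor c) a).contMDiffOn_section_baseSet_iff
    (IB := 𝓘(ℝ, E)) (n := ∞) |>.1 hV.contMDiffOn
  rw [baseSet_splitTractor] at h1
  simp only [trivializationAt_splitTractor] at h1
  have h2 : ContDiffOn ℝ ∞ (tractorInChart c.refScale a V) (extChartAt 𝓘(ℝ, E) a).target :=
    (h1.comp (contMDiffOn_extChartAt_symm a)
      fun z hz => (extChartAt 𝓘(ℝ, E) a).map_target hz).contDiffOn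
  obtain ⟨Ω, hΩ⟩ := c.exists_rescaling c.refScale g
  rw [tractorInChart_rescale hΩ]
  exact LocalMetric.contDiffOn_scaleWeights (contDiffOn_functionInChart a hΩ.smooth)
    (fun z _ => (hΩ.pos _).ne') h2

theorem differentiableAt_tractorInChart (g : c.Scale) {a x : M}
    (hx : x ∈ (extChartAt 𝓘(ℝ, E) a).source) {V : ∀ y, SplitTractor c y}
    (hV : MDifferentiableAt 𝓘(ℝ, E) (𝓘(ℝ, E).prod 𝓘(ℝ, TractorModel E))
      (fun y => TotalSpace.mk' (TractorModel E) y (V y)) x) :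
    DifferentiableAt ℝ (tractorInChart g a V) (extChartAt 𝓘(ℝ, E) a x) := by
  have h1 := ((trivializationAt (TractorModel E) (SplitTractor c) a).mdifferentiableAt_section_iff
    𝓘(ℝ, E) V (by rwa [baseSet_splitTractor])).1 hV
  simp only [trivializationAt_splitTractor] at h1
  have h2 : DifferentiableAt ℝ (tractorInChart c.refScale a V) (extChartAt 𝓘(ℝ, E) a x) :=
    (mdifferentiableAt_iff_comp_extChartAt_symm hx).1 h1
  obtain ⟨Ω, hΩ⟩ := c.exists_rescaling c.refScale g
  rw [tractorInChart_rescale hΩ]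
  exact LocalMetric.differentiableAt_scaleWeights
    (((contDiffOn_functionInChart a hΩ.smooth).contDiffAt ((isOpen_extChartAt_target a).mem_nhds
      ((extChartAt 𝓘(ℝ, E) a).map_source hx))).differentiableAt (by simp))
    (hΩ.pos _).ne' h2

theorem isConformalOn_inChart [FiniteDimensional ℝ E] {g g' : PseudoRiemannianMetric E M p q}
    {Ω : M → ℝ} (h : IsRescaling Ω g g') (a : M) :
    LocalMetric.IsConformalOn (functionInChart E a Ω) (g.inChart a) (g'.inChart a)
      (extChartAt 𝓘(ℝ, E) a).target where
  source := g.isMetricOn_inChart a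
  target := g'.isMetricOn_inChart a
  contDiffOn := contDiffOn_functionInChart a h.smooth
  pos z _ := h.pos _
  eq z _ := by
    ext u v
    rw [PseudoRiemannianMetric.inChart_apply, h.eq]
    rfl

theorem upsilon_chartFrame {g g' : PseudoRiemannianMetric E M p q} {Ω : M → ℝ}
    (h : IsRescaling Ω g g') {a x : M} (hx : x ∈ (extChartAt 𝓘(ℝ, E) a).source) :
    upsilon E Ω x ∘L chartFrame E a x =
      LocalMetric.dlog (functionInChart E a Ω) (extChartAt 𝓘(ℝ, E) a x) := by
  ext u
  change (Ω x)⁻¹ • mvfderiv 𝓘(ℝ, E) Ω x (chartFrame E a x u) = _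
  rw [mvfderiv_eq_fderiv_comp_extChartAt_symm hx (h.mdifferentiableAt x),
    chartCoframe_chartFrame hx, LocalMetric.dlog, functionInChart,
    (extChartAt 𝓘(ℝ, E) a).left_inv hx]
  rfl

theorem covector_inverse [FiniteDimensional ℝ E] (g : PseudoRiemannianMetric E M p q) {a x : M}
    (hx : x ∈ (extChartAt 𝓘(ℝ, E) a).source) (α β : Cotangent E x) :
    α ((g.val x).inverse β) = (α ∘L chartFrame E a x)
      ((g.inChart a (extChartAt 𝓘(ℝ, E) a x)).inverse (β ∘L chartFrame E a x)) := by
  rw [← g.chartCoframe_inverse hx, ContinuousLinearMap.comp_apply, chartFrame_chartCoframe hx]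

/-- The scale `g` used for coordinates is independent of the pair `g₁`, `g₂` that defines `Υ`: the
shift raises indices with the conformal metric, whose value at the point `g` of the ray is `g`
itself. The reference scale can therefore be used for every `Ω`. -/
theorem tractorCoord_tractorShift [FiniteDimensional ℝ E] (g : c.Scale)
    {g₁ g₂ : PseudoRiemannianMetric E M p q} {Ω : M → ℝ} (h : IsRescaling Ω g₁ g₂) {a x : M}
    (hx : x ∈ (extChartAt 𝓘(ℝ, E) a).source) (V : SplitTractor c x) :
    tractorCoord g a x (tractorShift c (upsilon E Ω x) V) =
      LocalMetric.tractorShift (g.1.inChart a) (functionInChart E a Ω)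
        (extChartAt 𝓘(ℝ, E) a x) (tractorCoord g a x V) := by
  have hu := upsilon_chartFrame h hx
  have hG := g.1.isMetricOn_inChart a
  have hz := (extChartAt 𝓘(ℝ, E) a).map_source hx
  refine Prod.ext rfl (Prod.ext ?_ ?_)
  · ext u
    rw [LocalMetric.tractorShift, ← hu]
    rfl
  · have e1 : upsilon E Ω x ((g.1.val x).inverse (Weighted.eval (g.pt x) V.2.1)) =
        (tractorCoord g a x V).2.1 (LocalMetric.gradLog (g.1.inChart a) (functionInChart E a Ω)
          (extChartAt 𝓘(ℝ, E) a x)) := by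
      rw [covector_inverse g.1 hx, hu, hG.apply_inverse_comm hz]
      rfl
    have e2 : upsilon E Ω x ((g.1.val x).inverse
        (Weighted.eval (g.pt x) (mulCovector (upsilon E Ω x) V.1))) =
        (tractorCoord g a x V).1 * LocalMetric.dlog (functionInChart E a Ω)
          (extChartAt 𝓘(ℝ, E) a x) (LocalMetric.gradLog (g.1.inChart a) (functionInChart E a Ω)
          (extChartAt 𝓘(ℝ, E) a x)) := by
      have : Weighted.eval (g.pt x) (mulCovector (upsilon E Ω x) V.1) =
        (tractorCoord g a x V).1 • upsilon E Ω x := rfl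
      rw [this, map_smul, map_smul, covector_inverse g.1 hx, hu]
      rfl
    rw [LocalMetric.tractorShift, ← e1, ← e2]
    rfl

variable [FiniteDimensional ℝ E]

/-- The tractor connection of a scale in the chart around `a`. -/
theorem tractorCoord_tractorDeriv (g : c.Scale) {a x : M}
    (hx : x ∈ (extChartAt 𝓘(ℝ, E) a).source) {V : ∀ y, SplitTractor c y}
    (hV : DifferentiableAt ℝ (tractorInChart g a V) (extChartAt 𝓘(ℝ, E) a x))
    (v : TangentSpace 𝓘(ℝ, E) x) :
    tractorCoord g a x (tractorDeriv g V x v) =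
      LocalMetric.tractorDeriv (g.1.inChart a) (tractorInChart g a V)
        (extChartAt 𝓘(ℝ, E) a x) (chartCoframe E a x v) := by
  have hinv := (extChartAt 𝓘(ℝ, E) a).left_inv hx
  have ht : tractorInChart g a V (extChartAt 𝓘(ℝ, E) a x) = tractorCoord g a x (V x) := by
    rw [tractorInChart, hinv]
  -- In the scale `g` a density of any weight is a function, and its covariant derivative is the
  -- ordinary one; this serves the first and the third slot.
  have hden : ∀ {w : ℝ} (τ : ∀ y, Weighted c w (Bundle.Trivial M ℝ) y),
      DifferentiableAt ℝ (fun z => (Weighted.eval (g.pt ((extChartAt 𝓘(ℝ, E) a).symm z))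
        (τ ((extChartAt 𝓘(ℝ, E) a).symm z)) : ℝ)) (extChartAt 𝓘(ℝ, E) a x) →
      Weighted.eval (g.pt x) (densityDeriv g τ x v) =
        fderiv ℝ (fun z => (Weighted.eval (g.pt ((extChartAt 𝓘(ℝ, E) a).symm z))
        (τ ((extChartAt 𝓘(ℝ, E) a).symm z)) : ℝ)) (extChartAt 𝓘(ℝ, E) a x)
        (chartCoframe E a x v) := fun {w} τ hτ => by
    have h1 := mvfderiv_eq_fderiv_comp_extChartAt_symm hx
      (f := fun y => (Weighted.eval (g.pt y) (τ y) : ℝ))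
      ((mdifferentiableAt_iff_comp_extChartAt_symm hx).2 hτ) v
    rw [densityDeriv, Weighted.eval_scaleEquiv_symm]
    exact h1
  refine Prod.ext ?_ (Prod.ext ?_ ?_)
  · rw [LocalMetric.tractorDeriv, ht]
    change Weighted.eval (g.pt x) (densityDeriv g (fun y => (V y).1) x v)
      - Weighted.eval (g.pt x) (V x).2.1 v = _
    rw [hden (fun y => (V y).1) hV.fst]
    change _ = _ - Weighted.eval (g.pt x) (V x).2.1 (chartFrame E a x (chartCoframe E a x v))
    rw [chartFrame_chartCoframe hx]
    rfl
  · ext u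
    rw [LocalMetric.tractorDeriv, ht]
    change Weighted.eval (g.pt x) (covectorDeriv g (fun y => (V y).2.1) x v) (chartFrame E a x u)
      + (Weighted.eval (g.pt x) (V x).2.2 : ℝ) * g.1.val x v (chartFrame E a x u)
      + (Weighted.eval (g.pt x) (V x).1 : ℝ) * g.1.schouten x v (chartFrame E a x u) = _
    rw [covectorDeriv, Weighted.eval_scaleEquiv_symm,
      g.1.leviCivita_apply (fun y => Weighted.scaleEquiv 1 (Cotangent E) g y (V y).2.1) hx
        hV.snd.fst,
      g.1.val_apply hx, g.1.schouten_apply hx, chartCoframe_chartFrame hx]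
    rw [formInChart, hinv]
    rfl
  · rw [LocalMetric.tractorDeriv, ht]
    change Weighted.eval (g.pt x) (densityDeriv g (fun y => (V y).2.2) x v)
      - g.1.schouten x v ((g.1.val x).inverse (Weighted.eval (g.pt x) (V x).2.1)) = _
    rw [hden (fun y => (V y).2.2) hV.snd.snd, g.1.schouten_apply hx, g.1.chartCoframe_inverse hx]
    rfl

/-- The tractor connection is conformally invariant. -/
theorem tractorDeriv_tractorShift {g g' : c.Scale} {Ω : M → ℝ} (h : IsRescaling Ω g.1 g'.1)
    {V : ∀ y, SplitTractor c y} {x : M}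
    (hV : MDifferentiableAt 𝓘(ℝ, E) (𝓘(ℝ, E).prod 𝓘(ℝ, TractorModel E))
      (fun y => TotalSpace.mk' (TractorModel E) y (V y)) x) (v : TangentSpace 𝓘(ℝ, E) x) :
    tractorDeriv g' (fun y => tractorShift c (upsilon E Ω y) (V y)) x v =
      tractorShift c (upsilon E Ω x) (tractorDeriv g V x v) := by
  have hx := mem_extChartAt_source (I := 𝓘(ℝ, E)) x
  have hz := (extChartAt 𝓘(ℝ, E) x).map_source hx
  have hc := isConformalOn_inChart h x
  have ht := differentiableAt_tractorInChart g hx hV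
  have hn : 3 ≤ Module.finrank ℝ E := Fact.out
  -- The coordinate form of the shift is valid only over the chart target, hence equality near the
  -- point, which is enough for derivatives.
  have hW : tractorInChart g' x (fun y => tractorShift c (upsilon E Ω y) (V y))
      =ᶠ[𝓝 (extChartAt 𝓘(ℝ, E) x x)] fun y =>
        LocalMetric.scaleWeights (functionInChart E x Ω y) (LocalMetric.tractorShift
          (g.1.inChart x) (functionInChart E x Ω) y (tractorInChart g x V y)) := by
    filter_upwards [hc.source.mem_nhds hz] with y hy
    have hy' := tractorCoord_tractorShift g h ((extChartAt 𝓘(ℝ, E) x).map_target hy)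
      (V ((extChartAt 𝓘(ℝ, E) x).symm y))
    rw [(extChartAt 𝓘(ℝ, E) x).right_inv hy] at hy'
    rw [tractorInChart_rescale h]
    exact congrArg (LocalMetric.scaleWeights _) hy'
  have htW := (LocalMetric.differentiableAt_scaleWeights (hc.differentiableAt hz)
    (hc.pos _ hz).ne' (hc.differentiableAt_tractorShift hz ht)).congr_of_eventuallyEq hW
  refine tractorCoord_injective g' hx ?_
  rw [tractorCoord_tractorDeriv g' hx htW, LocalMetric.tractorDeriv_congr _ hW,
    hc.tractorDeriv_tractorShift hn hz ht, ← tractorCoord_tractorDeriv g hx ht,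
    ← tractorCoord_tractorShift g h hx, functionInChart, (extChartAt 𝓘(ℝ, E) x).left_inv hx,
    ← tractorCoord_rescale h]

end TractorCoordinates

/-! ### Smoothness of the identifications, and linearity in the direction. -/

noncomputable section TractorConnection

variable {E : Type*} [NormedAddCommGroup E] [NormedSpace ℝ E]
  {M : Type*} [TopologicalSpace M] [ChartedSpace E M] [IsManifold 𝓘(ℝ, E) ∞ M] {p q : ℕ}
  {c : ConformalStructure E M p q} [Fact (3 ≤ Module.finrank ℝ E)] [FiniteDimensional ℝ E]

theorem contMDiff_tractorShift {g g' : PseudoRiemannianMetric E M p q} {Ω : M → ℝ}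
    (h : IsRescaling Ω g g') :
    ContMDiff (𝓘(ℝ, E).prod 𝓘(ℝ, TractorModel E)) (𝓘(ℝ, E).prod 𝓘(ℝ, TractorModel E)) ∞
      (fun z : TotalSpace (TractorModel E) (SplitTractor c) =>
        TotalSpace.mk' (TractorModel E) z.1 (tractorShift c (upsilon E Ω z.1) z.2)) := by
  intro z₀
  have hx := mem_extChartAt_source (I := 𝓘(ℝ, E)) z₀.1
  have hz := (extChartAt 𝓘(ℝ, E) z₀.1).map_source hx
  have hid := contMDiffAt_totalSpace.1
    (contMDiffAt_id (I := 𝓘(ℝ, E).prod 𝓘(ℝ, TractorModel E)) (n := ∞) (x := z₀))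
  refine contMDiffAt_totalSpace.2 ⟨hid.1, ?_⟩
  -- The trivializations evaluate at the reference scale, so its coordinate metric must be used
  -- here, whatever `g` is.
  have hG := c.refScale.1.isMetricOn_inChart z₀.1
  have hS := hG.contDiffOn_tractorShift (isConformalOn_inChart h z₀.1).contDiffOn_dlog
  have h1 : ContMDiffAt (𝓘(ℝ, E).prod 𝓘(ℝ, TractorModel E)) 𝓘(ℝ, E × TractorModel E) ∞
      (fun z : TotalSpace (TractorModel E) (SplitTractor c) => (extChartAt 𝓘(ℝ, E) z₀.1 z.1,
        (trivializationAt (TractorModel E) (SplitTractor c) z₀.1 z).2)) z₀ :=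
    ContMDiffAt.prodMk_space (contMDiffAt_extChartAt.comp z₀ hid.1) hid.2
  have h2 := (hS.contDiffAt (x := (extChartAt 𝓘(ℝ, E) z₀.1 z₀.1,
    (trivializationAt (TractorModel E) (SplitTractor c) z₀.1 z₀).2))
    (prod_mem_nhds (hG.mem_nhds hz) univ_mem)).contMDiffAt.comp z₀ h1
  refine h2.congr_of_eventuallyEq ?_
  filter_upwards [hid.1.continuousAt.preimage_mem_nhds
    ((isOpen_extChartAt_source z₀.1).mem_nhds hx)] with z hzs
  have hzs' : z.proj ∈ (extChartAt 𝓘(ℝ, E) z₀.1).source := hzs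
  refine (trivializationAt_splitTractor z₀.1 z.1 _).trans ?_
  rw [tractorCoord_tractorShift _ h hzs', ← trivializationAt_splitTractor]
  rfl

/-- By construction of the bundle structure of `𝒯`, this map is the identity in the trivializations.
-/
theorem contMDiff_ofScale_refScale_symm :
    ContMDiff (𝓘(ℝ, E).prod 𝓘(ℝ, TractorModel E)) (𝓘(ℝ, E).prod 𝓘(ℝ, TractorModel E)) ∞
      (fun z : TotalSpace (TractorModel E) (Tractor c) =>
        TotalSpace.mk' (TractorModel E) z.1 ((Tractor.ofScale c.refScale z.1).symm z.2)) :=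
  fun z₀ =>
    have h := contMDiffAt_totalSpace.1
      (contMDiffAt_id (I := 𝓘(ℝ, E).prod 𝓘(ℝ, TractorModel E)) (n := ∞) (x := z₀))
    contMDiffAt_totalSpace.2 ⟨h.1, h.2⟩

theorem contMDiff_ofScale_refScale :
    ContMDiff (𝓘(ℝ, E).prod 𝓘(ℝ, TractorModel E)) (𝓘(ℝ, E).prod 𝓘(ℝ, TractorModel E)) ∞
      (fun z : TotalSpace (TractorModel E) (SplitTractor c) =>
        TotalSpace.mk' (TractorModel E) z.1 (Tractor.ofScale c.refScale z.1 z.2)) := by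
  intro z₀
  have h := contMDiffAt_totalSpace.1
    (contMDiffAt_id (I := 𝓘(ℝ, E).prod 𝓘(ℝ, TractorModel E)) (n := ∞) (x := z₀))
  refine contMDiffAt_totalSpace.2 ⟨h.1, ?_⟩
  convert h.2 using 2 with z
  change (trivializationAt (TractorModel E) (SplitTractor c) z₀.1 ⟨z.1,
    (Tractor.ofScale c.refScale z.1).symm (Tractor.ofScale c.refScale z.1 z.2)⟩).2 = _
  rw [LinearEquiv.symm_apply_apply]
  rfl

theorem ofScale_eq_tractorShift {g g' : c.Scale} {Ω : M → ℝ} (h : IsRescaling Ω g.1 g'.1) (x : M)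
    (V : SplitTractor c x) :
    Tractor.ofScale g x V = Tractor.ofScale g' x (tractorShift c (upsilon E Ω x) V) :=
  Tractor.ofScaleFun_eq h x V

theorem ofScale_symm_eq_tractorShift {g g' : c.Scale} {Ω : M → ℝ} (h : IsRescaling Ω g'.1 g.1)
    (x : M) (t : Tractor c x) : (Tractor.ofScale g x).symm t =
      tractorShift c (upsilon E Ω x) ((Tractor.ofScale g' x).symm t) := by
  rw [LinearEquiv.symm_apply_eq, ← ofScale_eq_tractorShift h, LinearEquiv.apply_symm_apply]

/-- A scale identifies the split tractor bundle with the tractor bundle smoothly. -/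
theorem contMDiff_ofScale (g : c.Scale) :
    ContMDiff (𝓘(ℝ, E).prod 𝓘(ℝ, TractorModel E)) (𝓘(ℝ, E).prod 𝓘(ℝ, TractorModel E)) ∞
      (fun z : TotalSpace (TractorModel E) (SplitTractor c) =>
        TotalSpace.mk' (TractorModel E) z.1 (Tractor.ofScale g z.1 z.2)) := by
  obtain ⟨Ω, h⟩ := c.exists_rescaling g c.refScale
  simp only [ofScale_eq_tractorShift h]
  exact contMDiff_ofScale_refScale.comp (contMDiff_tractorShift h)

theorem contMDiff_ofScale_symm (g : c.Scale) :
    ContMDiff (𝓘(ℝ, E).prod 𝓘(ℝ, TractorModel E)) (𝓘(ℝ, E).prod 𝓘(ℝ, TractorModel E)) ∞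
      (fun z : TotalSpace (TractorModel E) (Tractor c) =>
        TotalSpace.mk' (TractorModel E) z.1 ((Tractor.ofScale g z.1).symm z.2)) := by
  obtain ⟨Ω, h⟩ := c.exists_rescaling c.refScale g
  simp only [ofScale_symm_eq_tractorShift h]
  exact (contMDiff_tractorShift h).comp contMDiff_ofScale_refScale_symm

theorem leviCivita_add_apply (g : PseudoRiemannianMetric E M p q) (μ : ∀ y : M, Cotangent E y)
    (x : M) (u v : TangentSpace 𝓘(ℝ, E) x) :
    g.leviCivita μ x (u + v) = g.leviCivita μ x u + g.leviCivita μ x v := by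
  ext w
  simp only [PseudoRiemannianMetric.leviCivita, map_add, ContinuousLinearMap.comp_add,
    ContinuousLinearMap.add_comp, ContinuousLinearMap.sub_comp, add_apply, sub_apply]
  ring

theorem leviCivita_smul_apply (g : PseudoRiemannianMetric E M p q) (μ : ∀ y : M, Cotangent E y)
    (x : M) (k : ℝ) (v : TangentSpace 𝓘(ℝ, E) x) :
    g.leviCivita μ x (k • v) = k • g.leviCivita μ x v := by
  ext w
  simp only [PseudoRiemannianMetric.leviCivita, map_smul, ContinuousLinearMap.comp_smul,
    ContinuousLinearMap.smul_comp, ContinuousLinearMap.sub_comp, smul_apply, sub_apply, smul_sub]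

theorem tractorDeriv_add_apply (g : c.Scale) (V : ∀ y, SplitTractor c y) (x : M)
    (u v : TangentSpace 𝓘(ℝ, E) x) :
    tractorDeriv g V x (u + v) = tractorDeriv g V x u + tractorDeriv g V x v := by
  have h1 : ∀ μ : Weighted c 1 (Cotangent E) x,
      contractVector (u + v) μ = contractVector u μ + contractVector v μ := fun μ => by
    ext a; simp [contractVector]
  have h2 : ∀ ρ : Weighted c (-1) (Bundle.Trivial M ℝ) x,
      Weighted.lower (u + v) ρ = Weighted.lower u ρ + Weighted.lower v ρ := fun ρ => by
    ext a; simp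
  simp only [tractorDeriv, densityDeriv, covectorDeriv, leviCivita_add_apply, map_add, h1, h2,
    mulCovector_add, contractCovector_add]
  refine Prod.ext ?_ (Prod.ext ?_ ?_) <;> simp only [Prod.fst_add, Prod.snd_add] <;> abel

theorem tractorDeriv_smul_apply (g : c.Scale) (V : ∀ y, SplitTractor c y) (x : M) (k : ℝ)
    (v : TangentSpace 𝓘(ℝ, E) x) :
    tractorDeriv g V x (k • v) = k • tractorDeriv g V x v := by
  have h1 : ∀ μ : Weighted c 1 (Cotangent E) x,
      contractVector (k • v) μ = k • contractVector v μ := fun μ => by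
    ext a; simp [contractVector]
  have h2 : ∀ ρ : Weighted c (-1) (Bundle.Trivial M ℝ) x,
      Weighted.lower (k • v) ρ = k • Weighted.lower v ρ := fun ρ => by
    ext a; simp [mul_left_comm]
  have h3 : ∀ (Υ : Cotangent E x) (σ : Weighted c 1 (Bundle.Trivial M ℝ) x),
      mulCovector (k • Υ) σ = k • mulCovector Υ σ := fun Υ σ => by
    ext a; simp [mulCovector, mul_left_comm]
  have h4 : ∀ (Υ : Cotangent E x) (μ : Weighted c 1 (Cotangent E) x),
      contractCovector (k • Υ) μ = k • contractCovector Υ μ := fun Υ μ => by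
    ext a; simp [contractCovector]
  have h5 : g.1.schouten x (k • v) = k • g.1.schouten x v := map_smul _ _ _
  simp only [tractorDeriv, densityDeriv, covectorDeriv, leviCivita_smul_apply, h1, h2, h5, h3, h4]
  refine Prod.ext ?_ (Prod.ext ?_ ?_)
  · simp only [Prod.smul_fst, map_smul, smul_sub]
  · simp only [Prod.smul_fst, Prod.smul_snd, map_smul, smul_add]
  · simp only [Prod.smul_snd, map_smul, smul_sub]

/-- The tractor connection of a scale, as a linear map of the direction. -/
def tractorDerivL (g : c.Scale) (V : ∀ y, SplitTractor c y) (x : M) :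
    TangentSpace 𝓘(ℝ, E) x →L[ℝ] SplitTractor c x :=
  haveI : FiniteDimensional ℝ (TangentSpace 𝓘(ℝ, E) x) := inferInstanceAs (FiniteDimensional ℝ E)
  haveI : T2Space (TangentSpace 𝓘(ℝ, E) x) := inferInstanceAs (T2Space E)
  LinearMap.toContinuousLinearMap
    { toFun := tractorDeriv g V x
      map_add' := tractorDeriv_add_apply g V x
      map_smul' := tractorDeriv_smul_apply g V x }

theorem tractorDerivL_apply (g : c.Scale) (V : ∀ y, SplitTractor c y) (x : M)
    (v : TangentSpace 𝓘(ℝ, E) x) : tractorDerivL g V x v = tractorDeriv g V x v := rfl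

end TractorConnection

/-! ### The connections on `[𝒯]_g` and on `𝒯`. -/

noncomputable section TractorCovariantDerivative

variable {E : Type*} [NormedAddCommGroup E] [NormedSpace ℝ E]
  {M : Type*} [TopologicalSpace M] [ChartedSpace E M] [IsManifold 𝓘(ℝ, E) ∞ M] {p q : ℕ}
  {c : ConformalStructure E M p q} [FiniteDimensional ℝ E]

theorem contMDiffAt_clm_of_apply {F : Type*} [NormedAddCommGroup F] [NormedSpace ℝ F]
    {f : M → E →L[ℝ] F} {x : M} (h : ∀ u, ContMDiffAt 𝓘(ℝ, E) 𝓘(ℝ, F) ∞ (fun y => f y u) x) :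
    ContMDiffAt 𝓘(ℝ, E) 𝓘(ℝ, E →L[ℝ] F) ∞ f x := by
  let b := Module.finBasis ℝ E
  have hf : f = fun y => ∑ i, ContinuousLinearMap.smulRightL ℝ E F
      (LinearMap.toContinuousLinearMap (b.coord i)) (f y (b i)) := by
    ext y u
    conv_lhs => rw [← b.sum_repr u, map_sum]
    simp
  rw [hf]
  exact ContMDiffAt.sum fun i _ => (ContinuousLinearMap.smulRightL ℝ E F
    (LinearMap.toContinuousLinearMap (b.coord i))).contMDiff.contMDiffAt.comp x (h (b i))

/-- A section of the bundle of homomorphisms from the tangent bundle to `B` is smooth when its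
values on the coordinate fields with constant components `u` are; a basis of `E` reduces operators
to such values. -/
theorem contMDiffCovariantDerivative_of_chartFrame {F : Type*} [NormedAddCommGroup F]
    [NormedSpace ℝ F] {B : M → Type*} [TopologicalSpace (TotalSpace F B)]
    [∀ x, AddCommGroup (B x)] [∀ x, Module ℝ (B x)] [∀ x, TopologicalSpace (B x)]
    [∀ x, IsTopologicalAddGroup (B x)] [∀ x, ContinuousSMul ℝ (B x)] [FiberBundle F B]
    [VectorBundle ℝ F B] (D : CovariantDerivative 𝓘(ℝ, E) F B)
    (h : ∀ W : ∀ y, B y, ContMDiff 𝓘(ℝ, E) (𝓘(ℝ, E).prod 𝓘(ℝ, F)) ∞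
      (fun y => TotalSpace.mk' F y (W y)) → ∀ x u, ContMDiffAt 𝓘(ℝ, E) 𝓘(ℝ, F) ∞
      (fun y => (trivializationAt F B x ⟨y, D W y (chartFrame E x y u)⟩).2) x) :
    CovariantDerivative.ContMDiffCovariantDerivative D ∞ := by
  refine ⟨⟨fun {W} hW x _ => ContMDiffAt.contMDiffWithinAt ?_⟩⟩
  refine (contMDiffAt_hom_bundle _).2 ⟨contMDiffAt_id, contMDiffAt_clm_of_apply fun u => ?_⟩
  refine (h W (contMDiffOn_univ.1 hW) x u).congr_of_eventuallyEq ?_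
  filter_upwards [(trivializationAt F B x).open_baseSet.mem_nhds
    (FiberBundle.mem_baseSet_trivializationAt F B x)] with y hy
  simp only [ContinuousLinearMap.inCoordinates, ContinuousLinearMap.comp_apply]
  rw [Trivialization.continuousLinearMapAt_apply, Trivialization.linearMapAt_apply, if_pos hy]
  rfl

variable [Fact (3 ≤ Module.finrank ℝ E)]

theorem contMDiffAt_trivializationAt_tractorDerivL (g : c.Scale) {V : ∀ y, SplitTractor c y}
    (hV : ContMDiff 𝓘(ℝ, E) (𝓘(ℝ, E).prod 𝓘(ℝ, TractorModel E)) ∞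
      (fun y => TotalSpace.mk' (TractorModel E) y (V y))) (x : M) (u : E) :
    ContMDiffAt 𝓘(ℝ, E) 𝓘(ℝ, TractorModel E) ∞ (fun y =>
      (trivializationAt (TractorModel E) (SplitTractor c) x
        ⟨y, tractorDerivL g V y (chartFrame E x y u)⟩).2) x := by
  have hx := mem_extChartAt_source (I := 𝓘(ℝ, E)) x
  have hz := (extChartAt 𝓘(ℝ, E) x).map_source hx
  have hG := g.1.isMetricOn_inChart x
  have ht := contDiffOn_tractorInChart g x hV
  -- The connection is computed in the scale `g` while the trivialization reads the reference scale;
  -- the factor `Ω` converts between them.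
  obtain ⟨Ω, h⟩ := c.exists_rescaling g c.refScale
  have h1 := LocalMetric.contDiffOn_scaleWeights (contDiffOn_functionInChart x h.smooth)
    (fun z _ => (h.pos _).ne') (hG.contDiffOn_tractorDeriv ht u)
  have h2 := (h1.contDiffAt (hG.mem_nhds hz)).contMDiffAt.comp x
    (contMDiffAt_extChartAt (I := 𝓘(ℝ, E)) (n := ∞))
  refine h2.congr_of_eventuallyEq ?_
  filter_upwards [(isOpen_extChartAt_source (I := 𝓘(ℝ, E)) x).mem_nhds hx] with y hy
  have hd := (ht.contDiffAt (hG.mem_nhds ((extChartAt 𝓘(ℝ, E) x).map_source hy))).differentiableAt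
    (by simp)
  refine (trivializationAt_splitTractor x y _).trans ?_
  rw [tractorDerivL_apply, tractorCoord_rescale h, tractorCoord_tractorDeriv g hy hd,
    chartCoframe_chartFrame hy]
  simp only [Function.comp_apply, functionInChart, (extChartAt 𝓘(ℝ, E) x).left_inv hy]

theorem tractorCoord_add (g : c.Scale) (a y : M) (V W : SplitTractor c y) :
    tractorCoord g a y (V + W) = tractorCoord g a y V + tractorCoord g a y W :=
  Prod.ext rfl (Prod.ext rfl rfl)

theorem tractorCoord_smul (g : c.Scale) (a y : M) (k : ℝ) (V : SplitTractor c y) :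
    tractorCoord g a y (k • V) = k • tractorCoord g a y V :=
  Prod.ext rfl (Prod.ext rfl rfl)

theorem tractorDerivL_add (g : c.Scale) {V W : ∀ y, SplitTractor c y} {x : M}
    (hV : MDifferentiableAt 𝓘(ℝ, E) (𝓘(ℝ, E).prod 𝓘(ℝ, TractorModel E))
      (fun y => TotalSpace.mk' (TractorModel E) y (V y)) x)
    (hW : MDifferentiableAt 𝓘(ℝ, E) (𝓘(ℝ, E).prod 𝓘(ℝ, TractorModel E))
      (fun y => TotalSpace.mk' (TractorModel E) y (W y)) x) :
    tractorDerivL g (V + W) x = tractorDerivL g V x + tractorDerivL g W x := by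
  have hx := mem_extChartAt_source (I := 𝓘(ℝ, E)) x
  have h1 := differentiableAt_tractorInChart g hx hV
  have h2 := differentiableAt_tractorInChart g hx hW
  ext1 v
  apply tractorCoord_injective g hx
  have hVW : tractorInChart g x (V + W) = tractorInChart g x V + tractorInChart g x W :=
    funext fun z => tractorCoord_add _ _ _ _ _
  rw [add_apply, tractorCoord_add]
  simp only [tractorDerivL_apply]
  rw [tractorCoord_tractorDeriv g hx (hVW ▸ h1.add h2), tractorCoord_tractorDeriv g hx h1,
    tractorCoord_tractorDeriv g hx h2, hVW, LocalMetric.tractorDeriv_add _ h1 h2]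

theorem tractorDerivL_leibniz (g : c.Scale) {V : ∀ y, SplitTractor c y} {f : M → ℝ} {x : M}
    (hV : MDifferentiableAt 𝓘(ℝ, E) (𝓘(ℝ, E).prod 𝓘(ℝ, TractorModel E))
      (fun y => TotalSpace.mk' (TractorModel E) y (V y)) x)
    (hf : MDifferentiableAt 𝓘(ℝ, E) 𝓘(ℝ) f x) :
    tractorDerivL g (f • V) x =
      f x • tractorDerivL g V x + (mvfderiv 𝓘(ℝ, E) f x).smulRight (V x) := by
  have hx := mem_extChartAt_source (I := 𝓘(ℝ, E)) x
  have h1 := differentiableAt_tractorInChart g hx hV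
  have h2 : DifferentiableAt ℝ (functionInChart E x f) (extChartAt 𝓘(ℝ, E) x x) :=
    (mdifferentiableAt_iff_comp_extChartAt_symm hx).1 hf
  ext1 v
  apply tractorCoord_injective g hx
  have hfV : tractorInChart g x (f • V) =
      fun z => functionInChart E x f z • tractorInChart g x V z := funext fun z => tractorCoord_smul _ _ _ _ _
  have h3 : DifferentiableAt ℝ (tractorInChart g x (f • V)) (extChartAt 𝓘(ℝ, E) x x) := by
    rw [hfV]; exact h2.smul h1
  rw [add_apply, smul_apply, ContinuousLinearMap.smulRight_apply, tractorCoord_add, tractorCoord_smul, tractorCoord_smul]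
  simp only [tractorDerivL_apply]
  rw [tractorCoord_tractorDeriv g hx h3, tractorCoord_tractorDeriv g hx h1, hfV,
    LocalMetric.tractorDeriv_smul _ h2 h1, mvfderiv_eq_fderiv_comp_extChartAt_symm hx hf,
    tractorInChart, functionInChart, (extChartAt 𝓘(ℝ, E) x).left_inv hx]
  rfl

/-- The tractor connection of a scale on `ℰ[1] ⊕ ℰ_a[1] ⊕ ℰ[-1]`. -/
def splitTractorConnection (g : c.Scale) :
    CovariantDerivative 𝓘(ℝ, E) (TractorModel E) (SplitTractor c) where
  toFun := tractorDerivL g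
  isCovariantDerivativeOnUniv :=
    { add := fun hV hW _ => tractorDerivL_add g hV hW
      leibniz := fun hV hf _ => tractorDerivL_leibniz g hV hf }

theorem contMDiff_splitTractorConnection (g : c.Scale) :
    CovariantDerivative.ContMDiffCovariantDerivative (splitTractorConnection g) ∞ :=
  contMDiffCovariantDerivative_of_chartFrame _ fun _ hV x u =>
    contMDiffAt_trivializationAt_tractorDerivL g hV x u

/-- The identification of `[𝒯]_g` with `𝒯` for the reference scale, as a continuous linear map. -/
def ofRefScaleL (c : ConformalStructure E M p q) (x : M) : SplitTractor c x →L[ℝ] Tractor c x where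
  toLinearMap := (Tractor.ofScale c.refScale x).toLinearMap
  cont := by
    -- The fibre of `𝒯` has the topology induced by the inverse of this very map, so continuity is
    -- that of the identity.
    refine continuous_induced_rng.2 ?_
    convert continuous_id using 1
    ext1 V
    exact (Tractor.ofScale c.refScale x).symm_apply_apply V

theorem ofRefScaleL_apply (x : M) (V : SplitTractor c x) :
    ofRefScaleL c x V = Tractor.ofScale c.refScale x V := rfl

theorem mdifferentiableAt_ofScale_symm (g : c.Scale) {W : ∀ y, Tractor c y} {x : M}
    (hW : MDifferentiableAt 𝓘(ℝ, E) (𝓘(ℝ, E).prod 𝓘(ℝ, TractorModel E))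
      (fun y => TotalSpace.mk' (TractorModel E) y (W y)) x) :
    MDifferentiableAt 𝓘(ℝ, E) (𝓘(ℝ, E).prod 𝓘(ℝ, TractorModel E))
      (fun y => TotalSpace.mk' (TractorModel E) y ((Tractor.ofScale g y).symm (W y))) x :=
  ((contMDiff_ofScale_symm g).mdifferentiableAt (by simp)).comp x hW

/-- The standard tractor connection. -/
def tractorConnection (c : ConformalStructure E M p q) :
    CovariantDerivative 𝓘(ℝ, E) (TractorModel E) (Tractor c) where
  toFun W x := ofRefScaleL c x ∘L
    tractorDerivL c.refScale (fun y => (Tractor.ofScale c.refScale y).symm (W y)) x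
  isCovariantDerivativeOnUniv :=
    { add := fun {W W' x} hW hW' _ => by
        have h : (fun y => (Tractor.ofScale c.refScale y).symm ((W + W') y)) =
            (fun y => (Tractor.ofScale c.refScale y).symm (W y)) +
              fun y => (Tractor.ofScale c.refScale y).symm (W' y) :=
          funext fun y => map_add _ _ _
        rw [h, tractorDerivL_add _ (mdifferentiableAt_ofScale_symm _ hW)
          (mdifferentiableAt_ofScale_symm _ hW'), ContinuousLinearMap.comp_add]
      leibniz := fun {W f x} hW hf _ => by
        have h : (fun y => (Tractor.ofScale c.refScale y).symm ((f • W) y)) =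
            f • fun y => (Tractor.ofScale c.refScale y).symm (W y) :=
          funext fun y => map_smul (Tractor.ofScale c.refScale y).symm (f y) (W y)
        rw [h, tractorDerivL_leibniz _ (mdifferentiableAt_ofScale_symm _ hW) hf]
        ext1 v
        simp only [ContinuousLinearMap.comp_apply, add_apply, smul_apply, map_add, map_smul,
          ContinuousLinearMap.smulRight_apply, ofRefScaleL_apply, LinearEquiv.apply_symm_apply] }

theorem tractorConnection_apply (W : ∀ y, Tractor c y) (x : M) (v : TangentSpace 𝓘(ℝ, E) x) :
    tractorConnection c W x v = Tractor.ofScale c.refScale x (tractorDeriv c.refScale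
      (fun y => (Tractor.ofScale c.refScale y).symm (W y)) x v) := rfl

theorem contMDiff_tractorConnection :
    CovariantDerivative.ContMDiffCovariantDerivative (tractorConnection c) ∞ := by
  refine contMDiffCovariantDerivative_of_chartFrame _ fun W hW x u => ?_
  refine (contMDiffAt_trivializationAt_tractorDerivL c.refScale
    (contMDiff_ofScale_refScale_symm.comp hW) x u).congr_of_eventuallyEq
      (Eventually.of_forall fun y => ?_)
  change (trivializationAt (TractorModel E) (SplitTractor c) x ⟨y,
    (Tractor.ofScale c.refScale y).symm (Tractor.ofScale c.refScale y _)⟩).2 = _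
  rw [LinearEquiv.symm_apply_apply]
  rfl

/-- The standard tractor connection is given in every scale by the same formula. -/
theorem tractorConnection_ofScale (g : c.Scale) {V : ∀ y, SplitTractor c y} {x : M}
    (hV : MDifferentiableAt 𝓘(ℝ, E) (𝓘(ℝ, E).prod 𝓘(ℝ, TractorModel E))
      (fun y => TotalSpace.mk' (TractorModel E) y (V y)) x) (v : TangentSpace 𝓘(ℝ, E) x) :
    tractorConnection c (fun y => Tractor.ofScale g y (V y)) x v =
      Tractor.ofScale g x (tractorDeriv g V x v) := by
  obtain ⟨Ω, h⟩ := c.exists_rescaling g c.refScale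
  rw [tractorConnection_apply]
  -- Seen from the reference scale, the section given by `V` in the scale `g` is the shift of `V`,
  -- so conformal invariance finishes the proof.
  simp only [ofScale_eq_tractorShift h, LinearEquiv.symm_apply_apply]
  rw [tractorDeriv_tractorShift h hV]

/-- A connection that is given by the formula in one scale is the tractor connection. -/
theorem eq_tractorConnection (g : c.Scale)
    (D : CovariantDerivative 𝓘(ℝ, E) (TractorModel E) (Tractor c))
    (hD : ∀ (V : ∀ y, SplitTractor c y) (x : M),
      MDifferentiableAt 𝓘(ℝ, E) (𝓘(ℝ, E).prod 𝓘(ℝ, TractorModel E))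
        (fun y => TotalSpace.mk' (TractorModel E) y (V y)) x →
      ∀ v, D (fun y => Tractor.ofScale g y (V y)) x v =
        Tractor.ofScale g x (tractorDeriv g V x v)) {W : ∀ y, Tractor c y} {x : M}
    (hW : MDifferentiableAt 𝓘(ℝ, E) (𝓘(ℝ, E).prod 𝓘(ℝ, TractorModel E))
      (fun y => TotalSpace.mk' (TractorModel E) y (W y)) x) :
    D W x = tractorConnection c W x := by
  have hV := mdifferentiableAt_ofScale_symm g hW
  -- Every section of `𝒯` arises from a section of `[𝒯]_g` with the same differentiability at `x`,
  -- so the formula in one scale fixes the connection.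
  have hWV : W = fun y => Tractor.ofScale g y ((Tractor.ofScale g y).symm (W y)) :=
    funext fun y => ((Tractor.ofScale g y).apply_symm_apply (W y)).symm
  ext1 v
  rw [hWV, hD _ x hV, tractorConnection_ofScale g hV]

end TractorCovariantDerivative

/-! ### The four statements together. -/

theorem theorem4
    {E : Type*} [NormedAddCommGroup E] [NormedSpace ℝ E] [FiniteDimensional ℝ E]
    [Fact (3 ≤ Module.finrank ℝ E)]
    {M : Type*} [TopologicalSpace M] [T2Space M] [SecondCountableTopology M]
    [ChartedSpace E M] [IsManifold 𝓘(ℝ, E) ∞ M] {p q : ℕ} (c : ConformalStructure E M p q) :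
    -- in each scale the formula is a smooth linear connection on `ℰ[1] ⊕ ℰ_a[1] ⊕ ℰ[-1]`
    (∀ g : c.Scale, ∃ D : CovariantDerivative 𝓘(ℝ, E) (TractorModel E) (SplitTractor c),
      CovariantDerivative.ContMDiffCovariantDerivative D ∞ ∧
      ∀ (V : ∀ y, SplitTractor c y) (x : M),
        MDifferentiableAt 𝓘(ℝ, E) (𝓘(ℝ, E).prod 𝓘(ℝ, TractorModel E))
          (fun y => TotalSpace.mk' (TractorModel E) y (V y)) x →
        ∀ v, D V x v = tractorDeriv g V x v) ∧
    -- the formula intertwines with the conformal transformation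
    (∀ (g g' : c.Scale) (Ω : M → ℝ), IsRescaling Ω g.1 g'.1 →
      ∀ (V : ∀ y, SplitTractor c y) (x : M),
        MDifferentiableAt 𝓘(ℝ, E) (𝓘(ℝ, E).prod 𝓘(ℝ, TractorModel E))
          (fun y => TotalSpace.mk' (TractorModel E) y (V y)) x →
        ∀ v, tractorDeriv g' (fun y => tractorShift c (upsilon E Ω y) (V y)) x v =
          tractorShift c (upsilon E Ω x) (tractorDeriv g V x v)) ∧
    -- every scale identifies `ℰ[1] ⊕ ℰ_a[1] ⊕ ℰ[-1]` with `𝒯` as smooth vector bundles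
    (∀ g : c.Scale,
      ContMDiff (𝓘(ℝ, E).prod 𝓘(ℝ, TractorModel E)) (𝓘(ℝ, E).prod 𝓘(ℝ, TractorModel E)) ∞
        (fun z : TotalSpace (TractorModel E) (SplitTractor c) =>
          TotalSpace.mk' (TractorModel E) z.1 (Tractor.ofScale g z.1 z.2)) ∧
      ContMDiff (𝓘(ℝ, E).prod 𝓘(ℝ, TractorModel E)) (𝓘(ℝ, E).prod 𝓘(ℝ, TractorModel E)) ∞
        (fun z : TotalSpace (TractorModel E) (Tractor c) =>
          TotalSpace.mk' (TractorModel E) z.1 ((Tractor.ofScale g z.1).symm z.2))) ∧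
    -- there is a smooth linear connection on `𝒯` given in every scale by the formula,
    -- and the formula in any one scale already determines it
    ∃ D : CovariantDerivative 𝓘(ℝ, E) (TractorModel E) (Tractor c),
      CovariantDerivative.ContMDiffCovariantDerivative D ∞ ∧
      (∀ (g : c.Scale) (V : ∀ y, SplitTractor c y) (x : M),
        MDifferentiableAt 𝓘(ℝ, E) (𝓘(ℝ, E).prod 𝓘(ℝ, TractorModel E))
          (fun y => TotalSpace.mk' (TractorModel E) y (V y)) x →
        ∀ v, D (fun y => Tractor.ofScale g y (V y)) x v =
          Tractor.ofScale g x (tractorDeriv g V x v)) ∧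
      ∀ (g : c.Scale) (D' : CovariantDerivative 𝓘(ℝ, E) (TractorModel E) (Tractor c)),
        (∀ (V : ∀ y, SplitTractor c y) (x : M),
          MDifferentiableAt 𝓘(ℝ, E) (𝓘(ℝ, E).prod 𝓘(ℝ, TractorModel E))
            (fun y => TotalSpace.mk' (TractorModel E) y (V y)) x →
          ∀ v, D' (fun y => Tractor.ofScale g y (V y)) x v =
            Tractor.ofScale g x (tractorDeriv g V x v)) →
        ∀ (W : ∀ y, Tractor c y) (x : M),
          MDifferentiableAt 𝓘(ℝ, E) (𝓘(ℝ, E).prod 𝓘(ℝ, TractorModel E))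
            (fun y => TotalSpace.mk' (TractorModel E) y (W y)) x →
          D' W x = D W x :=
  ⟨fun g => ⟨splitTractorConnection g, contMDiff_splitTractorConnection g, fun _ _ _ _ => rfl⟩,
    fun _ _ _ h _ _ hV v => tractorDeriv_tractorShift h hV v,
    fun g => ⟨contMDiff_ofScale g, contMDiff_ofScale_symm g⟩,
    tractorConnection c, contMDiff_tractorConnection,
    fun g _ _ hV v => tractorConnection_ofScale g hV v,
    fun g D' hD _ _ hW => eq_tractorConnection g D' hD hW⟩
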